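/- Let $d\ge 1$ and consider the system $x_{k+1}=(A+\omega_k\bar A)x_k+(B+\omega_k\bar B)u_{k-d}$, $k\ge 0$, with state in $\mathbb R^n$, input in $\mathbb R^q$, known initial data $x_0,u_{-d},\dots,u_{-1}$, and scalar white noise: $(\omega_k)_{k\ge0}$ are independent with mean $0$ and variance $\sigma^2$. Let $\mathcal F_k$ be the augmented $\sigma$-algebra generated by $\omega_0,\dots,\omega_k$. For symmetric positive definite $Q_i,R_i$ $(i=0,\dots,p)$ and $c\in\mathbb R^p$ put $$\bar J_i(\mathbf u)=E\Big(\sum_{k\ge0}x_k^TQ_ix_k+\sum_{k\ge d}u_{k-d}^TR_iu_{k-d}\Big),\qquad \psi(\lambda)=\min_{\mathbf u}\Big(\bar J_0(\mathbf u)+\sum_{i=1}^p\lambda_i(\bar J_i(\mathbf u)-c_i)\Big),$$ the minimum being over square-integrable controls with $u_k$ $\mathcal F_{k-1}$-measurable for which $E(x_k^Tx_k)\to0$. Let $Q(\lambda)=Q_0+\sum_i\lambda_iQ_i$, $R(\lambda)=R_0+\sum_i\lambda_iR_i$. Assume that the system is mean-square stabilizable: for some matrix $K$ the feedback $u_{k-d}=K\,E[x_k\mid\mathcal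 F_{k-d-1}]$, $k\ge d$, gives $E(x_k^Tx_k)\to0$ for all initial data. (a) For every $\lambda\ge0$ (coordinatewise) the algebraic Riccati-ZXL equation $$Z=A^TZA+\sigma^2\bar A^TX\bar A+Q(\lambda)-L,\quad X=Z+\sum_{j=0}^{d-1}(A^T)^jLA^j,\quad L=M^T\Upsilon^{-1}M,$$ $$\Upsilon=B^TZB+\sigma^2\bar B^TX\bar B+R(\lambda),\quad M=B^TZA+\sigma^2\bar B^TX\bar A$$ has exactly one solution $(Z,X,L,\Upsilon,M)$ with $Z>0$; it has $\Upsilon>0$. The minimum $\psi(\lambda)$ is attained and, with $\hat x_{k|k-d}=A^kx_0+\sum_{j=0}^{k-1}A^{k-1-j}Bu_{j-d}$ for $0\le k<d$, equals the dual cost $$x_0^TZx_0-\sum_{k=0}^{d-1}u_{k-d}^TR(\lambda)u_{k-d}+\sum_{k=0}^{d-1}\Big[2u_{k-d}^TM\hat x_{k|k-d}+\hat x_{k|k-d}^TL\hat x_{k|k-d}+u_{k-d}^T\Upsilon u_{k-d}\Big]-\lambda^Tc .$$ (b) For every $\lambda\ge0$, the matrices $Z,X,L,\Upsilon,M$ have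 partial derivatives with respect to each $\lambda_i$ at $\lambda$ (within the orthant $\lambda\ge0$, so one-sided where $\lambda_i=0$), and these are the unique solution with $\nabla_{\lambda_i}Z,\nabla_{\lambda_i}X$ symmetric of the linear equations $$\nabla_{\lambda_i}Z=A^T\nabla_{\lambda_i}Z\,A+\sigma^2\bar A^T\nabla_{\lambda_i}X\,\bar A+Q_i-\nabla_{\lambda_i}L,\qquad \nabla_{\lambda_i}X=\nabla_{\lambda_i}Z+\sum_{j=0}^{d-1}(A^T)^j\nabla_{\lambda_i}L\,A^j,$$ $$\nabla_{\lambda_i}L=(\nabla_{\lambda_i}M)^T\Upsilon^{-1}M-M^T\Upsilon^{-1}\nabla_{\lambda_i}\Upsilon\,\Upsilon^{-1}M+M^T\Upsilon^{-1}\nabla_{\lambda_i}M,$$ $$\nabla_{\lambda_i}\Upsilon=B^T\nabla_{\lambda_i}Z\,B+\sigma^2\bar B^T\nabla_{\lambda_i}X\,\bar B+R_i,\qquad \nabla_{\lambda_i}M=B^T\nabla_{\lambda_i}Z\,A+\sigma^2\bar B^T\nabla_{\lambda_i}X\,\bar A .$$ (c) The dual cost is differentiable on the orthant $\lambda\ge0$,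 and the $i$-th component of its gradient at $\lambda$ is $$g_i(\lambda)=x_0^T\nabla_{\lambda_i}Z\,x_0-\sum_{k=0}^{d-1}u_{k-d}^TR_iu_{k-d}+\sum_{k=0}^{d-1}\Big[2u_{k-d}^T(B^T\nabla_{\lambda_i}Z\,A+\sigma^2\bar B^T\nabla_{\lambda_i}X\,\bar A)\hat x_{k|k-d}+\hat x_{k|k-d}^T\nabla_{\lambda_i}L\,\hat x_{k|k-d}+u_{k-d}^T(B^T\nabla_{\lambda_i}Z\,B+\sigma^2\bar B^T\nabla_{\lambda_i}X\,\bar B+R_i)u_{k-d}\Big]-c_i .$$ (d) Consequently, for every learning rate $\alpha>0$ and every $\lambda^n\ge0$, the projected gradient-ascent step for maximizing the dual cost over $\lambda\ge0$ (the Euclidean projection of $\lambda^n+\alpha g(\lambda^n)$ onto the orthant) is exactly the update $\lambda_i^{n+1}=\max\{0,\lambda_i^n+\alpha g_i(\lambda^n)\}$, $i=1,\dots,p$, with $g_i(\lambda^n)$ computed from the linear equations in (b). -/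

import Mathlib

open MeasureTheory ProbabilityTheory Filter Topology Matrix

/-- The coefficients of the delayed system with scalar multiplicative noise
`x (k+1) = (A + ω k • Ab) x k + (B + ω k • Bb) u (k - d)`, where `ω k` has variance `σ ^ 2`. -/
structure DelaySystem (n m : ℕ) where
  A : Matrix (Fin n) (Fin n) ℝ
  Ab : Matrix (Fin n) (Fin n) ℝ
  B : Matrix (Fin n) (Fin m) ℝ
  Bb : Matrix (Fin n) (Fin m) ℝ
  σ : ℝ

/-- The weights of the cost (`Q₀`, `R₀`) and of the `p` constraints (`Q i`, `R i`), with the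
constraint levels `c i`. -/
structure QuadData (n m p : ℕ) where
  Q₀ : Matrix (Fin n) (Fin n) ℝ
  R₀ : Matrix (Fin m) (Fin m) ℝ
  Q : Fin p → Matrix (Fin n) (Fin n) ℝ
  R : Fin p → Matrix (Fin m) (Fin m) ℝ
  c : Fin p → ℝ

/-- All weighting matrices are (symmetric) positive definite. -/
structure QuadData.Positive {n m p : ℕ} (W : QuadData n m p) : Prop where
  Q₀ : W.Q₀.PosDef
  R₀ : W.R₀.PosDef
  Q : ∀ i, (W.Q i).PosDef
  R : ∀ i, (W.R i).PosDef

/-- `Q(lam) = Q₀ + ∑ i, lam i Q i`. -/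
def QuadData.Qlam {n m p : ℕ} (W : QuadData n m p) (lam : Fin p → ℝ) :
    Matrix (Fin n) (Fin n) ℝ := W.Q₀ + ∑ i, lam i • W.Q i

/-- `R(lam) = R₀ + ∑ i, lam i R i`. -/
def QuadData.Rlam {n m p : ℕ} (W : QuadData n m p) (lam : Fin p → ℝ) :
    Matrix (Fin m) (Fin m) ℝ := W.R₀ + ∑ i, lam i • W.R i

/-- The known initial data: `x 0` and the inputs `u (-d), …, u (-1)`; `uPre k` is `u (k - d)`. -/
structure InitialData (n m d : ℕ) where
  x₀ : Fin n → ℝ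
  uPre : Fin d → Fin m → ℝ

section Stochastic

variable {Ω : Type*} [MeasurableSpace Ω]

/-- Scalar white noise with mean zero and variance `σ ^ 2`. -/
structure IsWhiteNoise (P : Measure Ω) (w : ℕ → Ω → ℝ) (σ : ℝ) : Prop where
  measurable : ∀ k, Measurable (w k)
  indep : iIndepFun w P
  memLp : ∀ k, MemLp (w k) 2 P
  mean : ∀ k, ∫ s, w k s ∂P = 0
  variance : ∀ k, ∫ s, (w k s) ^ 2 ∂P = σ ^ 2

/-- The sigma-algebra `ℱ (k-1)` generated by `w 0, …, w (k-1)` (trivial for `k = 0`). -/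
abbrev past (w : ℕ → Ω → ℝ) (k : ℕ) : MeasurableSpace Ω :=
  ⨆ i : Fin k, MeasurableSpace.comap (w i) inferInstance

variable {n m d : ℕ}

/-- The input `u (k - d)` acting at time `k`: known for `k < d`, chosen by the controller
for `k ≥ d`. -/
def delayedInput (I : InitialData n m d) (u : ℕ → Ω → Fin m → ℝ) (k : ℕ) (s : Ω) : Fin m → ℝ :=
  if h : k < d then I.uPre ⟨k, h⟩ else u (k - d) s

/-- The state process. -/
def DelaySystem.state (S : DelaySystem n m) (w : ℕ → Ω → ℝ) (I : InitialData n m d)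
    (u : ℕ → Ω → Fin m → ℝ) : ℕ → Ω → Fin n → ℝ
  | 0, _ => I.x₀
  | k + 1, s => (S.A + w k s • S.Ab) *ᵥ S.state w I u k s
      + (S.B + w k s • S.Bb) *ᵥ delayedInput I u k s

/-- Square-integrable inputs such that `u k` is measurable for the `P`-augmentation of
`ℱ (k-1)`, i.e. almost everywhere equal to an `ℱ (k-1)`-measurable map. -/
def IsAdaptedInput (P : Measure Ω) (w : ℕ → Ω → ℝ) (u : ℕ → Ω → Fin m → ℝ) : Prop :=
  ∀ k, AEStronglyMeasurable[past w k] (u k) P ∧ MemLp (u k) 2 P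

/-- `E (x kᵀ x k) → 0`. -/
def DelaySystem.StableUnder (S : DelaySystem n m) (P : Measure Ω) (w : ℕ → Ω → ℝ)
    (I : InitialData n m d) (u : ℕ → Ω → Fin m → ℝ) : Prop :=
  Tendsto (fun k => ∫ s, S.state w I u k s ⬝ᵥ S.state w I u k s ∂P) atTop (𝓝 0)

/-- Mean-square stabilizability with delay `d`: there is a gain `K` such that, from every initial
condition, the feedback `u (k - d) = K E[x k | ℱ (k-d-1)]`, `k ≥ d`, makes `E (x kᵀ x k) → 0`. -/
def DelaySystem.MeanSquareStabilizable (S : DelaySystem n m) (d : ℕ) (P : Measure Ω)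
    (w : ℕ → Ω → ℝ) : Prop :=
  ∃ K : Matrix (Fin m) (Fin n) ℝ, ∀ I : InitialData n m d, ∃ u : ℕ → Ω → Fin m → ℝ,
    IsAdaptedInput P w u ∧
    (∀ k, u k =ᵐ[P] fun s => K *ᵥ (P[S.state w I u (k + d) | past w k]) s) ∧
    S.StableUnder P w I u

/-- The admissible controls of the infinite-horizon problem. -/
def DelaySystem.Admissible (S : DelaySystem n m) (P : Measure Ω) (w : ℕ → Ω → ℝ)
    (I : InitialData n m d) : Set (ℕ → Ω → Fin m → ℝ) :=
  {u | IsAdaptedInput P w u ∧ S.StableUnder P w I u}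

/-- `E (∑ k ≥ 0, x kᵀ Q x k + ∑ k ≥ d, u (k-d)ᵀ R u (k-d))`, possibly infinite. -/
noncomputable def DelaySystem.cost (S : DelaySystem n m) (P : Measure Ω) (w : ℕ → Ω → ℝ)
    (I : InitialData n m d) (Q : Matrix (Fin n) (Fin n) ℝ) (R : Matrix (Fin m) (Fin m) ℝ)
    (u : ℕ → Ω → Fin m → ℝ) : ENNReal :=
  ∫⁻ s, (∑' k, ENNReal.ofReal (S.state w I u k s ⬝ᵥ (Q *ᵥ S.state w I u k s))
    + ∑' k, ENNReal.ofReal (u k s ⬝ᵥ (R *ᵥ u k s))) ∂P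

/-- The Lagrangian `J₀(u) + ∑ i, lam i (J i (u) - c i)`. -/
noncomputable def DelaySystem.lagrangian {p : ℕ} (S : DelaySystem n m) (W : QuadData n m p)
    (P : Measure Ω) (w : ℕ → Ω → ℝ) (I : InitialData n m d) (lam : Fin p → ℝ)
    (u : ℕ → Ω → Fin m → ℝ) : EReal :=
  (S.cost P w I W.Q₀ W.R₀ u : EReal)
    + ∑ i, (lam i : EReal) * ((S.cost P w I (W.Q i) (W.R i) u : EReal) - (W.c i : EReal))

/-- The dual function `ψ(lam) = inf_u J(lam, u)`. -/
noncomputable def DelaySystem.dualFunction {p : ℕ} (S : DelaySystem n m) (W : QuadData n m p)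
    (P : Measure Ω) (w : ℕ → Ω → ℝ) (I : InitialData n m d) (lam : Fin p → ℝ) : EReal :=
  ⨅ u ∈ S.Admissible P w I, S.lagrangian W P w I lam u

end Stochastic

/-- A tuple of matrices `(Z, X, L, Υ, M)`; used for solutions of the Riccati-ZXL equation and
for their partial derivatives. -/
@[ext] structure ZXL (n m : ℕ) where
  Z : Matrix (Fin n) (Fin n) ℝ
  X : Matrix (Fin n) (Fin n) ℝ
  L : Matrix (Fin n) (Fin n) ℝ
  Υ : Matrix (Fin m) (Fin m) ℝ
  M : Matrix (Fin m) (Fin n) ℝ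

section Riccati

variable {n m p d : ℕ}

/-- `T` is a solution with `Z > 0` of the algebraic Riccati-ZXL equation with weights `Q`, `R`
and delay `d`. -/
structure DelaySystem.IsZXLSolution (S : DelaySystem n m) (d : ℕ)
    (Q : Matrix (Fin n) (Fin n) ℝ) (R : Matrix (Fin m) (Fin m) ℝ) (T : ZXL n m) : Prop where
  pos : T.Z.PosDef
  eqZ : T.Z = S.Aᵀ * T.Z * S.A + S.σ ^ 2 • (S.Abᵀ * T.X * S.Ab) + Q - T.L
  eqX : T.X = T.Z + ∑ j ∈ Finset.range d, (S.Aᵀ) ^ j * T.L * S.A ^ j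
  eqL : T.L = T.Mᵀ * T.Υ⁻¹ * T.M
  eqΥ : T.Υ = S.Bᵀ * T.Z * S.B + S.σ ^ 2 • (S.Bbᵀ * T.X * S.Bb) + R
  eqM : T.M = S.Bᵀ * T.Z * S.A + S.σ ^ 2 • (S.Bbᵀ * T.X * S.Ab)

/-- `D = (∇Z, ∇X, ∇L, ∇Υ, ∇M)`, with symmetric `∇Z` and `∇X`, solves the linear equations obtained
by differentiating the Riccati-ZXL equation at `T` in a direction in which the derivatives of the
weights are `Q'`, `R'`. -/
structure DelaySystem.IsGradientSolution (S : DelaySystem n m) (d : ℕ)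
    (Q' : Matrix (Fin n) (Fin n) ℝ) (R' : Matrix (Fin m) (Fin m) ℝ) (T D : ZXL n m) : Prop where
  symmZ : D.Z.IsSymm
  symmX : D.X.IsSymm
  eqZ : D.Z = S.Aᵀ * D.Z * S.A + S.σ ^ 2 • (S.Abᵀ * D.X * S.Ab) + Q' - D.L
  eqX : D.X = D.Z + ∑ j ∈ Finset.range d, (S.Aᵀ) ^ j * D.L * S.A ^ j
  eqL : D.L = D.Mᵀ * T.Υ⁻¹ * T.M - T.Mᵀ * T.Υ⁻¹ * D.Υ * T.Υ⁻¹ * T.M + T.Mᵀ * T.Υ⁻¹ * D.M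
  eqΥ : D.Υ = S.Bᵀ * D.Z * S.B + S.σ ^ 2 • (S.Bbᵀ * D.X * S.Bb) + R'
  eqM : D.M = S.Bᵀ * D.Z * S.A + S.σ ^ 2 • (S.Bbᵀ * D.X * S.Ab)

/-- `x̂ (k | k-d) = A ^ k x₀ + ∑ j < k, A ^ (k-1-j) B u (j-d)` for `k < d`. -/
def DelaySystem.predictor (S : DelaySystem n m) (I : InitialData n m d) (k : Fin d) :
    Fin n → ℝ :=
  (S.A ^ (k : ℕ)) *ᵥ I.x₀
    + ∑ j ∈ Finset.Iio k, (S.A ^ ((k : ℕ) - 1 - (j : ℕ)) * S.B) *ᵥ I.uPre j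

/-- The expression
`x₀ᵀ Z x₀ - ∑ uᵀ R u + ∑ (2 uᵀ (Bᵀ Z A + σ² Bbᵀ X Ab) x̂ + x̂ᵀ L x̂ + uᵀ (Bᵀ Z B + σ² Bbᵀ X Bb + R) u)`,
the sums running over `k = 0, …, d-1` with `u = u (k-d)` and `x̂ = x̂ (k | k-d)`. -/
def DelaySystem.quadExpr (S : DelaySystem n m) (I : InitialData n m d)
    (R : Matrix (Fin m) (Fin m) ℝ) (T : ZXL n m) : ℝ :=
  I.x₀ ⬝ᵥ (T.Z *ᵥ I.x₀) - ∑ k, I.uPre k ⬝ᵥ (R *ᵥ I.uPre k)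
    + ∑ k, (2 * (I.uPre k ⬝ᵥ
          ((S.Bᵀ * T.Z * S.A + S.σ ^ 2 • (S.Bbᵀ * T.X * S.Ab)) *ᵥ S.predictor I k))
        + S.predictor I k ⬝ᵥ (T.L *ᵥ S.predictor I k)
        + I.uPre k ⬝ᵥ ((S.Bᵀ * T.Z * S.B + S.σ ^ 2 • (S.Bbᵀ * T.X * S.Bb) + R) *ᵥ I.uPre k))

/-- The dual cost at `lam`, written with the solution `T` of the Riccati-ZXL equation at `lam`. -/
def DelaySystem.dualCost (S : DelaySystem n m) (W : QuadData n m p) (I : InitialData n m d)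
    (lam : Fin p → ℝ) (T : ZXL n m) : ℝ :=
  S.quadExpr I (W.Rlam lam) T - ∑ i, lam i * W.c i

/-- The formula for the `i`-th gradient component of the dual cost, written with the solution `D`
of the linear equations belonging to `lam i`. -/
def DelaySystem.dualGrad (S : DelaySystem n m) (W : QuadData n m p) (I : InitialData n m d)
    (i : Fin p) (D : ZXL n m) : ℝ :=
  S.quadExpr I (W.R i) D - W.c i

/-- `F'` is the partial derivative (entry by entry) of the matrix function `F` with respect to the
`i`-th coordinate at `lam`, within the orthant `lam ≥ 0` (one-sided where `lam i = 0`). -/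
def HasMatrixPartial {a b : ℕ} (F : (Fin p → ℝ) → Matrix (Fin a) (Fin b) ℝ)
    (F' : Matrix (Fin a) (Fin b) ℝ) (i : Fin p) (lam : Fin p → ℝ) : Prop :=
  ∀ r s, HasDerivWithinAt (fun t => F (Function.update lam i t) r s) (F' r s)
    (Set.Ici 0) (lam i)

/-- `g` is the gradient at `lam` of `f`, as a function on the orthant `lam ≥ 0`. -/
def HasOrthantGradient (f : (Fin p → ℝ) → ℝ) (g lam : Fin p → ℝ) : Prop :=
  HasFDerivWithinAt f (∑ i, g i • ContinuousLinearMap.proj (R := ℝ) (φ := fun _ : Fin p => ℝ) i)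
    (Set.Ici 0) lam

/-- `lam'` is obtained from `lam` by one step of gradient ascent for `f` with learning rate `α`
followed by Euclidean projection onto the orthant. -/
def IsProjectedGradientStep (f : (Fin p → ℝ) → ℝ) (α : ℝ) (lam lam' : Fin p → ℝ) : Prop :=
  ∃ g, HasOrthantGradient f g lam ∧ 0 ≤ lam' ∧
    ∀ μ : Fin p → ℝ, 0 ≤ μ →
      ∑ i, (lam i + α * g i - lam' i) ^ 2 ≤ ∑ i, (lam i + α * g i - μ i) ^ 2

/-- The update `lam' i = max {0, lam i + α (…)}` in which the increment is computed from the linear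
equations at the solution `T` of the Riccati-ZXL equation at `lam`. -/
def DelaySystem.IsRiccatiStep (S : DelaySystem n m) (W : QuadData n m p) (I : InitialData n m d)
    (T : ZXL n m) (α : ℝ) (lam lam' : Fin p → ℝ) : Prop :=
  ∀ i, ∃ D : ZXL n m, S.IsGradientSolution d (W.Q i) (W.R i) T D ∧
    lam' i = max 0 (lam i + α * S.dualGrad W I i D)

end Riccati

/-! ### Loewner order on real matrices: traces, scaling, limits. -/

section LoewnerOrder

open scoped MatrixOrder

variable {ι κ : Type*}

/-! Split the state at time `k` into the part `known`, determined by the noise available to the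
controller of the input acting at time `k`, and the `d` parts `innov k j`, `j < d`, each caused by
the noise of the single time `k - 1 - j`. These parts are mutually orthogonal. In one step each
innovation ages by one, the oldest is absorbed into the known part, and a fresh one of variance `σ ^
2` is created by the whole state. Second moments therefore evolve linearly. Dually, a tuple `C` of
`d + 1` weights (index `d` for the known part, index `j < d` for age `j`) is transported by a
positive linear operator `lyap`, in which the control enters only through row `d`. The delayed
problem thus becomes a delay-free one for tuples. Minimizing over the gain in row `d` gives the
operator `riccati`, and the Riccati-ZXL equation is its fixed-point equation with `Z = C d`, `X = C
0` and `L` the completed-square term; `weights` and `toZXL` translate between the two.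

Existence: stabilizability makes the iterates of the closed-loop `lyap` tend to zero, so a finite
sum of them is a strict Lyapunov certificate. A multiple of it is a supersolution of the monotone
map `riccati`, from which iteration decreases to a fixed point. Uniqueness and monotonicity in the
weights rest on one comparison principle, `nonpos_of_le_apply`: if a monotone linear `F` strictly
decreases some positive definite tuple, then `D ≤ F D` forces `D ≤ 0`. A solution of the Riccati
equation is itself such a tuple for its own feedback.

Differentiability uses order as well. By homogeneity and monotonicity, `C μ ≤ (1 + c ‖μ - ν‖) C ν`,
so the solution is Lipschitz. Freezing the optimal gain at `lam` turns the equation at `μ` into an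
affine one, up to a completed square in the gain error, which is of second order. The comparison
principle then bounds the remainder of the first-order expansion by `‖μ - lam‖ ^ 2`
(`isBigO_remainder`). This is an envelope argument: the derivative of the gain never enters, and the
linear equations for the gradients are the closed-loop Lyapunov equation in other variables
(`linearized_last`).

For the dual function, completing the square in every step (`sum_cost_eq`) writes the finite-horizon
cost as the dual expression plus nonnegative squares minus the terminal energy. The energy vanishes
for admissible controls, and the optimal feedback makes the squares vanish. The projected step is
then the coordinatewise positive part, because the gradient on the orthant is unique. -/

lemma Matrix.smul_nonneg' {X : Matrix ι ι ℝ} (h : 0 ≤ X) {c : ℝ} (hc : 0 ≤ c) : 0 ≤ c • X :=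
  (h.posSemidef.smul hc).nonneg

lemma Matrix.smul_mono_right {X Y : Matrix ι ι ℝ} (h : X ≤ Y) {c : ℝ} (hc : 0 ≤ c) :
    c • X ≤ c • Y := by
  rw [← sub_nonneg] at h ⊢
  rw [← smul_sub]
  exact smul_nonneg' h hc

lemma Matrix.smul_mono_left {X : Matrix ι ι ℝ} (h : 0 ≤ X) {c c' : ℝ} (hc : c ≤ c') :
    c • X ≤ c' • X := by
  rw [← sub_nonneg, ← sub_smul]
  exact smul_nonneg' h (sub_nonneg.2 hc)

lemma Matrix.PosDef.of_le {A B : Matrix ι ι ℝ} (hA : A.PosDef) (h : A ≤ B) : B.PosDef := by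
  have := hA.add_posSemidef (sub_nonneg.2 h).posSemidef
  rwa [add_sub_cancel] at this

variable [Fintype ι] [Fintype κ]

lemma Matrix.nonneg_iff_forall {A : Matrix ι ι ℝ} :
    0 ≤ A ↔ A.IsSymm ∧ ∀ x, 0 ≤ x ⬝ᵥ (A *ᵥ x) := by
  rw [nonneg_iff_posSemidef, posSemidef_iff_dotProduct_mulVec]
  simp [IsHermitian, IsSymm, conjTranspose_eq_transpose_of_trivial]

lemma Matrix.isSymm_of_nonneg {A : Matrix ι ι ℝ} (h : 0 ≤ A) : A.IsSymm :=
  (nonneg_iff_forall.1 h).1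

lemma Matrix.dotProduct_mulVec_mono {A B : Matrix ι ι ℝ} (h : A ≤ B) (x : ι → ℝ) :
    x ⬝ᵥ (A *ᵥ x) ≤ x ⬝ᵥ (B *ᵥ x) := by
  have := (nonneg_iff_forall.1 (sub_nonneg.2 h)).2 x
  rw [sub_mulVec, dotProduct_sub] at this
  linarith

lemma Matrix.le_of_forall_dotProduct {A B : Matrix ι ι ℝ} (hA : A.IsSymm) (hB : B.IsSymm)
    (h : ∀ x, x ⬝ᵥ (A *ᵥ x) ≤ x ⬝ᵥ (B *ᵥ x)) : A ≤ B := by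
  rw [← sub_nonneg, nonneg_iff_forall]
  refine ⟨hB.sub hA, fun x => ?_⟩
  rw [sub_mulVec, dotProduct_sub]
  linarith [h x]

lemma Matrix.conj_nonneg {X : Matrix ι ι ℝ} (h : 0 ≤ X) (A : Matrix ι κ ℝ) :
    0 ≤ Aᵀ * X * A := by
  have := h.posSemidef.conjTranspose_mul_mul_same A
  rw [conjTranspose_eq_transpose_of_trivial] at this
  exact this.nonneg

lemma Matrix.conj_mono {X Y : Matrix ι ι ℝ} (h : X ≤ Y) (A : Matrix ι κ ℝ) :
    Aᵀ * X * A ≤ Aᵀ * Y * A := by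
  rw [← sub_nonneg] at h ⊢
  have := conj_nonneg h A
  rwa [Matrix.mul_sub, Matrix.sub_mul] at this

lemma Matrix.transpose_mul_self_nonneg (A : Matrix κ ι ℝ) : 0 ≤ Aᵀ * A := by
  have := posSemidef_conjTranspose_mul_self A
  rw [conjTranspose_eq_transpose_of_trivial] at this
  exact this.nonneg

/-- Symmetry and each inequality `0 ≤ x ⬝ᵥ (A *ᵥ x)` are closed conditions. Used as a local instance
to pass to limits in matrix inequalities. -/
lemma Matrix.orderClosedTopology : OrderClosedTopology (Matrix ι ι ℝ) where
  isClosed_le' := by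
    have : {p : Matrix ι ι ℝ × Matrix ι ι ℝ | p.1 ≤ p.2}
        = {p | (p.2 - p.1)ᵀ = p.2 - p.1} ∩ ⋂ x, {p | 0 ≤ x ⬝ᵥ ((p.2 - p.1) *ᵥ x)} := by
      ext p
      simp only [Set.mem_ofPred_eq, Set.mem_inter_iff, Set.mem_iInter]
      rw [← sub_nonneg, nonneg_iff_forall]; rfl
    rw [this]
    refine (isClosed_eq (by fun_prop) (by fun_prop)).inter (isClosed_iInter fun x =>
      isClosed_le continuous_const ?_)
    exact continuous_const.dotProduct ((continuous_snd.sub continuous_fst).matrix_mulVec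
      continuous_const)

variable [DecidableEq ι]

/-- Cauchy–Schwarz applied to each row: the trace is the squared Frobenius norm. -/
lemma Matrix.transpose_mul_self_le_trace (A : Matrix κ ι ℝ) :
    Aᵀ * A ≤ (Aᵀ * A).trace • (1 : Matrix ι ι ℝ) := by
  refine le_of_forall_dotProduct (by simp [IsSymm]) (by simp [IsSymm]) fun x => ?_
  rw [← mulVec_mulVec, dotProduct_mulVec, vecMul_transpose, smul_mulVec, one_mulVec,
    dotProduct_smul, smul_eq_mul]
  have h : (Aᵀ * A).trace = ∑ k, ∑ i, A k i ^ 2 := by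
    simp only [trace, diag, mul_apply, transpose_apply]
    rw [Finset.sum_comm]
    simp [sq]
  rw [h, Finset.sum_mul]
  simp only [dotProduct, mulVec]
  refine Finset.sum_le_sum fun k _ => ?_
  have := Finset.sum_mul_sq_le_sq_mul_sq Finset.univ (A k) x
  calc _ = (∑ i, A k i * x i) ^ 2 := by ring
    _ ≤ _ := this
    _ = _ := by simp [sq]

lemma Matrix.le_trace_smul_one {A : Matrix ι ι ℝ} (h : 0 ≤ A) :
    A ≤ A.trace • (1 : Matrix ι ι ℝ) := by
  obtain ⟨X, rfl⟩ := CStarAlgebra.nonneg_iff_eq_star_mul_self.mp h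
  rw [star_eq_conjTranspose, conjTranspose_eq_transpose_of_trivial]
  exact transpose_mul_self_le_trace X

lemma Matrix.PosDef.exists_smul_one_le {A : Matrix ι ι ℝ} (hA : A.PosDef) :
    ∃ c : ℝ, 0 < c ∧ c • (1 : Matrix ι ι ℝ) ≤ A := by
  have hi := hA.inv.posSemidef.nonneg
  have hu : IsUnit A.det := (isUnit_iff_isUnit_det A).1 hA.isUnit
  -- `t` dominates `A⁻¹`; the summand 1 keeps it positive even when the index type is empty.
  -- Conjugating `A⁻¹ ≥ 0` by `A - t⁻¹ • 1` gives `A ≥ 2 t⁻¹ - t⁻² A⁻¹ ≥ t⁻¹`.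
  set t := A⁻¹.trace + 1 with ht
  have htp : 0 < t := by have := hA.inv.posSemidef.trace_nonneg; linarith
  have h1 : A⁻¹ ≤ t • (1 : Matrix ι ι ℝ) :=
    (le_trace_smul_one hi).trans (smul_mono_left PosSemidef.one.nonneg (by linarith))
  refine ⟨t⁻¹, inv_pos.2 htp, ?_⟩
  have hs : Aᵀ = A := isSymm_of_nonneg hA.posSemidef.nonneg
  have h2 := conj_nonneg hi (A - t⁻¹ • (1 : Matrix ι ι ℝ))
  have h3 : (A - t⁻¹ • (1 : Matrix ι ι ℝ))ᵀ * A⁻¹ * (A - t⁻¹ • (1 : Matrix ι ι ℝ))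
      = A - (2 * t⁻¹) • (1 : Matrix ι ι ℝ) + t⁻¹ ^ 2 • A⁻¹ := by
    simp only [transpose_sub, hs, transpose_smul, transpose_one, Matrix.sub_mul, Matrix.mul_sub,
      mul_nonsing_inv _ hu, nonsing_inv_mul _ hu, Matrix.smul_mul, Matrix.mul_smul,
      Matrix.one_mul, Matrix.mul_one]
    module
  rw [h3] at h2
  have h4 := smul_mono_right h1 (sq_nonneg t⁻¹)
  have h5 : (t⁻¹ ^ 2) • t • (1 : Matrix ι ι ℝ) = t⁻¹ • (1 : Matrix ι ι ℝ) := by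
    rw [smul_smul]; congr 1; field_simp
  rw [h5] at h4
  rw [← sub_nonneg] at h4 ⊢
  have := add_nonneg h2 h4
  convert this using 1
  module

lemma Matrix.IsSymm.exists_le_smul {A B : Matrix ι ι ℝ} (hB : B.IsSymm) (hA : A.PosDef) :
    ∃ c : ℝ, 0 < c ∧ B ≤ c • A := by
  obtain ⟨ε, hε, hεA⟩ := hA.exists_smul_one_le
  set r := (Bᵀ * B).trace with hr
  have hr0 : 0 ≤ r := (transpose_mul_self_nonneg B).posSemidef.trace_nonneg
  have h1 := transpose_mul_self_le_trace B
  have h2 := transpose_mul_self_nonneg (1 - B)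
  -- From `(1 - B) ^ 2 ≥ 0` one gets `2 B ≤ 1 + B ^ 2`, and `B ^ 2` is at most its trace `r`.
  have h3 : B ≤ (1 + r) • (1 : Matrix ι ι ℝ) := by
    have hB2 := transpose_mul_self_nonneg B
    rw [transpose_sub, transpose_one, hB.eq, Matrix.sub_mul, Matrix.one_mul, Matrix.mul_sub,
      Matrix.mul_one] at h2
    rw [hB.eq] at h1
    rw [← sub_nonneg] at h1 ⊢
    have h4 := add_nonneg (add_nonneg h2 h1)
      (smul_nonneg' (PosSemidef.one (n := ι) (R := ℝ)).nonneg (by linarith : 0 ≤ 1 + r))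
    have h5 := smul_nonneg' h4 (by norm_num : (0 : ℝ) ≤ 1 / 2)
    convert h5 using 1
    rw [hr, hB.eq]
    module
  refine ⟨(1 + r) / ε, by positivity, h3.trans ?_⟩
  have := smul_mono_right hεA (by positivity : 0 ≤ (1 + r) / ε)
  rwa [smul_smul, div_mul_cancel₀ _ hε.ne'] at this

lemma Matrix.dotProduct_single_mulVec (A : Matrix ι ι ℝ) (i j : ι) :
    Pi.single i (1 : ℝ) ⬝ᵥ (A *ᵥ Pi.single j 1) = A i j := by simp

lemma Matrix.IsSymm.apply_eq_quadratic {A : Matrix ι ι ℝ} (hA : A.IsSymm) (i j : ι) :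
    A i j = ((Pi.single i (1 : ℝ) + Pi.single j 1) ⬝ᵥ (A *ᵥ (Pi.single i (1 : ℝ) + Pi.single j 1))
      - Pi.single i (1 : ℝ) ⬝ᵥ (A *ᵥ Pi.single i 1)
      - Pi.single j (1 : ℝ) ⬝ᵥ (A *ᵥ Pi.single j 1)) / 2 := by
  have := hA.apply i j
  simp only [mulVec_add, add_dotProduct, dotProduct_add, dotProduct_single_mulVec]
  rw [this]; ring

lemma Matrix.abs_apply_le_of_nonneg {A : Matrix ι ι ℝ} (h : 0 ≤ A) (i j : ι) :
    |A i j| ≤ (A i i + A j j) / 2 := by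
  have hs := (isSymm_of_nonneg h).apply i j
  have h1 := (nonneg_iff_forall.1 h).2 (Pi.single i (1 : ℝ) + Pi.single j 1)
  have h2 := (nonneg_iff_forall.1 h).2 (Pi.single i (1 : ℝ) - Pi.single j 1)
  simp only [mulVec_add, mulVec_sub, add_dotProduct, sub_dotProduct, dotProduct_sub,
    dotProduct_add, dotProduct_single_mulVec] at h1 h2
  rw [abs_le]; constructor <;> linarith

lemma Matrix.apply_self_mono {A B : Matrix ι ι ℝ} (h : A ≤ B) (i : ι) : A i i ≤ B i i := by
  have := dotProduct_mulVec_mono h (Pi.single i 1)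
  simpa only [dotProduct_single_mulVec] using this

/-- Polarization recovers the entries of a symmetric matrix from its quadratic form. -/
lemma Matrix.tendsto_of_tendsto_quadratic {A : ℕ → Matrix ι ι ℝ} (hs : ∀ k, (A k).IsSymm)
    (h : ∀ x, ∃ l, Tendsto (fun k => x ⬝ᵥ (A k *ᵥ x)) atTop (𝓝 l)) :
    ∃ L, Tendsto A atTop (𝓝 L) := by
  choose q hq using h
  refine ⟨fun i j => (q (Pi.single i (1 : ℝ) + Pi.single j 1) - q (Pi.single i 1)
    - q (Pi.single j 1)) / 2, ?_⟩
  refine tendsto_pi_nhds.2 fun i => tendsto_pi_nhds.2 fun j => ?_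
  have := (((hq (Pi.single i (1 : ℝ) + Pi.single j 1)).sub (hq (Pi.single i 1))).sub
    (hq (Pi.single j 1))).div_const 2
  exact this.congr fun k => ((hs k).apply_eq_quadratic i j).symm

lemma Matrix.exists_tendsto_of_antitone {A : ℕ → Matrix ι ι ℝ} (hA : Antitone A)
    (h0 : ∀ k, 0 ≤ A k) : ∃ L, Tendsto A atTop (𝓝 L) := by
  refine tendsto_of_tendsto_quadratic (fun k => isSymm_of_nonneg (h0 k)) fun x =>
    ⟨_, tendsto_atTop_ciInf (fun i j hij => dotProduct_mulVec_mono (hA hij) x) ⟨0, ?_⟩⟩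
  rintro _ ⟨k, rfl⟩
  exact (nonneg_iff_forall.1 (h0 k)).2 x

end LoewnerOrder

/-! ### Positive linear operators on tuples: contraction, comparison, monotone iteration. -/

section PositiveOperators

open scoped MatrixOrder

attribute [local instance] Matrix.orderClosedTopology

variable {J ι : Type*} [Fintype J] [Fintype ι] [DecidableEq ι]

lemma exists_le_smul_tuple {C P : J → Matrix ι ι ℝ} (hC : ∀ j, (C j).IsSymm)
    (hP : ∀ j, (P j).PosDef) : ∃ c : ℝ, 1 ≤ c ∧ C ≤ c • P := by
  choose c hc0 hc using fun j => (hC j).exists_le_smul (hP j)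
  refine ⟨1 + ∑ j, c j, by linarith [Finset.sum_nonneg fun j (_ : j ∈ Finset.univ) => (hc0 j).le],
    fun j => (hc j).trans (smul_mono_left (hP j).posSemidef.nonneg ?_)⟩
  have := Finset.single_le_sum (fun j _ => (hc0 j).le) (Finset.mem_univ j)
  linarith

/-- A positive definite tuple which is strictly decreased by a positive operator is contracted
by it. -/
lemma exists_contraction {F : (J → Matrix ι ι ℝ) →ₗ[ℝ] (J → Matrix ι ι ℝ)}
    {P : J → Matrix ι ι ℝ} (hP : ∀ j, (P j).PosDef) (hFP : ∀ j, (P j - F P j).PosDef) :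
    ∃ θ : ℝ, 0 ≤ θ ∧ θ < 1 ∧ F P ≤ θ • P := by
  obtain ⟨c, hc1, hc⟩ := exists_le_smul_tuple (fun j => isSymm_of_nonneg (hP j).posSemidef.nonneg)
    hFP
  have hc0 : 0 < c := by linarith
  -- `P ≤ c (P - F P)` rearranges to `F P ≤ (1 - c⁻¹) P`; the bound `1 ≤ c` makes the factor
  -- nonnegative.
  refine ⟨1 - c⁻¹, ?_, ?_, fun j => ?_⟩
  · have := inv_le_one_of_one_le₀ hc1; linarith
  · have := inv_pos.2 hc0; linarith
  · have h := smul_mono_right (hc j) (inv_pos.2 hc0).le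
    change c⁻¹ • P j ≤ c⁻¹ • c • (P j - F P j) at h
    rw [smul_smul, inv_mul_cancel₀ hc0.ne', one_smul, ← sub_nonneg] at h
    change F P j ≤ (1 - c⁻¹) • P j
    rw [← sub_nonneg]
    convert h using 1
    module

/-- Comparison principle: iterating `D ≤ F D` from `D ≤ c P` gives `D ≤ c θ ^ k P`, which tends to
zero. Symmetry of `D` serves only to start from some multiple of `P`. -/
lemma nonpos_of_le_apply {F : (J → Matrix ι ι ℝ) →ₗ[ℝ] (J → Matrix ι ι ℝ)} (hF : Monotone F)
    {P : J → Matrix ι ι ℝ} (hP : ∀ j, (P j).PosDef) (hFP : ∀ j, (P j - F P j).PosDef)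
    {D : J → Matrix ι ι ℝ} (hs : ∀ j, (D j).IsSymm) (hD : D ≤ F D) : D ≤ 0 := by
  obtain ⟨θ, hθ0, hθ1, hθ⟩ := exists_contraction hP hFP
  obtain ⟨c, hc1, hc⟩ := exists_le_smul_tuple hs hP
  have hk : ∀ k : ℕ, D ≤ (c * θ ^ k) • P := by
    intro k
    induction k with
    | zero => simpa using hc
    | succ k ih =>
      refine hD.trans ((hF ih).trans ?_)
      rw [map_smul]
      intro j
      have := smul_mono_right (hθ j) (by positivity : 0 ≤ c * θ ^ k)
      refine this.trans (le_of_eq ?_)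
      simp only [Pi.smul_apply, smul_smul]
      congr 1; ring
  have ht : Tendsto (fun k : ℕ => (c * θ ^ k) • P) atTop (𝓝 0) := by
    have := ((tendsto_pow_atTop_nhds_zero_of_lt_one hθ0 hθ1).const_mul c).smul_const P
    simpa using this
  exact ge_of_tendsto' ht hk

omit [Fintype J] in
/-- A monotone map on nonnegative tuples with a supersolution has a fixed point, if at each point
it is touched from above by a continuous map. -/
lemma exists_fixedPoint_of_supersolution {Φ : (J → Matrix ι ι ℝ) → J → Matrix ι ι ℝ}
    (hmono : ∀ C C', 0 ≤ C → C ≤ C' → Φ C ≤ Φ C') (h0 : ∀ C, 0 ≤ C → 0 ≤ Φ C)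
    {P : J → Matrix ι ι ℝ} (hP0 : 0 ≤ P) (hP : Φ P ≤ P)
    (hmaj : ∀ C, 0 ≤ C → ∃ Ψ : (J → Matrix ι ι ℝ) → J → Matrix ι ι ℝ,
      Continuous Ψ ∧ Ψ C = Φ C ∧ ∀ C', 0 ≤ C' → Φ C' ≤ Ψ C') :
    ∃ C, 0 ≤ C ∧ Φ C = C := by
  set D : ℕ → J → Matrix ι ι ℝ := fun k => Φ^[k] P with hD
  have hsucc : ∀ k, D (k + 1) = Φ (D k) := fun k => Function.iterate_succ_apply' Φ k P
  have hnn : ∀ k, 0 ≤ D k := by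
    intro k
    induction k with
    | zero => exact hP0
    | succ k ih => rw [hsucc]; exact h0 _ ih
  have hanti : Antitone D := by
    refine antitone_nat_of_succ_le fun k => ?_
    induction k with
    | zero => exact hP
    | succ k ih =>
      rw [hsucc (k + 1), hsucc k]
      exact hmono _ _ (hsucc k ▸ hnn _) (hsucc k ▸ ih)
  choose L hL using fun j => exists_tendsto_of_antitone (A := fun k => D k j)
    (fun a b hab => hanti hab j) (fun k => hnn k j)
  have hLt : Tendsto D atTop (𝓝 L) := tendsto_pi_nhds.2 hL
  have hL0 : 0 ≤ L := ge_of_tendsto' hLt hnn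
  have hLle : ∀ k, L ≤ D k := fun k => hanti.le_of_tendsto hLt k
  -- `Φ` need not be continuous. Monotonicity gives `Φ L ≤ L`, and the majorant that touches `Φ` at
  -- `L` gives the reverse inequality in the limit of `Φ (D k) ≤ Ψ (D k)`.
  obtain ⟨Ψ, hΨc, hΨL, hΨ⟩ := hmaj L hL0
  have hLt' := hLt.comp (tendsto_add_atTop_nat 1)
  refine ⟨L, hL0, le_antisymm ?_ ?_⟩
  · exact ge_of_tendsto' hLt' fun k => by
      simpa only [Function.comp, hsucc] using hmono _ _ hL0 (hLle k)
  · rw [← hΨL]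
    refine le_of_tendsto_of_tendsto' hLt' ((hΨc.tendsto L).comp hLt) fun k => ?_
    simpa only [Function.comp, hsucc] using hΨ _ (hnn k)

end PositiveOperators

/-! ### The Lyapunov and Riccati operators on tuples of weights. -/

section RiccatiOperator

open scoped MatrixOrder

attribute [local instance] Matrix.orderClosedTopology

variable {n m d : ℕ}

/-- The successor on `Fin (d + 1)` that is constant at the last element. -/
def Fin.satSucc (j : Fin (d + 1)) : Fin (d + 1) := ⟨min (j + 1) d, by omega⟩

lemma Fin.satSucc_castSucc (j : Fin d) : j.castSucc.satSucc = j.succ := by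
  ext; simp [satSucc]

lemma Fin.satSucc_last : (Fin.last d).satSucc = Fin.last d := by
  ext; simp [satSucc]

namespace DelaySystem

variable (S : DelaySystem n m)

/-- The quadratic form of the state reached in one step with the input `K x`, where `Z` weighs
the mean and `X` the noise. -/
def stepForm (K : Matrix (Fin m) (Fin n) ℝ) (Z X : Matrix (Fin n) (Fin n) ℝ) :
    Matrix (Fin n) (Fin n) ℝ :=
  (S.A + S.B * K)ᵀ * Z * (S.A + S.B * K)
    + S.σ ^ 2 • ((S.Ab + S.Bb * K)ᵀ * X * (S.Ab + S.Bb * K))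

lemma stepForm_zero_gain (Z X : Matrix (Fin n) (Fin n) ℝ) :
    S.stepForm 0 Z X = S.Aᵀ * Z * S.A + S.σ ^ 2 • (S.Abᵀ * X * S.Ab) := by
  simp [stepForm]

lemma stepForm_mono (K : Matrix (Fin m) (Fin n) ℝ) {Z Z' X X' : Matrix (Fin n) (Fin n) ℝ}
    (hZ : Z ≤ Z') (hX : X ≤ X') : S.stepForm K Z X ≤ S.stepForm K Z' X' :=
  add_le_add (conj_mono hZ _) (smul_mono_right (conj_mono hX _) (sq_nonneg _))

/-- The Lyapunov operator of the delayed system: `C j` weighs the part of the state known with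
information delay `j`, and `κ j` is the feedback from that part. -/
def lyap (κ : Fin (d + 1) → Matrix (Fin m) (Fin n) ℝ) :
    (Fin (d + 1) → Matrix (Fin n) (Fin n) ℝ) →ₗ[ℝ] (Fin (d + 1) → Matrix (Fin n) (Fin n) ℝ) where
  toFun C j := S.stepForm (κ j) (C j.satSucc) (C 0)
  map_add' C C' := by
    ext1 j
    simp only [stepForm, Pi.add_apply, Matrix.mul_add, Matrix.add_mul, smul_add]
    abel
  map_smul' c C := by
    ext1 j
    simp only [stepForm, Pi.smul_apply, Matrix.mul_smul, Matrix.smul_mul, RingHom.id_apply,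
      smul_add]
    rw [smul_comm c]

lemma lyap_apply (κ : Fin (d + 1) → Matrix (Fin m) (Fin n) ℝ)
    (C : Fin (d + 1) → Matrix (Fin n) (Fin n) ℝ) (j : Fin (d + 1)) :
    S.lyap κ C j = S.stepForm (κ j) (C j.satSucc) (C 0) := rfl

lemma lyap_mono (κ : Fin (d + 1) → Matrix (Fin m) (Fin n) ℝ) : Monotone (S.lyap κ) :=
  fun _ _ h j => S.stepForm_mono (κ j) (h _) (h _)

/-- Feedback with gain `K` from the part of the state that is available to the controller. -/
def delayedGain (d : ℕ) (K : Matrix (Fin m) (Fin n) ℝ) :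
    Fin (d + 1) → Matrix (Fin m) (Fin n) ℝ :=
  fun j => if j = Fin.last d then K else 0

lemma delayedGain_last (K : Matrix (Fin m) (Fin n) ℝ) : delayedGain d K (Fin.last d) = K := by
  simp [delayedGain]

lemma delayedGain_castSucc (K : Matrix (Fin m) (Fin n) ℝ) (j : Fin d) :
    delayedGain d K j.castSucc = 0 := by
  simp [delayedGain, Fin.castSucc_ne_last]

lemma lyap_last (K : Matrix (Fin m) (Fin n) ℝ) (C : Fin (d + 1) → Matrix (Fin n) (Fin n) ℝ) :
    S.lyap (delayedGain d K) C (Fin.last d) = S.stepForm K (C (Fin.last d)) (C 0) := by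
  rw [lyap_apply, delayedGain_last, Fin.satSucc_last]

lemma lyap_castSucc (K : Matrix (Fin m) (Fin n) ℝ) (C : Fin (d + 1) → Matrix (Fin n) (Fin n) ℝ)
    (j : Fin d) :
    S.lyap (delayedGain d K) C j.castSucc
      = S.Aᵀ * C j.succ * S.A + S.σ ^ 2 • (S.Abᵀ * C 0 * S.Ab) := by
  rw [lyap_apply, delayedGain_castSucc, Fin.satSucc_castSucc, stepForm_zero_gain]

/-- A gain together with a strict Lyapunov certificate for it. -/
def HasCertificate (d : ℕ) : Prop :=
  ∃ (K : Matrix (Fin m) (Fin n) ℝ) (P : Fin (d + 1) → Matrix (Fin n) (Fin n) ℝ),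
    (∀ j, (P j).PosDef) ∧ ∀ j, (P j - S.lyap (delayedGain d K) P j).PosDef

/-- `Υ` as a function of `Z` and `X`. -/
def upsilon (R : Matrix (Fin m) (Fin m) ℝ) (Z X : Matrix (Fin n) (Fin n) ℝ) :
    Matrix (Fin m) (Fin m) ℝ :=
  S.Bᵀ * Z * S.B + S.σ ^ 2 • (S.Bbᵀ * X * S.Bb) + R

/-- `M` as a function of `Z` and `X`. -/
def crossTerm (Z X : Matrix (Fin n) (Fin n) ℝ) : Matrix (Fin m) (Fin n) ℝ :=
  S.Bᵀ * Z * S.A + S.σ ^ 2 • (S.Bbᵀ * X * S.Ab)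

/-- The minimizing gain. -/
noncomputable def optGain (R : Matrix (Fin m) (Fin m) ℝ) (Z X : Matrix (Fin n) (Fin n) ℝ) :
    Matrix (Fin m) (Fin n) ℝ :=
  -((S.upsilon R Z X)⁻¹ * S.crossTerm Z X)

lemma crossTerm_transpose {Z X : Matrix (Fin n) (Fin n) ℝ} (hZ : Z.IsSymm) (hX : X.IsSymm) :
    (S.crossTerm Z X)ᵀ = S.Aᵀ * Z * S.B + S.σ ^ 2 • (S.Abᵀ * X * S.Bb) := by
  simp [crossTerm, hZ.eq, hX.eq, Matrix.mul_assoc]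

lemma posDef_upsilon {R : Matrix (Fin m) (Fin m) ℝ} (hR : R.PosDef)
    {Z X : Matrix (Fin n) (Fin n) ℝ} (hZ : 0 ≤ Z) (hX : 0 ≤ X) : (S.upsilon R Z X).PosDef := by
  refine hR.of_le (le_add_of_nonneg_left (add_nonneg (conj_nonneg hZ _) ?_))
  exact smul_nonneg' (conj_nonneg hX _) (sq_nonneg _)

lemma stepForm_expand {R : Matrix (Fin m) (Fin m) ℝ} {Z X : Matrix (Fin n) (Fin n) ℝ}
    (hZ : Z.IsSymm) (hX : X.IsSymm) (K : Matrix (Fin m) (Fin n) ℝ) :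
    S.stepForm K Z X + Kᵀ * R * K = S.stepForm 0 Z X + Kᵀ * S.crossTerm Z X
      + (S.crossTerm Z X)ᵀ * K + Kᵀ * S.upsilon R Z X * K := by
  rw [S.crossTerm_transpose hZ hX]
  simp only [stepForm, crossTerm, upsilon, transpose_add, transpose_mul, Matrix.mul_add,
    Matrix.add_mul, Matrix.mul_smul, Matrix.smul_mul, smul_add, Matrix.mul_assoc, Matrix.mul_zero,
    add_zero]
  abel

lemma upsilon_mul_optGain {R : Matrix (Fin m) (Fin m) ℝ} {Z X : Matrix (Fin n) (Fin n) ℝ}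
    (hΥ : (S.upsilon R Z X).PosDef) :
    S.upsilon R Z X * S.optGain R Z X = -S.crossTerm Z X := by
  rw [optGain, Matrix.mul_neg, ← Matrix.mul_assoc,
    mul_nonsing_inv _ ((isUnit_iff_isUnit_det _).1 hΥ.isUnit), Matrix.one_mul]

lemma optGain_transpose_mul {R : Matrix (Fin m) (Fin m) ℝ} {Z X : Matrix (Fin n) (Fin n) ℝ}
    (hΥ : (S.upsilon R Z X).PosDef) :
    (S.optGain R Z X)ᵀ * S.upsilon R Z X = -(S.crossTerm Z X)ᵀ := by
  have := congrArg transpose (S.upsilon_mul_optGain hΥ)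
  rwa [transpose_mul, (isSymm_of_nonneg hΥ.posSemidef.nonneg).eq, transpose_neg] at this

/-- The value at the minimizing gain is a Schur complement; the subtracted term is the matrix `L` of
the Riccati-ZXL equation. -/
lemma stepForm_optGain {R : Matrix (Fin m) (Fin m) ℝ} {Z X : Matrix (Fin n) (Fin n) ℝ}
    (hZ : Z.IsSymm) (hX : X.IsSymm) (hΥ : (S.upsilon R Z X).PosDef) :
    S.stepForm (S.optGain R Z X) Z X + (S.optGain R Z X)ᵀ * R * S.optGain R Z X
      = S.stepForm 0 Z X - (S.crossTerm Z X)ᵀ * (S.upsilon R Z X)⁻¹ * S.crossTerm Z X := by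
  rw [S.stepForm_expand hZ hX, S.optGain_transpose_mul hΥ, optGain]
  simp only [Matrix.mul_neg, Matrix.neg_mul, transpose_neg, transpose_mul, Matrix.mul_assoc,
    transpose_nonsing_inv, (isSymm_of_nonneg hΥ.posSemidef.nonneg).eq]
  abel

/-- Completing the square in the gain. The last term is the exact loss caused by a suboptimal gain;
it drives both the minimality of `riccati` and the second-order error in the sensitivity analysis.
-/
lemma stepForm_eq_add_square {R : Matrix (Fin m) (Fin m) ℝ} {Z X : Matrix (Fin n) (Fin n) ℝ}
    (hZ : Z.IsSymm) (hX : X.IsSymm) (hΥ : (S.upsilon R Z X).PosDef)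
    (K : Matrix (Fin m) (Fin n) ℝ) :
    S.stepForm K Z X + Kᵀ * R * K
      = S.stepForm (S.optGain R Z X) Z X + (S.optGain R Z X)ᵀ * R * S.optGain R Z X
        + (K - S.optGain R Z X)ᵀ * S.upsilon R Z X * (K - S.optGain R Z X) := by
  have h1 := S.upsilon_mul_optGain hΥ
  have h2 := S.optGain_transpose_mul hΥ
  rw [S.stepForm_expand hZ hX, S.stepForm_expand hZ hX]
  have h3 : (S.optGain R Z X)ᵀ * S.crossTerm Z X = (S.crossTerm Z X)ᵀ * S.optGain R Z X := by
    rw [← neg_inj, ← Matrix.mul_neg, ← h1, ← Matrix.mul_assoc, h2, Matrix.neg_mul]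
  simp only [transpose_sub, Matrix.sub_mul, Matrix.mul_sub, Matrix.mul_assoc, h1]
  rw [← Matrix.mul_assoc (S.optGain R Z X)ᵀ (S.upsilon R Z X) K, h2]
  simp only [Matrix.mul_neg, Matrix.neg_mul, h3]
  abel

/-- The weights of the running cost under the feedback `κ`. -/
def runningWeight (Q : Matrix (Fin n) (Fin n) ℝ) (R : Matrix (Fin m) (Fin m) ℝ)
    (κ : Fin (d + 1) → Matrix (Fin m) (Fin n) ℝ) : Fin (d + 1) → Matrix (Fin n) (Fin n) ℝ :=
  fun j => Q + (κ j)ᵀ * R * κ j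

/-- The feedback that is optimal for the weights `C`. -/
noncomputable def optPolicy (R : Matrix (Fin m) (Fin m) ℝ)
    (C : Fin (d + 1) → Matrix (Fin n) (Fin n) ℝ) : Fin (d + 1) → Matrix (Fin m) (Fin n) ℝ :=
  delayedGain d (S.optGain R (C (Fin.last d)) (C 0))

/-- The Riccati operator on tuples of weights. -/
noncomputable def riccati (Q : Matrix (Fin n) (Fin n) ℝ) (R : Matrix (Fin m) (Fin m) ℝ)
    (C : Fin (d + 1) → Matrix (Fin n) (Fin n) ℝ) : Fin (d + 1) → Matrix (Fin n) (Fin n) ℝ :=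
  S.lyap (S.optPolicy R C) C + runningWeight Q R (S.optPolicy R C)

variable {S} {Q : Matrix (Fin n) (Fin n) ℝ} {R : Matrix (Fin m) (Fin m) ℝ}

lemma le_runningWeight (hR : 0 ≤ R) (κ : Fin (d + 1) → Matrix (Fin m) (Fin n) ℝ)
    (j : Fin (d + 1)) : Q ≤ runningWeight Q R κ j :=
  le_add_of_nonneg_right (conj_nonneg hR _)

lemma posDef_runningWeight (hQ : Q.PosDef) (hR : R.PosDef)
    (κ : Fin (d + 1) → Matrix (Fin m) (Fin n) ℝ) (j : Fin (d + 1)) :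
    (runningWeight Q R κ j).PosDef :=
  hQ.of_le (le_runningWeight hR.posSemidef.nonneg κ j)

lemma runningWeight_mono {Q' : Matrix (Fin n) (Fin n) ℝ} {R' : Matrix (Fin m) (Fin m) ℝ}
    (hQ : Q ≤ Q') (hR : R ≤ R') (κ : Fin (d + 1) → Matrix (Fin m) (Fin n) ℝ) :
    runningWeight Q R κ ≤ runningWeight Q' R' κ :=
  fun _ => add_le_add hQ (conj_mono hR _)

lemma lyap_nonneg (κ : Fin (d + 1) → Matrix (Fin m) (Fin n) ℝ)
    {C : Fin (d + 1) → Matrix (Fin n) (Fin n) ℝ} (hC : 0 ≤ C) : 0 ≤ S.lyap κ C := by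
  simpa using S.lyap_mono κ hC

lemma continuous_lyap (κ : Fin (d + 1) → Matrix (Fin m) (Fin n) ℝ) :
    Continuous (S.lyap κ : (Fin (d + 1) → Matrix (Fin n) (Fin n) ℝ) → _) :=
  LinearMap.continuous_of_finiteDimensional _

/-- `riccati` is a minimum over gains of affine monotone maps: the gain occurs only in the last row,
where the discarded square is nonnegative. Monotonicity and affine majorants follow from this. -/
lemma riccati_le (hR : R.PosDef) {C : Fin (d + 1) → Matrix (Fin n) (Fin n) ℝ} (hC : 0 ≤ C)
    (K : Matrix (Fin m) (Fin n) ℝ) :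
    S.riccati Q R C ≤ S.lyap (delayedGain d K) C + runningWeight Q R (delayedGain d K) := by
  intro j
  induction j using Fin.lastCases with
  | cast j =>
    simp [riccati, optPolicy, lyap_castSucc, runningWeight, delayedGain_castSucc]
  | last =>
    have hΥ := S.posDef_upsilon hR (hC (Fin.last d)) (hC 0)
    have h := S.stepForm_eq_add_square (isSymm_of_nonneg (hC (Fin.last d)))
      (isSymm_of_nonneg (hC 0)) hΥ K
    simp only [riccati, optPolicy, Pi.add_apply, lyap_last, runningWeight, delayedGain_last]
    rw [add_left_comm, add_left_comm (S.stepForm K _ _), h]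
    exact add_le_add le_rfl (le_add_of_nonneg_right (conj_nonneg hΥ.posSemidef.nonneg _))

lemma riccati_nonneg (hQ : 0 ≤ Q) (hR : R.PosDef) {C : Fin (d + 1) → Matrix (Fin n) (Fin n) ℝ}
    (hC : 0 ≤ C) : 0 ≤ S.riccati Q R C :=
  add_nonneg (lyap_nonneg _ hC) fun j => hQ.trans (le_runningWeight hR.posSemidef.nonneg _ j)

lemma riccati_mono (hR : R.PosDef) {C C' : Fin (d + 1) → Matrix (Fin n) (Fin n) ℝ} (hC : 0 ≤ C)
    (h : C ≤ C') : S.riccati Q R C ≤ S.riccati Q R C' :=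
  (riccati_le hR hC _).trans (add_le_add_left (S.lyap_mono _ h) _)

/-- The gap `P - lyap P` is positive definite and scales with `P`, so a large multiple absorbs the
running weight. -/
lemma HasCertificate.exists_supersolution (h : S.HasCertificate d) (hQ : Q.IsSymm)
    (hR : R.IsSymm) : ∃ (K : Matrix (Fin m) (Fin n) ℝ)
      (P : Fin (d + 1) → Matrix (Fin n) (Fin n) ℝ),
      0 ≤ P ∧ S.lyap (delayedGain d K) P + runningWeight Q R (delayedGain d K) ≤ P := by
  obtain ⟨K, P, hP, hFP⟩ := h
  obtain ⟨c, hc1, hc⟩ := exists_le_smul_tuple (C := runningWeight Q R (delayedGain d K))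
    (fun j => by simp [IsSymm, runningWeight, hQ.eq, hR.eq, Matrix.mul_assoc]) hFP
  refine ⟨K, c • P, fun j => smul_nonneg' (hP j).posSemidef.nonneg (by linarith), fun j => ?_⟩
  have := hc j
  rw [map_smul]
  rw [← sub_nonneg] at this ⊢
  convert this using 1
  simp only [Pi.smul_apply, Pi.add_apply]
  module

lemma exists_riccati_fixedPoint (h : S.HasCertificate d) (hQ : Q.PosDef) (hR : R.PosDef) :
    ∃ C : Fin (d + 1) → Matrix (Fin n) (Fin n) ℝ, 0 ≤ C ∧ S.riccati Q R C = C := by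
  obtain ⟨K, P, hP0, hP⟩ := h.exists_supersolution (isSymm_of_nonneg hQ.posSemidef.nonneg)
    (isSymm_of_nonneg hR.posSemidef.nonneg)
  refine exists_fixedPoint_of_supersolution (fun C C' hC hCC' => riccati_mono hR hC hCC')
    (fun C hC => riccati_nonneg hQ.posSemidef.nonneg hR hC) hP0 ((riccati_le hR hP0 K).trans hP)
    -- Freezing the policy that is optimal at `C` gives an affine majorant touching `riccati` at
    -- `C`.
    fun C hC => ⟨fun C' => S.lyap (S.optPolicy R C) C' + runningWeight Q R (S.optPolicy R C),
      (continuous_lyap _).add continuous_const, rfl, fun C' hC' => riccati_le hR hC' _⟩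

/-- A nonnegative solution of the Riccati equation is a certificate for its own feedback. -/
lemma posDef_sub_lyap_of_fixedPoint (hQ : Q.PosDef) (hR : R.PosDef)
    {C : Fin (d + 1) → Matrix (Fin n) (Fin n) ℝ} (h : S.riccati Q R C = C) (j : Fin (d + 1)) :
    (C j - S.lyap (S.optPolicy R C) C j).PosDef := by
  have := congrFun h j
  rw [riccati, Pi.add_apply] at this
  rw [sub_eq_of_eq_add' this.symm]
  exact posDef_runningWeight hQ hR _ j

lemma posDef_of_fixedPoint (hQ : Q.PosDef) (hR : R.PosDef)
    {C : Fin (d + 1) → Matrix (Fin n) (Fin n) ℝ} (hC : 0 ≤ C) (h : S.riccati Q R C = C)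
    (j : Fin (d + 1)) : (C j).PosDef := by
  have := posDef_sub_lyap_of_fixedPoint hQ hR h j
  refine this.of_le (sub_le_self _ (lyap_nonneg _ hC j))

/-- Solutions of the Riccati equation are monotone in the weights. -/
lemma fixedPoint_le_fixedPoint {Q' : Matrix (Fin n) (Fin n) ℝ} {R' : Matrix (Fin m) (Fin m) ℝ}
    (hR : R.PosDef) (hQ' : Q'.PosDef) (hR' : R'.PosDef) (hQQ : Q ≤ Q')
    (hRR : R ≤ R') {C C' : Fin (d + 1) → Matrix (Fin n) (Fin n) ℝ} (hC : 0 ≤ C) (hC' : 0 ≤ C')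
    (h : S.riccati Q R C = C) (h' : S.riccati Q' R' C' = C') : C ≤ C' := by
  rw [← sub_nonpos]
  -- Under the policy optimal for `C'`, `C'` solves an affine equation and `C` is a subsolution of
  -- it. The difference satisfies the comparison hypothesis, with `C'` itself as certificate.
  refine nonpos_of_le_apply (S.lyap_mono (S.optPolicy R' C')) (P := C')
    (posDef_of_fixedPoint hQ' hR' hC' h') (posDef_sub_lyap_of_fixedPoint hQ' hR' h')
    (fun j => (isSymm_of_nonneg (hC j)).sub (isSymm_of_nonneg (hC' j))) ?_
  have h1 : C ≤ S.lyap (S.optPolicy R' C') C + runningWeight Q' R' (S.optPolicy R' C') := by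
    conv_lhs => rw [← h]
    exact (riccati_le hR hC _).trans (add_le_add_right (runningWeight_mono hQQ hRR _) _)
  have h2 : C' = S.lyap (S.optPolicy R' C') C' + runningWeight Q' R' (S.optPolicy R' C') := h'.symm
  rw [map_sub]
  rw [← sub_nonneg] at h1 ⊢
  convert h1 using 1
  have h3 : S.lyap (S.optPolicy R' C') C' - C' = -runningWeight Q' R' (S.optPolicy R' C') := by
    rw [sub_eq_iff_eq_add', ← sub_eq_add_neg]
    exact eq_sub_of_add_eq h2.symm
  rw [sub_sub_sub_comm, h3]
  abel

end DelaySystem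

end RiccatiOperator

/-! ### Translation between Riccati-ZXL solutions and fixed points; the linearized equation. -/

section RiccatiZXL

open scoped MatrixOrder

attribute [local instance] Matrix.orderClosedTopology

lemma Matrix.dotProduct_mulVec_mul_mul {ι κ l : Type*} [Fintype ι] [Fintype κ] [Fintype l]
    (B : Matrix ι κ ℝ) (N : Matrix ι ι ℝ) (A : Matrix ι l ℝ) (x : κ → ℝ) (y : l → ℝ) :
    x ⬝ᵥ ((Bᵀ * N * A) *ᵥ y) = (B *ᵥ x) ⬝ᵥ (N *ᵥ (A *ᵥ y)) := by
  rw [← mulVec_mulVec, ← mulVec_mulVec, dotProduct_mulVec, vecMul_transpose]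

lemma Matrix.dotProduct_mulVec_conj {ι κ : Type*} [Fintype ι] [Fintype κ] (A : Matrix ι κ ℝ)
    (N : Matrix ι ι ℝ) (x y : κ → ℝ) :
    x ⬝ᵥ ((Aᵀ * N * A) *ᵥ y) = (A *ᵥ x) ⬝ᵥ (N *ᵥ (A *ᵥ y)) :=
  dotProduct_mulVec_mul_mul A N A x y

/-- A bound by a positive definite form that needs no symmetry of `N`, obtained from `|x - N y| ^ 2
≥ 0`. -/
lemma Matrix.exists_dotProduct_mulVec_le {ι : Type*} [Fintype ι] [DecidableEq ι]
    (N : Matrix ι ι ℝ) {P : Matrix ι ι ℝ} (hP : P.PosDef) :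
    ∃ c : ℝ, 0 ≤ c ∧ ∀ x y, x ⬝ᵥ (N *ᵥ y) ≤ c * (x ⬝ᵥ (P *ᵥ x) + y ⬝ᵥ (P *ᵥ y)) := by
  obtain ⟨c₁, h₁, hc₁⟩ := (isSymm_one (n := ι) (α := ℝ)).exists_le_smul hP
  obtain ⟨c₂, h₂, hc₂⟩ :=
    (isSymm_of_nonneg (transpose_mul_self_nonneg N)).exists_le_smul hP
  refine ⟨c₁ + c₂, by positivity, fun x y => ?_⟩
  have e₁ := dotProduct_mulVec_mono hc₁ x
  have e₂ := dotProduct_mulVec_mono hc₂ y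
  rw [← mulVec_mulVec, dotProduct_mulVec, vecMul_transpose] at e₂
  simp only [smul_mulVec, one_mulVec, dotProduct_smul, smul_eq_mul] at e₁ e₂
  have px := hP.posSemidef.dotProduct_mulVec_nonneg x
  have py := hP.posSemidef.dotProduct_mulVec_nonneg y
  simp only [star_trivial] at px py
  have h : 0 ≤ (x - N *ᵥ y) ⬝ᵥ (x - N *ᵥ y) := by
    simpa using dotProduct_star_self_nonneg (x - N *ᵥ y)
  have h' : 0 ≤ x ⬝ᵥ x := by simpa using dotProduct_star_self_nonneg x
  have h'' : 0 ≤ (N *ᵥ y) ⬝ᵥ (N *ᵥ y) := by simpa using dotProduct_star_self_nonneg (N *ᵥ y)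
  simp only [sub_dotProduct, dotProduct_sub, dotProduct_comm (N *ᵥ y) x] at h
  nlinarith [mul_nonneg h₂.le px, mul_nonneg h₁.le py]

namespace DelaySystem

variable {n m d : ℕ} {S : DelaySystem n m} {Q : Matrix (Fin n) (Fin n) ℝ}
  {R : Matrix (Fin m) (Fin m) ℝ}

/-- The weights of the partial states, recovered from `Z` and `L`. -/
def weights (S : DelaySystem n m) (d : ℕ) (Z L : Matrix (Fin n) (Fin n) ℝ) :
    Fin (d + 1) → Matrix (Fin n) (Fin n) ℝ :=
  fun j => Z + ∑ i ∈ Finset.range (d - j), S.Aᵀ ^ i * L * S.A ^ i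

lemma weights_last (Z L : Matrix (Fin n) (Fin n) ℝ) : S.weights d Z L (Fin.last d) = Z := by
  simp [weights]

lemma weights_zero (Z L : Matrix (Fin n) (Fin n) ℝ) :
    S.weights d Z L 0 = Z + ∑ j ∈ Finset.range d, S.Aᵀ ^ j * L * S.A ^ j := by
  simp [weights]

/-- Splitting off the term `i = 0` leaves the next weight conjugated by `A`. By the equation for
`Z`, the constant `Z + L - AᵀZA` equals `σ² Abᵀ X Ab + Q`, so this is a non-final row of the Riccati
equation. -/
lemma weights_castSucc (Z L : Matrix (Fin n) (Fin n) ℝ) (j : Fin d) :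
    S.weights d Z L j.castSucc
      = S.Aᵀ * S.weights d Z L j.succ * S.A + (Z + L - S.Aᵀ * Z * S.A) := by
  have h : d - (j : ℕ) = d - ((j : ℕ) + 1) + 1 := by omega
  simp only [weights, Fin.val_castSucc, Fin.val_succ]
  rw [h, Finset.sum_range_succ', pow_zero, pow_zero, Matrix.one_mul, Matrix.mul_one,
    Matrix.mul_add, Matrix.add_mul, Matrix.mul_sum, Matrix.sum_mul]
  simp only [pow_succ' S.Aᵀ, pow_succ S.A, Matrix.mul_assoc]
  abel

lemma eq_weights {Z L : Matrix (Fin n) (Fin n) ℝ} {C : Fin (d + 1) → Matrix (Fin n) (Fin n) ℝ}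
    (hlast : C (Fin.last d) = Z)
    (hC : ∀ j : Fin d, C j.castSucc = S.Aᵀ * C j.succ * S.A + (Z + L - S.Aᵀ * Z * S.A)) :
    C = S.weights d Z L := by
  funext j
  induction j using Fin.reverseInduction with
  | last => rw [hlast, weights_last]
  | cast j ih => rw [hC, weights_castSucc, ih]

/-- The Lyapunov operator without the row of the available part of the state. -/
def openLyap (S : DelaySystem n m) (d : ℕ) :
    (Fin (d + 1) → Matrix (Fin n) (Fin n) ℝ) →ₗ[ℝ] (Fin (d + 1) → Matrix (Fin n) (Fin n) ℝ) where
  toFun C j := if j = Fin.last d then 0 else S.lyap (delayedGain d 0) C j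
  map_add' C C' := by ext1 j; by_cases h : j = Fin.last d <;> simp [h]
  map_smul' c C := by ext1 j; by_cases h : j = Fin.last d <;> simp [h]

lemma openLyap_castSucc (C : Fin (d + 1) → Matrix (Fin n) (Fin n) ℝ) (j : Fin d) :
    S.openLyap d C j.castSucc = S.Aᵀ * C j.succ * S.A + S.σ ^ 2 • (S.Abᵀ * C 0 * S.Ab) := by
  rw [← lyap_castSucc S 0]
  simp [openLyap, Fin.castSucc_ne_last]

lemma openLyap_last (C : Fin (d + 1) → Matrix (Fin n) (Fin n) ℝ) :
    S.openLyap d C (Fin.last d) = 0 := by simp [openLyap]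

lemma openLyap_mono : Monotone (S.openLyap d) := by
  intro C C' h j
  induction j using Fin.lastCases with
  | last => simp [openLyap_last]
  | cast j =>
    have := S.lyap_mono (delayedGain d 0) h j.castSucc
    rwa [lyap_castSucc, lyap_castSucc, ← openLyap_castSucc, ← openLyap_castSucc] at this

lemma HasCertificate.openLyap (h : S.HasCertificate d) :
    ∃ P : Fin (d + 1) → Matrix (Fin n) (Fin n) ℝ, (∀ j, (P j).PosDef) ∧
      ∀ j, (P j - S.openLyap d P j).PosDef := by
  obtain ⟨K, P, hP, hFP⟩ := h
  refine ⟨P, hP, fun j => ?_⟩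
  induction j using Fin.lastCases with
  | last => simpa [openLyap_last] using hP _
  | cast j =>
    have := hFP j.castSucc
    rwa [lyap_castSucc, ← openLyap_castSucc] at this

/-- Without symmetry of `N` the Loewner order does not apply, so the bilinear forms `x ⬝ᵥ (N j *ᵥ
y)` are estimated instead: each use of `N = openLyap N` gains a factor `θ`. -/
lemma eq_zero_of_openLyap (h : S.HasCertificate d) {N : Fin (d + 1) → Matrix (Fin n) (Fin n) ℝ}
    (hN : S.openLyap d N = N) : N = 0 := by
  obtain ⟨P, hP, hFP⟩ := h.openLyap
  obtain ⟨θ, hθ0, hθ1, hθ⟩ := exists_contraction hP hFP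
  choose c hc0 hc using fun j => exists_dotProduct_mulVec_le (N j) (hP j)
  have hPn : ∀ j x, 0 ≤ x ⬝ᵥ (P j *ᵥ x) := fun j x => by
    simpa using (hP j).posSemidef.dotProduct_mulVec_nonneg x
  have key : ∀ k : ℕ, ∀ j x y, x ⬝ᵥ (N j *ᵥ y)
      ≤ (∑ j, c j) * θ ^ k * (x ⬝ᵥ (P j *ᵥ x) + y ⬝ᵥ (P j *ᵥ y)) := by
    intro k
    induction k with
    | zero =>
      intro j x y
      rw [pow_zero, mul_one]
      refine (hc j x y).trans (mul_le_mul_of_nonneg_right ?_ (add_nonneg (hPn j x) (hPn j y)))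
      exact Finset.single_le_sum (fun i _ => hc0 i) (Finset.mem_univ j)
    | succ k ih =>
      intro j x y
      have hcs : 0 ≤ ∑ j, c j := Finset.sum_nonneg fun i _ => hc0 i
      have hs : 0 ≤ (∑ j, c j) * θ ^ k := by positivity
      induction j using Fin.lastCases with
      | last =>
        rw [← hN, openLyap_last, zero_mulVec, dotProduct_zero]
        have := add_nonneg (hPn (Fin.last d) x) (hPn (Fin.last d) y)
        positivity
      | cast j =>
        have hx := dotProduct_mulVec_mono (hθ j.castSucc) x
        have hy := dotProduct_mulVec_mono (hθ j.castSucc) y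
        have e1 := ih j.succ (S.A *ᵥ x) (S.A *ᵥ y)
        have e2 := mul_le_mul_of_nonneg_left (ih 0 (S.Ab *ᵥ x) (S.Ab *ᵥ y)) (sq_nonneg S.σ)
        rw [← hN]
        rw [openLyap_castSucc] at hx hy ⊢
        simp only [Pi.smul_apply, smul_mulVec, dotProduct_smul, smul_eq_mul, add_mulVec,
          dotProduct_add, dotProduct_mulVec_conj] at hx hy ⊢
        have e3 := mul_le_mul_of_nonneg_left (add_le_add hx hy) hs
        rw [pow_succ θ]
        linarith
  have hle : ∀ j x y, x ⬝ᵥ (N j *ᵥ y) ≤ 0 := by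
    intro j x y
    have ht : Tendsto (fun k : ℕ => (∑ j, c j) * θ ^ k * (x ⬝ᵥ (P j *ᵥ x) + y ⬝ᵥ (P j *ᵥ y)))
        atTop (𝓝 0) := by
      simpa using ((tendsto_pow_atTop_nhds_zero_of_lt_one hθ0 hθ1).const_mul
        (∑ j, c j)).mul_const (x ⬝ᵥ (P j *ᵥ x) + y ⬝ᵥ (P j *ᵥ y))
    exact ge_of_tendsto' ht fun k => key k j x y
  funext j
  ext a b
  have h1 := hle j (Pi.single a 1) (Pi.single b 1)
  have h2 := hle j (-Pi.single a 1) (Pi.single b 1)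
  rw [neg_dotProduct] at h2
  rw [dotProduct_single_mulVec] at h1 h2
  exact le_antisymm h1 (neg_nonpos.1 h2)

/-- A Riccati-ZXL solution is only assumed to have `Z > 0`; neither symmetry nor sign of `X` is
given. The antisymmetric parts `C j - (C j)ᵀ` are fixed by `openLyap` and hence vanish; then `-C ≤
openLyap (-C)` and comparison applies. -/
lemma nonneg_of_recursion (h : S.HasCertificate d) (hQ : 0 ≤ Q)
    {C : Fin (d + 1) → Matrix (Fin n) (Fin n) ℝ} (hlast : 0 ≤ C (Fin.last d))
    (hC : ∀ j : Fin d, C j.castSucc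
      = S.Aᵀ * C j.succ * S.A + S.σ ^ 2 • (S.Abᵀ * C 0 * S.Ab) + Q) : 0 ≤ C := by
  have hN : (fun j => C j - (C j)ᵀ) = 0 := by
    refine eq_zero_of_openLyap h (funext fun j => ?_)
    induction j using Fin.lastCases with
    | last => rw [openLyap_last, (isSymm_of_nonneg hlast).eq, sub_self]
    | cast j =>
      rw [openLyap_castSucc, hC]
      simp only [transpose_add, transpose_smul, transpose_mul, transpose_transpose,
        Matrix.mul_sub, Matrix.sub_mul, smul_sub, (isSymm_of_nonneg hQ).eq, Matrix.mul_assoc]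
      abel
  have hs : ∀ j, (C j).IsSymm := fun j => (sub_eq_zero.1 (congrFun hN j)).symm
  obtain ⟨P, hP, hFP⟩ := h.openLyap
  have := nonpos_of_le_apply openLyap_mono hP hFP (D := -C) (fun j => (hs j).neg) fun j => ?_
  · simpa using this
  · rw [map_neg]
    simp only [Pi.neg_apply, neg_le_neg_iff]
    induction j using Fin.lastCases with
    | last => rwa [openLyap_last]
    | cast j =>
      rw [openLyap_castSucc, hC]
      exact le_add_of_nonneg_right hQ

/-- The matrices `(Z, X, L, Υ, M)` belonging to a tuple of weights. -/
def toZXL (S : DelaySystem n m) (Q : Matrix (Fin n) (Fin n) ℝ) (R : Matrix (Fin m) (Fin m) ℝ)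
    (C : Fin (d + 1) → Matrix (Fin n) (Fin n) ℝ) : ZXL n m where
  Z := C (Fin.last d)
  X := C 0
  L := S.Aᵀ * C (Fin.last d) * S.A + S.σ ^ 2 • (S.Abᵀ * C 0 * S.Ab) + Q - C (Fin.last d)
  Υ := S.upsilon R (C (Fin.last d)) (C 0)
  M := S.crossTerm (C (Fin.last d)) (C 0)

lemma fixedPoint_castSucc {C : Fin (d + 1) → Matrix (Fin n) (Fin n) ℝ}
    (h : S.riccati Q R C = C) (j : Fin d) :
    C j.castSucc = S.Aᵀ * C j.succ * S.A + S.σ ^ 2 • (S.Abᵀ * C 0 * S.Ab) + Q := by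
  conv_lhs => rw [← h]
  simp [riccati, optPolicy, lyap_castSucc, runningWeight, delayedGain_castSucc]

lemma riccati_last (hR : R.PosDef) {C : Fin (d + 1) → Matrix (Fin n) (Fin n) ℝ} (hC : 0 ≤ C) :
    S.riccati Q R C (Fin.last d) = S.Aᵀ * C (Fin.last d) * S.A + S.σ ^ 2 • (S.Abᵀ * C 0 * S.Ab) + Q
      - (S.toZXL Q R C).Mᵀ * (S.toZXL Q R C).Υ⁻¹ * (S.toZXL Q R C).M := by
  have h := S.stepForm_optGain (R := R) (isSymm_of_nonneg (hC (Fin.last d)))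
    (isSymm_of_nonneg (hC 0)) (S.posDef_upsilon hR (hC (Fin.last d)) (hC 0))
  simp only [riccati, optPolicy, Pi.add_apply, lyap_last, runningWeight, delayedGain_last, toZXL]
  rw [add_left_comm, h, stepForm_zero_gain]
  abel

lemma isZXLSolution_toZXL (hQ : Q.PosDef) (hR : R.PosDef)
    {C : Fin (d + 1) → Matrix (Fin n) (Fin n) ℝ} (hC : 0 ≤ C) (h : S.riccati Q R C = C) :
    S.IsZXLSolution d Q R (S.toZXL Q R C) where
  pos := posDef_of_fixedPoint hQ hR hC h _
  eqZ := by simp [toZXL]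
  eqX := by
    have := eq_weights (S := S) (C := C) (L := (S.toZXL Q R C).L) rfl fun j => by
      rw [fixedPoint_castSucc h j]
      simp only [toZXL]
      abel
    exact (congrFun this 0).trans (weights_zero _ _)
  -- `toZXL` defines `L` through the equation for `Z`, so this identity is the last row of the
  -- fixed-point equation.
  eqL := by
    have := congrFun h (Fin.last d)
    rw [riccati_last hR hC, sub_eq_iff_eq_add] at this
    conv_lhs => simp only [toZXL]
    rw [this]
    abel
  eqΥ := rfl
  eqM := rfl

lemma IsZXLSolution.weights_eq {T : ZXL n m} (h : S.IsZXLSolution d Q R T) (j : Fin d) :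
    S.weights d T.Z T.L j.castSucc = S.Aᵀ * S.weights d T.Z T.L j.succ * S.A
      + S.σ ^ 2 • (S.Abᵀ * S.weights d T.Z T.L 0 * S.Ab) + Q := by
  rw [weights_castSucc, weights_zero, ← h.eqX]
  have := h.eqZ
  rw [eq_sub_iff_add_eq] at this
  rw [this]
  abel

lemma IsZXLSolution.eq_toZXL {T : ZXL n m} (h : S.IsZXLSolution d Q R T) :
    T = S.toZXL Q R (S.weights d T.Z T.L) := by
  have hX : S.weights d T.Z T.L 0 = T.X := by rw [weights_zero, ← h.eqX]
  ext1
  · simp [toZXL, weights_last]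
  · simp [toZXL, hX]
  · simp only [toZXL, weights_last, hX]
    have := h.eqZ
    rw [eq_sub_iff_add_eq] at this
    rw [← this]; abel
  · simp only [toZXL, weights_last, hX]; exact h.eqΥ
  · simp only [toZXL, weights_last, hX]; exact h.eqM

lemma IsZXLSolution.weights_nonneg {T : ZXL n m} (hc : S.HasCertificate d) (hQ : Q.PosDef)
    (h : S.IsZXLSolution d Q R T) : 0 ≤ S.weights d T.Z T.L :=
  nonneg_of_recursion hc hQ.posSemidef.nonneg
    (by rw [weights_last]; exact h.pos.posSemidef.nonneg) h.weights_eq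

lemma IsZXLSolution.riccati_weights {T : ZXL n m} (hc : S.HasCertificate d) (hQ : Q.PosDef)
    (hR : R.PosDef) (h : S.IsZXLSolution d Q R T) :
    S.riccati Q R (S.weights d T.Z T.L) = S.weights d T.Z T.L := by
  have hC := h.weights_nonneg hc hQ
  funext j
  induction j using Fin.lastCases with
  | last =>
    rw [riccati_last hR hC, ← h.eq_toZXL, ← h.eqL, weights_last, weights_zero, ← h.eqX, ← h.eqZ]
  | cast j =>
    rw [h.weights_eq]
    simp [riccati, optPolicy, lyap_castSucc, runningWeight, delayedGain_castSucc]

/-- Every solution comes from a nonnegative fixed point of `riccati`; two of them are compared in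
both directions with equal weights. -/
lemma existsUnique_isZXLSolution (hc : S.HasCertificate d) (hQ : Q.PosDef) (hR : R.PosDef) :
    ∃! T : ZXL n m, S.IsZXLSolution d Q R T := by
  obtain ⟨C, hC, h⟩ := exists_riccati_fixedPoint hc hQ hR
  refine ⟨_, isZXLSolution_toZXL hQ hR hC h, fun T hT => ?_⟩
  have hT0 := hT.weights_nonneg hc hQ
  have hTr := hT.riccati_weights hc hQ hR
  rw [hT.eq_toZXL]
  congr 1
  exact le_antisymm (fixedPoint_le_fixedPoint hR hQ hR le_rfl le_rfl hT0 hC hTr h)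
    (fixedPoint_le_fixedPoint hR hQ hR le_rfl le_rfl hC hT0 h hTr)

variable {Q' : Matrix (Fin n) (Fin n) ℝ} {R' : Matrix (Fin m) (Fin m) ℝ}

/-- The linearized equation at weights `C` for the derivative `D` of the weights. -/
def IsLinearized (S : DelaySystem n m) (R : Matrix (Fin m) (Fin m) ℝ)
    (Q' : Matrix (Fin n) (Fin n) ℝ) (R' : Matrix (Fin m) (Fin m) ℝ)
    (C D : Fin (d + 1) → Matrix (Fin n) (Fin n) ℝ) : Prop :=
  D = S.lyap (S.optPolicy R C) D + runningWeight Q' R' (S.optPolicy R C)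

lemma IsLinearized.castSucc {C D : Fin (d + 1) → Matrix (Fin n) (Fin n) ℝ}
    (h : S.IsLinearized R Q' R' C D) (j : Fin d) :
    D j.castSucc = S.Aᵀ * D j.succ * S.A + S.σ ^ 2 • (S.Abᵀ * D 0 * S.Ab) + Q' := by
  conv_lhs => rw [h]
  simp [optPolicy, lyap_castSucc, runningWeight, delayedGain_castSucc]

/-- The difference of two solutions is fixed by the closed-loop operator, for which `C` is a
certificate; comparison applies to it and to its negative. -/
lemma IsLinearized.unique (hQ : Q.PosDef) (hR : R.PosDef)
    {C D D' : Fin (d + 1) → Matrix (Fin n) (Fin n) ℝ} (hC : 0 ≤ C) (h : S.riccati Q R C = C)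
    (hDs : ∀ j, (D j).IsSymm) (hDs' : ∀ j, (D' j).IsSymm)
    (hD : S.IsLinearized R Q' R' C D) (hD' : S.IsLinearized R Q' R' C D') : D = D' := by
  have key : D - D' = S.lyap (S.optPolicy R C) (D - D') := by
    conv_lhs => rw [hD, hD']
    rw [map_sub]
    abel
  have hP := posDef_of_fixedPoint hQ hR hC h
  have hFP := posDef_sub_lyap_of_fixedPoint hQ hR h
  refine le_antisymm (sub_nonpos.1 ?_) (sub_nonpos.1 ?_)
  · exact nonpos_of_le_apply (S.lyap_mono _) hP hFP (fun j => (hDs j).sub (hDs' j)) key.le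
  · refine nonpos_of_le_apply (S.lyap_mono _) hP hFP (fun j => (hDs' j).sub (hDs j)) ?_
    rw [← neg_sub, map_neg]
    exact (congrArg Neg.neg key).le

lemma exists_isLinearized (hQ : Q.PosDef) (hR : R.PosDef)
    {C : Fin (d + 1) → Matrix (Fin n) (Fin n) ℝ} (hC : 0 ≤ C) (h : S.riccati Q R C = C)
    (hQ' : 0 ≤ Q') (hR' : 0 ≤ R') :
    ∃ D : Fin (d + 1) → Matrix (Fin n) (Fin n) ℝ, 0 ≤ D ∧ S.IsLinearized R Q' R' C D := by
  have hP := posDef_of_fixedPoint hQ hR hC h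
  have hw : 0 ≤ runningWeight Q' R' (S.optPolicy R C) := fun j =>
    hQ'.trans (le_runningWeight hR' _ j)
  obtain ⟨c, hc1, hc⟩ := exists_le_smul_tuple (C := runningWeight Q' R' (S.optPolicy R C))
    (fun j => isSymm_of_nonneg (hw j)) (posDef_sub_lyap_of_fixedPoint hQ hR h)
  -- The map is affine and monotone, hence its own majorant, and a large multiple of `C` is a
  -- supersolution.
  obtain ⟨D, hD0, hD⟩ := exists_fixedPoint_of_supersolution
    (Φ := fun D => S.lyap (S.optPolicy R C) D + runningWeight Q' R' (S.optPolicy R C))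
    (P := c • C) (fun D D' _ hDD => add_le_add_left (S.lyap_mono _ hDD) _)
    (fun D hD => add_nonneg (lyap_nonneg _ hD) hw)
    (fun j => smul_nonneg' (hC j) (by linarith)) (fun j => by
      have := hc j
      rw [map_smul]
      rw [← sub_nonneg] at this ⊢
      convert this using 1
      simp only [Pi.smul_apply, Pi.add_apply]
      module)
    fun D _ => ⟨_, (continuous_lyap _).add continuous_const, rfl, fun _ _ => le_rfl⟩
  exact ⟨D, hD0, hD.symm⟩

/-- Envelope identity: the product-rule derivative of `MᵀΥ⁻¹M` is exactly what expanding `stepForm`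
at the frozen gain `-Υ⁻¹M` produces. The gradient equations are therefore the closed-loop Lyapunov
equation. -/
lemma linearized_last {T D : ZXL n m} (hΥ : T.Υ.PosDef) (hΥT : T.Υ = S.upsilon R T.Z T.X)
    (hMT : T.M = S.crossTerm T.Z T.X) (hZ : D.Z.IsSymm) (hX : D.X.IsSymm)
    (hΥD : D.Υ = S.upsilon R' D.Z D.X) (hMD : D.M = S.crossTerm D.Z D.X) :
    S.Aᵀ * D.Z * S.A + S.σ ^ 2 • (S.Abᵀ * D.X * S.Ab) + Q'
      - (D.Mᵀ * T.Υ⁻¹ * T.M - T.Mᵀ * T.Υ⁻¹ * D.Υ * T.Υ⁻¹ * T.M + T.Mᵀ * T.Υ⁻¹ * D.M)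
      = S.stepForm (S.optGain R T.Z T.X) D.Z D.X
        + (Q' + (S.optGain R T.Z T.X)ᵀ * R' * S.optGain R T.Z T.X) := by
  rw [add_left_comm, S.stepForm_expand hZ hX, stepForm_zero_gain, ← hΥD, ← hMD, optGain, ← hΥT,
    ← hMT]
  simp only [transpose_neg, transpose_mul, transpose_nonsing_inv,
    (isSymm_of_nonneg hΥ.posSemidef.nonneg).eq, Matrix.mul_neg, Matrix.neg_mul, Matrix.mul_assoc]
  abel

lemma isGradientSolution_toZXL (hR : R.PosDef)
    {C D : Fin (d + 1) → Matrix (Fin n) (Fin n) ℝ} (hC : 0 ≤ C) (hs : ∀ j, (D j).IsSymm)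
    (h : S.IsLinearized R Q' R' C D) :
    S.IsGradientSolution d Q' R' (S.toZXL Q R C) (S.toZXL Q' R' D) where
  symmZ := hs _
  symmX := hs _
  eqZ := by simp [toZXL]
  eqX := by
    have := eq_weights (S := S) (C := D) (L := (S.toZXL Q' R' D).L) rfl fun j => by
      rw [h.castSucc j]
      simp only [toZXL]
      abel
    exact (congrFun this 0).trans (weights_zero _ _)
  eqL := by
    have h1 := linearized_last (Q' := Q') (T := S.toZXL Q R C) (D := S.toZXL Q' R' D)
      (S.posDef_upsilon hR (hC _) (hC _)) rfl rfl (hs _) (hs _) rfl rfl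
    have h2 := congrFun h (Fin.last d)
    simp only [optPolicy, Pi.add_apply, lyap_last, runningWeight, delayedGain_last] at h2
    have h3 := h1.trans h2.symm
    rw [sub_eq_iff_eq_add] at h3
    rw [← sub_eq_iff_eq_add'] at h3
    exact h3
  eqΥ := rfl
  eqM := rfl

lemma IsGradientSolution.eq_toZXL {T D : ZXL n m} (h : S.IsGradientSolution d Q' R' T D) :
    D = S.toZXL Q' R' (S.weights d D.Z D.L) := by
  have hX : S.weights d D.Z D.L 0 = D.X := by rw [weights_zero, ← h.eqX]
  ext1
  · simp [toZXL, weights_last]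
  · simp [toZXL, hX]
  · simp only [toZXL, weights_last, hX]
    have := h.eqZ
    rw [eq_sub_iff_add_eq] at this
    rw [← this]; abel
  · simp only [toZXL, weights_last, hX]; exact h.eqΥ
  · simp only [toZXL, weights_last, hX]; exact h.eqM

lemma IsGradientSolution.weights_castSucc_eq {T D : ZXL n m}
    (h : S.IsGradientSolution d Q' R' T D) (j : Fin d) :
    S.weights d D.Z D.L j.castSucc = S.Aᵀ * S.weights d D.Z D.L j.succ * S.A
      + S.σ ^ 2 • (S.Abᵀ * S.weights d D.Z D.L 0 * S.Ab) + Q' := by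
  rw [weights_castSucc, weights_zero, ← h.eqX]
  have := h.eqZ
  rw [eq_sub_iff_add_eq] at this
  rw [this]
  abel

lemma IsGradientSolution.isSymm_weights {T D : ZXL n m} (hQ' : Q'.IsSymm)
    (h : S.IsGradientSolution d Q' R' T D) (j : Fin (d + 1)) :
    (S.weights d D.Z D.L j).IsSymm := by
  induction j using Fin.reverseInduction with
  | last => rw [weights_last]; exact h.symmZ
  | cast j ih =>
    rw [h.weights_castSucc_eq, weights_zero, ← h.eqX]
    simp [IsSymm, ih.eq, hQ'.eq, h.symmX.eq, Matrix.mul_assoc]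

lemma IsGradientSolution.isLinearized (hR : R.PosDef)
    {C : Fin (d + 1) → Matrix (Fin n) (Fin n) ℝ} (hC : 0 ≤ C) {D : ZXL n m}
    (h : S.IsGradientSolution d Q' R' (S.toZXL Q R C) D) :
    S.IsLinearized R Q' R' C (S.weights d D.Z D.L) := by
  funext j
  induction j using Fin.lastCases with
  | last =>
    have h1 := linearized_last (Q' := Q') (T := S.toZXL Q R C) (D := D)
      (S.posDef_upsilon hR (hC _) (hC _)) rfl rfl h.symmZ h.symmX h.eqΥ h.eqM
    simp only [optPolicy, Pi.add_apply, lyap_last, runningWeight, delayedGain_last]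
    rw [weights_last, weights_zero, ← h.eqX]
    refine Eq.trans ?_ h1
    rw [← h.eqL]
    exact h.eqZ
  | cast j =>
    rw [h.weights_castSucc_eq]
    simp [optPolicy, lyap_castSucc, runningWeight, delayedGain_castSucc]

end DelaySystem

end RiccatiZXL

/-! ### Differentiation rules on the orthant. -/

section OrthantCalculus

variable {p : ℕ} {lam : Fin p → ℝ}

namespace HasOrthantGradient

variable {f f' : (Fin p → ℝ) → ℝ} {g g' : Fin p → ℝ}

lemma add (h : HasOrthantGradient f g lam) (h' : HasOrthantGradient f' g' lam) :
    HasOrthantGradient (fun μ => f μ + f' μ) (fun i => g i + g' i) lam := by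
  have := HasFDerivWithinAt.fun_add h h'
  unfold HasOrthantGradient
  simpa only [add_smul, Finset.sum_add_distrib] using this

lemma const_mul (c : ℝ) (h : HasOrthantGradient f g lam) :
    HasOrthantGradient (fun μ => c * f μ) (fun i => c * g i) lam := by
  have := HasFDerivWithinAt.const_mul h c
  unfold HasOrthantGradient
  simpa only [Finset.smul_sum, smul_smul] using this

lemma mul_const (c : ℝ) (h : HasOrthantGradient f g lam) :
    HasOrthantGradient (fun μ => f μ * c) (fun i => g i * c) lam := by
  simpa only [mul_comm _ c] using h.const_mul c

lemma sub (h : HasOrthantGradient f g lam) (h' : HasOrthantGradient f' g' lam) :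
    HasOrthantGradient (fun μ => f μ - f' μ) (fun i => g i - g' i) lam := by
  simpa only [neg_one_mul, ← sub_eq_add_neg] using h.add (h'.const_mul (-1))

lemma const (c : ℝ) : HasOrthantGradient (fun _ => c) (fun _ : Fin p => 0) lam := by
  unfold HasOrthantGradient
  simpa using hasFDerivWithinAt_const c lam (Set.Ici 0)

lemma sum {α : Type*} (s : Finset α) {f : α → (Fin p → ℝ) → ℝ} {g : α → Fin p → ℝ}
    (h : ∀ a, HasOrthantGradient (f a) (g a) lam) :
    HasOrthantGradient (fun μ => ∑ a ∈ s, f a μ) (fun i => ∑ a ∈ s, g a i) lam := by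
  classical
  induction s using Finset.induction_on with
  | empty => simpa using const 0
  | insert a s ha ih => simpa only [Finset.sum_insert ha] using (h a).add ih

lemma coord (i : Fin p) : HasOrthantGradient (fun μ => μ i) (fun k => if k = i then 1 else 0) lam := by
  unfold HasOrthantGradient
  have := (ContinuousLinearMap.proj (R := ℝ) (φ := fun _ : Fin p => ℝ) i).hasFDerivWithinAt
    (x := lam) (s := Set.Ici 0)
  simp only [ite_smul, one_smul, zero_smul, Finset.sum_ite_eq', Finset.mem_univ, if_true]
  exact this

lemma congr_of_orthant (h : HasOrthantGradient f g lam) (hlam : 0 ≤ lam)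
    (hf : ∀ μ, 0 ≤ μ → f' μ = f μ) : HasOrthantGradient f' g lam :=
  HasFDerivWithinAt.congr h hf (hf lam hlam)

lemma hasDerivWithinAt (h : HasOrthantGradient f g lam) (hlam : 0 ≤ lam) (i : Fin p) :
    HasDerivWithinAt (fun t => f (Function.update lam i t)) (g i) (Set.Ici 0) (lam i) := by
  have h1 : HasFDerivWithinAt f (∑ i, g i • ContinuousLinearMap.proj (R := ℝ)
      (φ := fun _ : Fin p => ℝ) i) (Set.Ici 0) (Function.update lam i (lam i)) := by
    rwa [Function.update_eq_self]
  have := h1.comp_hasDerivWithinAt (lam i)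
    (hasDerivAt_update lam i (lam i)).hasDerivWithinAt (t := Set.Ici 0) (s := Set.Ici 0) (by
      intro t ht k
      by_cases hk : k = i
      · subst hk; simpa using ht
      · simpa [hk] using hlam k)
  simpa [_root_.sum_apply, Pi.single_apply, Function.comp_def] using this

lemma unique (h : HasOrthantGradient f g lam) (h' : HasOrthantGradient f g' lam)
    (hlam : 0 ≤ lam) : g = g' := by
  -- The orthant is convex and has the all-ones vector in its interior, so derivatives within it are
  -- unique even at boundary points.
  have hu : UniqueDiffWithinAt ℝ (Set.Ici (0 : Fin p → ℝ)) lam := by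
    refine uniqueDiffOn_convex (convex_Ici 0) ?_ lam hlam
    rw [← Set.pi_univ_Ici, interior_pi_set Set.finite_univ]
    exact ⟨fun _ => 1, fun i _ => by simp⟩
  have := UniqueDiffWithinAt.eq hu h h'
  funext i
  have := congrArg (fun L => L (Pi.single i 1)) this
  simpa [_root_.sum_apply, Pi.single_apply] using this

end HasOrthantGradient

/-- `F' i` is the `i`-th partial derivative in the Fréchet derivative of `F` on the orthant. -/
def HasMatrixGradient {a b : Type*} (F : (Fin p → ℝ) → Matrix a b ℝ) (F' : Fin p → Matrix a b ℝ)
    (lam : Fin p → ℝ) : Prop :=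
  ∀ r s, HasOrthantGradient (fun μ => F μ r s) (fun i => F' i r s) lam

namespace HasMatrixGradient

variable {a b c : Type*} {F G : (Fin p → ℝ) → Matrix a b ℝ} {F' G' : Fin p → Matrix a b ℝ}

lemma add (h : HasMatrixGradient F F' lam) (h' : HasMatrixGradient G G' lam) :
    HasMatrixGradient (fun μ => F μ + G μ) (fun i => F' i + G' i) lam :=
  fun r s => (h r s).add (h' r s)

lemma sub (h : HasMatrixGradient F F' lam) (h' : HasMatrixGradient G G' lam) :
    HasMatrixGradient (fun μ => F μ - G μ) (fun i => F' i - G' i) lam :=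
  fun r s => (h r s).sub (h' r s)

lemma const_smul (k : ℝ) (h : HasMatrixGradient F F' lam) :
    HasMatrixGradient (fun μ => k • F μ) (fun i => k • F' i) lam :=
  fun r s => (h r s).const_mul k

lemma const_mul [Fintype a] (U : Matrix c a ℝ) (h : HasMatrixGradient F F' lam) :
    HasMatrixGradient (fun μ => U * F μ) (fun i => U * F' i) lam :=
  fun r s => by
    simpa only [mul_apply] using HasOrthantGradient.sum Finset.univ
      fun k => (h k s).const_mul (U r k)

lemma mul_const [Fintype b] (U : Matrix b c ℝ) (h : HasMatrixGradient F F' lam) :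
    HasMatrixGradient (fun μ => F μ * U) (fun i => F' i * U) lam :=
  fun r s => by
    simpa only [mul_apply] using HasOrthantGradient.sum Finset.univ
      fun k => (h r k).mul_const (U k s)

lemma dotProduct_mulVec [Fintype a] [Fintype b] (h : HasMatrixGradient F F' lam) (x : a → ℝ)
    (y : b → ℝ) :
    HasOrthantGradient (fun μ => x ⬝ᵥ (F μ *ᵥ y)) (fun i => x ⬝ᵥ (F' i *ᵥ y)) lam := by
  simpa only [dotProduct, mulVec] using HasOrthantGradient.sum Finset.univ fun r =>
    (HasOrthantGradient.sum Finset.univ fun s => (h r s).mul_const (y s)).const_mul (x r)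

lemma congr_of_orthant (h : HasMatrixGradient F F' lam) (hlam : 0 ≤ lam)
    (hF : ∀ μ, 0 ≤ μ → G μ = F μ) : HasMatrixGradient G F' lam :=
  fun r s => (h r s).congr_of_orthant hlam fun μ hμ => by rw [hF μ hμ]

lemma hasMatrixPartial {a b : ℕ} {F : (Fin p → ℝ) → Matrix (Fin a) (Fin b) ℝ}
    {F' : Fin p → Matrix (Fin a) (Fin b) ℝ} (h : HasMatrixGradient F F' lam) (hlam : 0 ≤ lam)
    (i : Fin p) : HasMatrixPartial F (F' i) i lam :=
  fun r s => (h r s).hasDerivWithinAt hlam i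

lemma affine (F₀ : Matrix a b ℝ) (F' : Fin p → Matrix a b ℝ) :
    HasMatrixGradient (fun μ => F₀ + ∑ i, μ i • F' i) F' lam := by
  intro r s
  have := (HasOrthantGradient.const (F₀ r s)).add (HasOrthantGradient.sum (lam := lam) Finset.univ
    fun i => (HasOrthantGradient.coord i).mul_const (F' i r s))
  simpa [Matrix.sum_apply] using this

end HasMatrixGradient

end OrthantCalculus

/-! ### Dependence of the Riccati solution and the dual cost on the multipliers. -/

section Sensitivity

open scoped MatrixOrder
open Asymptotics

variable {n m p d : ℕ} {S : DelaySystem n m} {W : QuadData n m p}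

/-- Turns order bounds into entrywise ones. `X + Y ≥ 0` has entries bounded by `X a a + X b b`, and
removing `X a b` costs another half of that. -/
lemma Matrix.abs_apply_le_of_sandwich {ι : Type*} [Fintype ι] [DecidableEq ι]
    {X Y : Matrix ι ι ℝ} (hX : 0 ≤ X) (h1 : -X ≤ Y) (h2 : Y ≤ X) (a b : ι) :
    |Y a b| ≤ 3 / 2 * (X a a + X b b) := by
  have h3 : 0 ≤ X + Y := by rw [← neg_le_iff_add_nonneg']; exact h1
  have e1 := abs_apply_le_of_nonneg h3 a b
  have e2 := abs_apply_le_of_nonneg hX a b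
  have e3 := apply_self_mono h2 a
  have e4 := apply_self_mono h2 b
  simp only [Matrix.add_apply] at e1
  rw [abs_le] at *
  constructor <;> linarith

/-- With `g = G x`, expand `|ε g - Y g| ^ 2 ≥ 0` and use `ε |g| ^ 2 ≤ g ⬝ᵥ Y g`. For `Y = Υ` this
controls the loss of a gain by its defect, with no estimate of `Υ` from above. -/
lemma Matrix.conj_le_of_smul_one_le {ι κ : Type*} [Fintype ι] [DecidableEq ι] [Fintype κ]
    {Y : Matrix ι ι ℝ} {ε : ℝ} (hε : 0 < ε) (hY : ε • (1 : Matrix ι ι ℝ) ≤ Y)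
    (hs : Y.IsSymm) (G : Matrix ι κ ℝ) :
    Gᵀ * Y * G ≤ ε⁻¹ • ((Y * G)ᵀ * (Y * G)) := by
  refine le_of_forall_dotProduct (by simp [IsSymm, hs.eq, Matrix.mul_assoc]) (by simp [IsSymm])
    fun x => ?_
  have h1 := dotProduct_mulVec_mono hY (G *ᵥ x)
  have h2 := dotProduct_star_self_nonneg (ε • (G *ᵥ x) - Y *ᵥ (G *ᵥ x))
  rw [dotProduct_mulVec_conj, smul_mulVec, ← mulVec_mulVec, dotProduct_smul, dotProduct_mulVec x,
    vecMul_transpose, smul_eq_mul, ← mulVec_mulVec]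
  simp only [star_trivial, sub_dotProduct, dotProduct_sub, smul_dotProduct, dotProduct_smul,
    smul_eq_mul, dotProduct_comm (Y *ᵥ (G *ᵥ x)) (G *ᵥ x), smul_mulVec, one_mulVec] at h1 h2
  rw [inv_mul_eq_div, le_div_iff₀ hε]
  nlinarith

namespace QuadData

lemma Qlam_sub (μ ν : Fin p → ℝ) : W.Qlam μ - W.Qlam ν = ∑ i, (μ i - ν i) • W.Q i := by
  simp [Qlam, sub_smul, Finset.sum_sub_distrib]

lemma Rlam_sub (μ ν : Fin p → ℝ) : W.Rlam μ - W.Rlam ν = ∑ i, (μ i - ν i) • W.R i := by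
  simp [Rlam, sub_smul, Finset.sum_sub_distrib]

/-- Affine families of positive definite matrices are Lipschitz in the multiplicative sense. -/
lemma exists_affine_le {ι : Type*} [Fintype ι] [DecidableEq ι] {F₀ : Matrix ι ι ℝ}
    {F : Fin p → Matrix ι ι ℝ} (h₀ : F₀.PosDef) (h : ∀ i, 0 ≤ F i) :
    ∃ c : ℝ, 0 ≤ c ∧ ∀ μ ν : Fin p → ℝ, 0 ≤ ν →
      F₀ + ∑ i, μ i • F i ≤ (1 + c * ‖μ - ν‖) • (F₀ + ∑ i, ν i • F i) := by
  obtain ⟨c, hc0, hc⟩ := (isSymm_of_nonneg (Finset.sum_nonneg fun i (_ : i ∈ Finset.univ) =>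
    h i)).exists_le_smul h₀
  refine ⟨c, hc0.le, fun μ ν hν => ?_⟩
  have h1 : ∑ i, (μ i - ν i) • F i ≤ ‖μ - ν‖ • ∑ i, F i := by
    rw [Finset.smul_sum]
    refine Finset.sum_le_sum fun i _ => smul_mono_left (h i) ?_
    exact (le_abs_self _).trans (norm_le_pi_norm (μ - ν) i)
  have h2 : F₀ ≤ F₀ + ∑ i, ν i • F i :=
    le_add_of_nonneg_right (Finset.sum_nonneg fun i _ => smul_nonneg' (h i) (hν i))
  have h3 := h1.trans (smul_mono_right (hc.trans (smul_mono_right h2 hc0.le)) (norm_nonneg (μ - ν)))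
  have h4 : F₀ + ∑ i, μ i • F i = (F₀ + ∑ i, ν i • F i) + ∑ i, (μ i - ν i) • F i := by
    simp only [sub_smul, Finset.sum_sub_distrib]; abel
  rw [h4, add_smul, one_smul]
  refine add_le_add le_rfl (h3.trans (le_of_eq ?_))
  rw [smul_smul, mul_comm]

namespace Positive

lemma posDef_Qlam (hW : W.Positive) {μ : Fin p → ℝ} (hμ : 0 ≤ μ) : (W.Qlam μ).PosDef :=
  hW.Q₀.of_le (le_add_of_nonneg_right (Finset.sum_nonneg fun i _ =>
    smul_nonneg' (hW.Q i).posSemidef.nonneg (hμ i)))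

lemma R₀_le_Rlam (hW : W.Positive) {μ : Fin p → ℝ} (hμ : 0 ≤ μ) : W.R₀ ≤ W.Rlam μ :=
  le_add_of_nonneg_right (Finset.sum_nonneg fun i _ =>
    smul_nonneg' (hW.R i).posSemidef.nonneg (hμ i))

lemma posDef_Rlam (hW : W.Positive) {μ : Fin p → ℝ} (hμ : 0 ≤ μ) : (W.Rlam μ).PosDef :=
  hW.R₀.of_le (hW.R₀_le_Rlam hμ)

end Positive

end QuadData

namespace DelaySystem

lemma optGain_smul {t : ℝ} (ht : t ≠ 0) (R : Matrix (Fin m) (Fin m) ℝ)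
    (Z X : Matrix (Fin n) (Fin n) ℝ) :
    S.optGain (t • R) (t • Z) (t • X) = S.optGain R Z X := by
  have h1 : S.upsilon (t • R) (t • Z) (t • X) = t • S.upsilon R Z X := by
    simp only [upsilon, Matrix.mul_smul, Matrix.smul_mul, smul_add, smul_comm t]
  have h2 : S.crossTerm (t • Z) (t • X) = t • S.crossTerm Z X := by
    simp only [crossTerm, Matrix.mul_smul, Matrix.smul_mul, smul_add, smul_comm t]
  have h3 : (t • S.upsilon R Z X)⁻¹ = t⁻¹ • (S.upsilon R Z X)⁻¹ := by
    by_cases hd : IsUnit (S.upsilon R Z X).det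
    · exact Matrix.inv_smul' _ (Units.mk0 t ht) hd
    · rw [nonsing_inv_apply_not_isUnit _ hd, nonsing_inv_apply_not_isUnit, smul_zero]
      rw [det_smul, IsUnit.mul_iff]
      exact fun h => hd h.2
  rw [optGain, optGain, h1, h2, h3, Matrix.smul_mul, Matrix.mul_smul, smul_smul,
    inv_mul_cancel₀ ht, one_smul]

/-- Scaling all weights leaves the optimal gain unchanged, so `t • C` solves the equation with
`t`-fold weights. -/
lemma riccati_smul {t : ℝ} (ht : t ≠ 0) (Q : Matrix (Fin n) (Fin n) ℝ)
    (R : Matrix (Fin m) (Fin m) ℝ) (C : Fin (d + 1) → Matrix (Fin n) (Fin n) ℝ) :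
    S.riccati (t • Q) (t • R) (t • C) = t • S.riccati Q R C := by
  have h : S.optPolicy (t • R) (t • C) = S.optPolicy R C := by
    simp only [optPolicy, Pi.smul_apply, S.optGain_smul ht]
  rw [riccati, riccati, h, map_smul, smul_add]
  congr 1
  funext j
  simp only [runningWeight, Pi.smul_apply, Matrix.mul_smul, Matrix.smul_mul, smul_add]

/-- A family of nonnegative solutions of the Riccati equation, indexed by the multipliers. -/
def IsRiccatiFamily (S : DelaySystem n m) (W : QuadData n m p)
    (C : (Fin p → ℝ) → Fin (d + 1) → Matrix (Fin n) (Fin n) ℝ) : Prop :=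
  ∀ μ, 0 ≤ μ → 0 ≤ C μ ∧ S.riccati (W.Qlam μ) (W.Rlam μ) (C μ) = C μ

variable {C : (Fin p → ℝ) → Fin (d + 1) → Matrix (Fin n) (Fin n) ℝ} {lam : Fin p → ℝ}

/-- The weights at `μ` are at most `t = 1 + c ‖μ - ν‖` times those at `ν`. Homogeneity and
monotonicity carry this bound over to the solutions. -/
lemma IsRiccatiFamily.exists_le (hW : W.Positive) (hC : S.IsRiccatiFamily W C) :
    ∃ c : ℝ, 0 ≤ c ∧ ∀ μ ν, 0 ≤ μ → 0 ≤ ν → C μ ≤ (1 + c * ‖μ - ν‖) • C ν := by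
  obtain ⟨c₁, h₁, hc₁⟩ := QuadData.exists_affine_le hW.Q₀ fun i => (hW.Q i).posSemidef.nonneg
  obtain ⟨c₂, h₂, hc₂⟩ := QuadData.exists_affine_le hW.R₀ fun i => (hW.R i).posSemidef.nonneg
  refine ⟨c₁ + c₂, by positivity, fun μ ν hμ hν => ?_⟩
  have hn := norm_nonneg (μ - ν)
  have ht : 0 < 1 + (c₁ + c₂) * ‖μ - ν‖ := by positivity
  obtain ⟨hμ0, hμr⟩ := hC μ hμ
  obtain ⟨hν0, hνr⟩ := hC ν hν
  have hQ := hW.posDef_Qlam hν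
  have hR := hW.posDef_Rlam hν
  refine fixedPoint_le_fixedPoint (hW.posDef_Rlam hμ) (hQ.smul ht) (hR.smul ht)
    ((hc₁ μ ν hν).trans (smul_mono_left hQ.posSemidef.nonneg (by nlinarith)))
    ((hc₂ μ ν hν).trans (smul_mono_left hR.posSemidef.nonneg (by nlinarith)))
    hμ0 (fun j => smul_nonneg' (hν0 j) ht.le) hμr ?_
  rw [riccati_smul ht.ne', hνr]

lemma IsRiccatiFamily.isBigO_sub (hW : W.Positive) (hC : S.IsRiccatiFamily W C) (hlam : 0 ≤ lam)
    (j : Fin (d + 1)) (a b : Fin n) :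
    (fun μ => (C μ j - C lam j) a b) =O[𝓝[Set.Ici 0] lam] fun μ => ‖μ - lam‖ := by
  obtain ⟨c, hc0, hc⟩ := hC.exists_le hW
  refine IsBigO.of_bound (3 / 2 * (c * (1 + c) * (C lam j a a + C lam j b b))) ?_
  have hball : ∀ᶠ μ in 𝓝[Set.Ici 0] lam, ‖μ - lam‖ < 1 := by
    refine nhdsWithin_le_nhds ?_
    filter_upwards [Metric.ball_mem_nhds lam one_pos] with μ hμ
    rwa [← dist_eq_norm]
  filter_upwards [self_mem_nhdsWithin, hball] with μ hμ hμ1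
  have hn := norm_nonneg (μ - lam)
  have h0 : 0 ≤ C lam j := (hC lam hlam).1 j
  have h1 : C μ j ≤ (1 + c * ‖μ - lam‖) • C lam j := hc μ lam hμ hlam j
  have h2 : C lam j ≤ (1 + c * ‖μ - lam‖) • C μ j := by
    have := hc lam μ hlam hμ j
    rwa [norm_sub_rev] at this
  -- The factor `1 + c` comes from the lower bound: its error is a multiple of `C μ`, which is at
  -- most `(1 + c) • C lam` when `‖μ - lam‖ < 1`.
  have hX : 0 ≤ (c * (1 + c) * ‖μ - lam‖) • C lam j := smul_nonneg' h0 (by positivity)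
  have hu : C μ j - C lam j ≤ (c * (1 + c) * ‖μ - lam‖) • C lam j := by
    rw [sub_le_iff_le_add]
    refine h1.trans ?_
    rw [← one_smul ℝ (C lam j), smul_smul, smul_smul, ← add_smul]
    refine smul_mono_left h0 ?_
    nlinarith [mul_nonneg (mul_nonneg hc0 hc0) hn]
  have hl : -((c * (1 + c) * ‖μ - lam‖) • C lam j) ≤ C μ j - C lam j := by
    rw [neg_le, neg_sub, sub_le_iff_le_add]
    refine h2.trans ?_
    rw [add_smul, one_smul, add_comm]
    refine add_le_add ?_ le_rfl
    have h3 := smul_mono_right h1 (by positivity : 0 ≤ c * ‖μ - lam‖)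
    refine h3.trans ?_
    rw [smul_smul]
    refine smul_mono_left h0 ?_
    nlinarith [mul_nonneg (mul_nonneg (mul_nonneg hc0 hc0) hn) (sub_nonneg.2 hμ1.le)]
  have := abs_apply_le_of_sandwich hX hl hu a b
  rw [Real.norm_eq_abs, norm_norm]
  refine this.trans (le_of_eq ?_)
  simp only [Matrix.smul_apply, smul_eq_mul]
  ring

/-- The failure of the gain `K` to be optimal for the weights `Z`, `X`. -/
def gainDefect (S : DelaySystem n m) (R : Matrix (Fin m) (Fin m) ℝ) (K : Matrix (Fin m) (Fin n) ℝ)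
    (Z X : Matrix (Fin n) (Fin n) ℝ) : Matrix (Fin m) (Fin n) ℝ :=
  S.upsilon R Z X * K + S.crossTerm Z X

lemma gainDefect_sub (R R' : Matrix (Fin m) (Fin m) ℝ) (K : Matrix (Fin m) (Fin n) ℝ)
    (Z X Z' X' : Matrix (Fin n) (Fin n) ℝ) :
    S.gainDefect R K Z X - S.gainDefect R' K Z' X'
      = S.Bᵀ * (Z - Z') * (S.A + S.B * K) + S.σ ^ 2 • (S.Bbᵀ * (X - X') * (S.Ab + S.Bb * K))
        + (R - R') * K := by
  simp only [gainDefect, upsilon, crossTerm, Matrix.mul_sub, Matrix.sub_mul, Matrix.add_mul,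
    Matrix.mul_add, Matrix.smul_mul, Matrix.mul_assoc, smul_add, smul_sub]
  abel

lemma isBigO_mul_mul_apply {a b c e : Type*} [Fintype b] [Fintype c] (U : Matrix a b ℝ)
    {F : (Fin p → ℝ) → Matrix b c ℝ} (V : Matrix c e ℝ) {l : Filter (Fin p → ℝ)}
    {g : (Fin p → ℝ) → ℝ} (h : ∀ r s, (fun μ => F μ r s) =O[l] g) (r : a) (s : e) :
    (fun μ => (U * F μ * V) r s) =O[l] g := by
  simp only [mul_apply]
  refine IsBigO.fun_sum fun i _ => ?_
  simp_rw [mul_comm _ (V i s)]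
  refine IsBigO.const_mul_left (IsBigO.fun_sum fun k _ => ?_) _
  exact (h k i).const_mul_left _

/-- For a fixed gain the defect is affine in the weights and the solution, both Lipschitz at `lam`,
and it vanishes at `lam`, where the gain is optimal. -/
lemma IsRiccatiFamily.isBigO_gainDefect (hW : W.Positive) (hC : S.IsRiccatiFamily W C)
    (hlam : 0 ≤ lam) (a : Fin m) (b : Fin n) :
    (fun μ => S.gainDefect (W.Rlam μ)
      (S.optGain (W.Rlam lam) (C lam (Fin.last d)) (C lam 0)) (C μ (Fin.last d)) (C μ 0) a b)
      =O[𝓝[Set.Ici 0] lam] fun μ => ‖μ - lam‖ := by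
  set K := S.optGain (W.Rlam lam) (C lam (Fin.last d)) (C lam 0)
  have h0 : S.gainDefect (W.Rlam lam) K (C lam (Fin.last d)) (C lam 0) = 0 := by
    rw [gainDefect, S.upsilon_mul_optGain (S.posDef_upsilon (hW.posDef_Rlam hlam)
      ((hC lam hlam).1 _) ((hC lam hlam).1 _)), neg_add_cancel]
  have hR : ∀ r s, (fun μ => (W.Rlam μ - W.Rlam lam) r s)
      =O[𝓝[Set.Ici 0] lam] fun μ => ‖μ - lam‖ := by
    intro r s
    simp only [QuadData.Rlam_sub, Matrix.sum_apply, Matrix.smul_apply, smul_eq_mul]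
    refine IsBigO.fun_sum fun i _ => ?_
    simp_rw [mul_comm _ (W.R i r s)]
    refine IsBigO.const_mul_left ?_ _
    exact IsBigO.of_bound 1 (Eventually.of_forall fun μ => by
      rw [one_mul, norm_norm]; exact norm_le_pi_norm (μ - lam) i)
  have h1 : ∀ μ, S.gainDefect (W.Rlam μ) K (C μ (Fin.last d)) (C μ 0)
      = S.Bᵀ * (C μ (Fin.last d) - C lam (Fin.last d)) * (S.A + S.B * K)
        + S.σ ^ 2 • (S.Bbᵀ * (C μ 0 - C lam 0) * (S.Ab + S.Bb * K))
        + 1 * (W.Rlam μ - W.Rlam lam) * K := by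
    intro μ
    rw [Matrix.one_mul, ← gainDefect_sub, h0, sub_zero]
  simp only [h1, Matrix.add_apply, Matrix.smul_apply, smul_eq_mul]
  exact ((isBigO_mul_mul_apply _ _ (hC.isBigO_sub hW hlam _) a b).add
    ((isBigO_mul_mul_apply _ _ (hC.isBigO_sub hW hlam _) a b).const_mul_left _)).add
    (isBigO_mul_mul_apply _ _ hR a b)

lemma runningWeight_sub (W : QuadData n m p) (κ : Fin (d + 1) → Matrix (Fin m) (Fin n) ℝ)
    (μ ν : Fin p → ℝ) :
    runningWeight (W.Qlam μ) (W.Rlam μ) κ - runningWeight (W.Qlam ν) (W.Rlam ν) κ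
      = ∑ i, (μ i - ν i) • runningWeight (W.Q i) (W.R i) κ := by
  funext j
  simp only [Pi.sub_apply, runningWeight, Finset.sum_apply, Pi.smul_apply, smul_add,
    Finset.sum_add_distrib, ← QuadData.Qlam_sub]
  have : ∑ i, (μ i - ν i) • ((κ j)ᵀ * W.R i * κ j) = (κ j)ᵀ * (W.Rlam μ - W.Rlam ν) * κ j := by
    simp [QuadData.Rlam_sub, Matrix.mul_sum, Matrix.sum_mul]
  rw [this, Matrix.mul_sub, Matrix.sub_mul]
  abel

/-- The remainder of the first-order expansion of the solution of the Riccati equation. -/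
def remainder (C : (Fin p → ℝ) → Fin (d + 1) → Matrix (Fin n) (Fin n) ℝ)
    (D : Fin p → Fin (d + 1) → Matrix (Fin n) (Fin n) ℝ) (lam μ : Fin p → ℝ) :
    Fin (d + 1) → Matrix (Fin n) (Fin n) ℝ :=
  C μ - C lam - ∑ i, (μ i - lam i) • D i

/-- With the gain frozen at its value for `lam`, the equation at `μ` is affine up to one completed
square `E` in the last row. Subtracting the equation at `lam` and the linearized equations cancels
all first-order terms. -/
lemma IsRiccatiFamily.remainder_eq (hW : W.Positive) (hC : S.IsRiccatiFamily W C)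
    (hlam : 0 ≤ lam) {D : Fin p → Fin (d + 1) → Matrix (Fin n) (Fin n) ℝ}
    (hD : ∀ i, S.IsLinearized (W.Rlam lam) (W.Q i) (W.R i) (C lam) (D i))
    {μ : Fin p → ℝ} (hμ : 0 ≤ μ) :
    ∃ E : Matrix (Fin n) (Fin n) ℝ, remainder C D lam μ
        = S.lyap (S.optPolicy (W.Rlam lam) (C lam)) (remainder C D lam μ)
          - Pi.single (Fin.last d) E ∧ 0 ≤ E ∧
      ∀ ε : ℝ, 0 < ε → ε • (1 : Matrix (Fin m) (Fin m) ℝ) ≤ W.R₀ →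
        E ≤ (ε⁻¹ * ∑ a, ∑ b, (S.gainDefect (W.Rlam μ)
          (S.optGain (W.Rlam lam) (C lam (Fin.last d)) (C lam 0)) (C μ (Fin.last d)) (C μ 0) a b) ^ 2)
          • (1 : Matrix (Fin n) (Fin n) ℝ) := by
  set K := S.optGain (W.Rlam lam) (C lam (Fin.last d)) (C lam 0) with hK
  set Kμ := S.optGain (W.Rlam μ) (C μ (Fin.last d)) (C μ 0) with hKμ
  set Υ := S.upsilon (W.Rlam μ) (C μ (Fin.last d)) (C μ 0) with hΥdef
  have hZ := (hC μ hμ).1 (Fin.last d)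
  have hX := (hC μ hμ).1 0
  have hΥ : Υ.PosDef := S.posDef_upsilon (hW.posDef_Rlam hμ) hZ hX
  have hsq := S.stepForm_eq_add_square (isSymm_of_nonneg hZ) (isSymm_of_nonneg hX) hΥ K
  have hκ : S.optPolicy (W.Rlam lam) (C lam) = delayedGain d K := rfl
  refine ⟨(K - Kμ)ᵀ * Υ * (K - Kμ), ?_, conj_nonneg hΥ.posSemidef.nonneg _, fun ε hε hεR => ?_⟩
  · have h1 : C μ = S.lyap (delayedGain d K) (C μ)
        + runningWeight (W.Qlam μ) (W.Rlam μ) (delayedGain d K)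
        - Pi.single (Fin.last d) ((K - Kμ)ᵀ * Υ * (K - Kμ)) := by
      conv_lhs => rw [← (hC μ hμ).2]
      funext j
      induction j using Fin.lastCases with
      | last =>
        simp only [riccati, optPolicy, Pi.add_apply, Pi.sub_apply, lyap_last, runningWeight,
          delayedGain_last, Pi.single_eq_same]
        rw [add_left_comm (S.stepForm K _ _), hsq]
        abel
      | cast j =>
        simp [riccati, optPolicy, lyap_castSucc, runningWeight, delayedGain_castSucc,
          Fin.castSucc_ne_last]
    have h2 : C lam = S.lyap (delayedGain d K) (C lam)
        + runningWeight (W.Qlam lam) (W.Rlam lam) (delayedGain d K) := (hC lam hlam).2.symm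
    have h3 : ∑ i, (μ i - lam i) • D i = S.lyap (delayedGain d K) (∑ i, (μ i - lam i) • D i)
        + (runningWeight (W.Qlam μ) (W.Rlam μ) (delayedGain d K)
          - runningWeight (W.Qlam lam) (W.Rlam lam) (delayedGain d K)) := by
      rw [runningWeight_sub, map_sum, ← Finset.sum_add_distrib]
      refine Finset.sum_congr rfl fun i _ => ?_
      rw [map_smul, ← smul_add]
      congr 1
      exact hD i
    rw [hκ]
    conv_lhs => rw [remainder, h1, h2, h3]
    simp only [remainder, map_sub]
    abel
  -- The defect equals `Υ * (K - Kμ)`, so `E` is at most `ε⁻¹` times its square, and the trace turns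
  -- that into a scalar.
  · have hdef : S.gainDefect (W.Rlam μ) K (C μ (Fin.last d)) (C μ 0) = Υ * (K - Kμ) := by
      rw [gainDefect, Matrix.mul_sub, S.upsilon_mul_optGain hΥ, sub_neg_eq_add]
    have hle : ε • (1 : Matrix (Fin m) (Fin m) ℝ) ≤ Υ :=
      hεR.trans ((hW.R₀_le_Rlam hμ).trans (le_add_of_nonneg_left
        (add_nonneg (conj_nonneg hZ _) (smul_nonneg' (conj_nonneg hX _) (sq_nonneg _)))))
    refine (conj_le_of_smul_one_le hε hle (isSymm_of_nonneg hΥ.posSemidef.nonneg) _).trans ?_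
    refine (Matrix.smul_mono_right (transpose_mul_self_le_trace _) (inv_pos.2 hε).le).trans (le_of_eq ?_)
    rw [smul_smul, hdef]
    congr 2
    simp only [trace, diag, mul_apply (M := (Υ * (K - Kμ))ᵀ), transpose_apply, ← sq]
    exact Finset.sum_comm

/-- Comparison from both sides: the remainder is a subsolution, hence nonpositive. Adding a multiple
of `C lam` proportional to `q μ`, the square of the gain defect, outweighs `E`, hence a lower bound
of second order. -/
lemma IsRiccatiFamily.isBigO_remainder (hW : W.Positive) (hC : S.IsRiccatiFamily W C)
    (hlam : 0 ≤ lam) {D : Fin p → Fin (d + 1) → Matrix (Fin n) (Fin n) ℝ}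
    (hs : ∀ i j, (D i j).IsSymm)
    (hD : ∀ i, S.IsLinearized (W.Rlam lam) (W.Q i) (W.R i) (C lam) (D i))
    (j : Fin (d + 1)) (a b : Fin n) :
    (fun μ => remainder C D lam μ j a b) =O[𝓝[Set.Ici 0] lam] fun μ => ‖μ - lam‖ ^ 2 := by
  obtain ⟨ε, hε, hεR⟩ := hW.R₀.exists_smul_one_le
  set q : (Fin p → ℝ) → ℝ := fun μ => ε⁻¹ * ∑ a, ∑ b, (S.gainDefect (W.Rlam μ)
    (S.optGain (W.Rlam lam) (C lam (Fin.last d)) (C lam 0)) (C μ (Fin.last d)) (C μ 0) a b) ^ 2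
    with hq
  have hqO : q =O[𝓝[Set.Ici 0] lam] fun μ => ‖μ - lam‖ ^ 2 := by
    refine IsBigO.const_mul_left (IsBigO.fun_sum fun a _ => IsBigO.fun_sum fun b _ => ?_) _
    exact (hC.isBigO_gainDefect hW hlam a b).pow 2
  have hq0 : ∀ μ, 0 ≤ q μ := fun μ => by positivity
  have hC0 := (hC lam hlam).1
  have hP := posDef_of_fixedPoint (hW.posDef_Qlam hlam) (hW.posDef_Rlam hlam) hC0 (hC lam hlam).2
  have hFP := posDef_sub_lyap_of_fixedPoint (hW.posDef_Qlam hlam) (hW.posDef_Rlam hlam)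
    (hC lam hlam).2
  obtain ⟨c, hc0, hc⟩ := (isSymm_one (n := Fin n) (α := ℝ)).exists_le_smul (hFP (Fin.last d))
  refine IsBigO.trans (g := q) (IsBigO.of_bound (3 / 2 * (c * (C lam j a a + C lam j b b))) ?_) hqO
  filter_upwards [self_mem_nhdsWithin] with μ hμ
  obtain ⟨E, hρ, hE0, hE⟩ := hC.remainder_eq hW hlam hD hμ
  have hEq : E ≤ (q μ) • (1 : Matrix (Fin n) (Fin n) ℝ) := hE ε hε hεR
  set ρ := remainder C D lam μ with hρdef
  have hρs : ∀ j, (ρ j).IsSymm := by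
    intro j
    simp only [hρdef, remainder, Pi.sub_apply, Finset.sum_apply, Pi.smul_apply]
    refine ((isSymm_of_nonneg ((hC μ hμ).1 j)).sub (isSymm_of_nonneg (hC0 j))).sub ?_
    rw [IsSymm, transpose_sum]
    exact Finset.sum_congr rfl fun i _ => by rw [transpose_smul, (hs i j).eq]
  have hE' : 0 ≤ (Pi.single (Fin.last d) E : Fin (d + 1) → Matrix (Fin n) (Fin n) ℝ) :=
    Pi.single_nonneg.2 hE0
  have hup : ρ ≤ 0 := nonpos_of_le_apply (S.lyap_mono _) hP hFP hρs
    (by conv_lhs => rw [hρ]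
        exact sub_le_self _ hE')
  have hlo : -ρ - (q μ * c) • C lam ≤ 0 := by
    refine nonpos_of_le_apply (S.lyap_mono _) hP hFP (fun j => (hρs j).neg.sub
      (IsSymm.smul (isSymm_of_nonneg (hC0 j)) (q μ * c))) ?_
    -- `c` was chosen so that `1` is at most `c` times the last row of the gap `C lam - lyap (C
    -- lam)`; the other rows only need the gap to be nonnegative.
    have h1 : (Pi.single (Fin.last d) E : Fin (d + 1) → Matrix (Fin n) (Fin n) ℝ)
        ≤ (q μ * c) • (C lam - S.lyap (S.optPolicy (W.Rlam lam) (C lam)) (C lam)) := by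
      intro j
      induction j using Fin.lastCases with
      | last =>
        rw [Pi.single_eq_same]
        have := smul_mono_right hc (hq0 μ)
        rw [smul_smul] at this
        exact hEq.trans this
      | cast j =>
        rw [Pi.single_eq_of_ne (Fin.castSucc_ne_last j)]
        exact smul_nonneg' (hFP _).posSemidef.nonneg (mul_nonneg (hq0 μ) hc0.le)
    rw [map_sub, map_neg, map_smul]
    have h2 : S.lyap (S.optPolicy (W.Rlam lam) (C lam)) ρ = ρ + Pi.single (Fin.last d) E := by
      rw [eq_comm, ← eq_sub_iff_add_eq]; exact hρ
    rw [h2]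
    rw [← sub_nonneg] at h1 ⊢
    convert h1 using 1
    rw [smul_sub]
    abel
  have hX : 0 ≤ (q μ * c) • C lam j := smul_nonneg' (hC0 j) (mul_nonneg (hq0 μ) hc0.le)
  have h1 : -((q μ * c) • C lam j) ≤ ρ j := by
    have := hlo j
    simp only [Pi.sub_apply, Pi.neg_apply, Pi.smul_apply, Pi.zero_apply, sub_nonpos] at this
    exact neg_le.1 this
  have := abs_apply_le_of_sandwich hX h1 ((hup j).trans hX) a b
  rw [Real.norm_eq_abs, Real.norm_of_nonneg (hq0 μ)]
  refine this.trans (le_of_eq ?_)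
  simp only [Matrix.smul_apply, smul_eq_mul]
  ring

lemma IsRiccatiFamily.hasMatrixGradient (hW : W.Positive) (hC : S.IsRiccatiFamily W C)
    (hlam : 0 ≤ lam) {D : Fin p → Fin (d + 1) → Matrix (Fin n) (Fin n) ℝ}
    (hs : ∀ i j, (D i j).IsSymm)
    (hD : ∀ i, S.IsLinearized (W.Rlam lam) (W.Q i) (W.R i) (C lam) (D i)) (j : Fin (d + 1)) :
    HasMatrixGradient (fun μ => C μ j) (fun i => D i j) lam := by
  intro a b
  unfold HasOrthantGradient
  rw [hasFDerivWithinAt_iff_isLittleO]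
  have h1 := (hC.isBigO_remainder hW hlam hs hD j a b).trans_isLittleO
    ((isLittleO_pow_sub_sub lam one_lt_two).mono nhdsWithin_le_nhds)
  refine h1.congr_left fun μ => ?_
  simp [remainder, Matrix.sum_apply, mul_comm]

lemma hasMatrixGradient_toZXL (hlam : 0 ≤ lam) {T : (Fin p → ℝ) → ZXL n m}
    (hT : ∀ μ, 0 ≤ μ → T μ = S.toZXL (W.Qlam μ) (W.Rlam μ) (C μ))
    {D : Fin p → Fin (d + 1) → Matrix (Fin n) (Fin n) ℝ}
    (h : ∀ j, HasMatrixGradient (fun μ => C μ j) (fun i => D i j) lam) :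
    HasMatrixGradient (fun μ => (T μ).Z) (fun i => (S.toZXL (W.Q i) (W.R i) (D i)).Z) lam ∧
    HasMatrixGradient (fun μ => (T μ).X) (fun i => (S.toZXL (W.Q i) (W.R i) (D i)).X) lam ∧
    HasMatrixGradient (fun μ => (T μ).L) (fun i => (S.toZXL (W.Q i) (W.R i) (D i)).L) lam ∧
    HasMatrixGradient (fun μ => (T μ).Υ) (fun i => (S.toZXL (W.Q i) (W.R i) (D i)).Υ) lam ∧
    HasMatrixGradient (fun μ => (T μ).M) (fun i => (S.toZXL (W.Q i) (W.R i) (D i)).M) lam := by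
  have hZ := h (Fin.last d)
  have hX := h 0
  have hQ : HasMatrixGradient W.Qlam W.Q lam := HasMatrixGradient.affine _ _
  have hR : HasMatrixGradient W.Rlam W.R lam := HasMatrixGradient.affine _ _
  refine ⟨hZ.congr_of_orthant hlam fun μ hμ => by rw [hT μ hμ]; rfl,
    hX.congr_of_orthant hlam fun μ hμ => by rw [hT μ hμ]; rfl,
    (((((hZ.const_mul _).mul_const _).add (((hX.const_mul _).mul_const _).const_smul _)).add
      hQ).sub hZ).congr_of_orthant hlam fun μ hμ => by rw [hT μ hμ]; rfl,
    ((((hZ.const_mul _).mul_const _).add (((hX.const_mul _).mul_const _).const_smul _)).add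
      hR).congr_of_orthant hlam fun μ hμ => by rw [hT μ hμ]; rfl,
    (((hZ.const_mul _).mul_const _).add
      (((hX.const_mul _).mul_const _).const_smul _)).congr_of_orthant hlam
      fun μ hμ => by rw [hT μ hμ]; rfl⟩

lemma hasOrthantGradient_dualCost (I : InitialData n m d) {T : (Fin p → ℝ) → ZXL n m}
    {D : Fin p → ZXL n m} (hZ : HasMatrixGradient (fun μ => (T μ).Z) (fun i => (D i).Z) lam)
    (hX : HasMatrixGradient (fun μ => (T μ).X) (fun i => (D i).X) lam)
    (hL : HasMatrixGradient (fun μ => (T μ).L) (fun i => (D i).L) lam) :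
    HasOrthantGradient (fun μ => S.dualCost W I μ (T μ)) (fun i => S.dualGrad W I i (D i)) lam := by
  have hR : HasMatrixGradient W.Rlam W.R lam := HasMatrixGradient.affine _ _
  have hc : HasOrthantGradient (fun μ : Fin p → ℝ => ∑ i, μ i * W.c i) W.c lam := by
    simpa using HasOrthantGradient.sum (lam := lam) Finset.univ
      fun i => (HasOrthantGradient.coord i).mul_const (W.c i)
  have hM := ((hZ.const_mul S.Bᵀ).mul_const S.A).add
    (((hX.const_mul S.Bbᵀ).mul_const S.Ab).const_smul (S.σ ^ 2))
  have hΥ := (((hZ.const_mul S.Bᵀ).mul_const S.B).add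
    (((hX.const_mul S.Bbᵀ).mul_const S.Bb).const_smul (S.σ ^ 2))).add hR
  unfold dualCost dualGrad quadExpr
  refine HasOrthantGradient.sub (HasOrthantGradient.add (HasOrthantGradient.sub
    (hZ.dotProduct_mulVec _ _) (HasOrthantGradient.sum _ fun k => hR.dotProduct_mulVec _ _))
    (HasOrthantGradient.sum _ fun k => ?_)) hc
  exact (((hM.dotProduct_mulVec _ _).const_mul 2).add (hL.dotProduct_mulVec _ _)).add
    (hΥ.dotProduct_mulVec _ _)

end DelaySystem

end Sensitivity

/-! ### Square-integrable random vectors and means of quadratic forms. -/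

section SecondMoments

variable {Ω : Type*} {m m' : MeasurableSpace Ω} [m₀ : MeasurableSpace Ω] {P : Measure Ω}

/-- Square-integrable random vectors that are measurable, up to null sets, for `m`. -/
def IsL2Measurable (P : Measure Ω) (m : MeasurableSpace Ω) {a : ℕ} (f : Ω → Fin a → ℝ) : Prop :=
  AEStronglyMeasurable[m] f P ∧ MemLp f 2 P

namespace IsL2Measurable

variable {a b : ℕ} {f g : Ω → Fin a → ℝ}

lemma mono (hm : m ≤ m') (h : IsL2Measurable P m f) : IsL2Measurable P m' f :=
  ⟨h.1.mono hm, h.2⟩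

lemma add (hf : IsL2Measurable P m f) (hg : IsL2Measurable P m g) :
    IsL2Measurable P m (fun s => f s + g s) :=
  ⟨hf.1.add hg.1, hf.2.add hg.2⟩

lemma sub (hf : IsL2Measurable P m f) (hg : IsL2Measurable P m g) :
    IsL2Measurable P m (fun s => f s - g s) :=
  ⟨hf.1.sub hg.1, hf.2.sub hg.2⟩

lemma mulVec (A : Matrix (Fin b) (Fin a) ℝ) (hf : IsL2Measurable P m f) :
    IsL2Measurable P m (fun s => A *ᵥ f s) := by
  refine ⟨?_, ?_⟩
  · have hc : Continuous fun x : Fin a → ℝ => A *ᵥ x := by fun_prop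
    exact hc.comp_aestronglyMeasurable hf.1
  · exact (LinearMap.toContinuousLinearMap A.mulVecLin).comp_memLp' hf.2

lemma const [IsFiniteMeasure P] (x : Fin a → ℝ) : IsL2Measurable P m (fun _ => x) :=
  ⟨aestronglyMeasurable_const, memLp_const x⟩

lemma apply (hf : IsL2Measurable P m f) (i : Fin a) :
    AEStronglyMeasurable[m] (fun s => f s i) P ∧ MemLp (fun s => f s i) 2 P :=
  ⟨(continuous_apply i).comp_aestronglyMeasurable hf.1, hf.2.eval i⟩

end IsL2Measurable

/-- The expectation of a quadratic form of a random vector. -/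
noncomputable def meanQuad (P : Measure Ω) {a : ℕ} (X : Matrix (Fin a) (Fin a) ℝ)
    (f : Ω → Fin a → ℝ) : ℝ :=
  ∫ s, f s ⬝ᵥ (X *ᵥ f s) ∂P

variable {a b : ℕ} {f g : Ω → Fin a → ℝ}

lemma integrable_dotProduct_mulVec {g : Ω → Fin b → ℝ} (hf : MemLp f 2 P) (hg : MemLp g 2 P)
    (X : Matrix (Fin a) (Fin b) ℝ) : Integrable (fun s => f s ⬝ᵥ (X *ᵥ g s)) P := by
  simp only [dotProduct, Matrix.mulVec, Finset.mul_sum]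
  refine integrable_finsetSum _ fun i _ => integrable_finsetSum _ fun j _ => ?_
  have := ((hf.eval i).integrable_mul (hg.eval j)).const_mul (X i j)
  refine this.congr (Eventually.of_forall fun s => ?_)
  simp only [Pi.mul_apply]; ring

lemma meanQuad_eq_sum (hf : MemLp f 2 P) (X : Matrix (Fin a) (Fin a) ℝ) :
    meanQuad P X f = ∑ i, ∑ j, X i j * ∫ s, f s i * f s j ∂P := by
  have hint : ∀ i j, Integrable (fun s => X i j * (f s i * f s j)) P := fun i j =>
    ((hf.eval i).integrable_mul (hf.eval j)).const_mul (X i j)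
  have : meanQuad P X f = ∫ s, ∑ i, ∑ j, X i j * (f s i * f s j) ∂P := by
    refine integral_congr_ae (Eventually.of_forall fun s => ?_)
    simp only [dotProduct, Matrix.mulVec, Finset.mul_sum]
    refine Finset.sum_congr rfl fun i _ => Finset.sum_congr rfl fun j _ => ?_
    ring
  rw [this, integral_finsetSum _ fun i _ => integrable_finsetSum _ fun j _ => hint i j]
  refine Finset.sum_congr rfl fun i _ => ?_
  rw [integral_finsetSum _ fun j _ => hint i j]
  exact Finset.sum_congr rfl fun j _ => integral_const_mul _ _

lemma meanQuad_congr (X : Matrix (Fin a) (Fin a) ℝ) (h : f =ᵐ[P] g) :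
    meanQuad P X f = meanQuad P X g :=
  integral_congr_ae (h.mono fun s hs => by simp only [hs])

lemma meanQuad_add_left (hf : MemLp f 2 P) (X Y : Matrix (Fin a) (Fin a) ℝ) :
    meanQuad P (X + Y) f = meanQuad P X f + meanQuad P Y f := by
  simp only [meanQuad, add_mulVec, dotProduct_add]
  exact integral_add (integrable_dotProduct_mulVec hf hf X) (integrable_dotProduct_mulVec hf hf Y)

lemma meanQuad_smul (c : ℝ) (X : Matrix (Fin a) (Fin a) ℝ) :
    meanQuad P (c • X) f = c * meanQuad P X f := by
  simp only [meanQuad, smul_mulVec, dotProduct_smul, smul_eq_mul]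
  exact integral_const_mul _ _

lemma meanQuad_mulVec (X : Matrix (Fin b) (Fin b) ℝ) (A : Matrix (Fin b) (Fin a) ℝ) :
    meanQuad P X (fun s => A *ᵥ f s) = meanQuad P (Aᵀ * X * A) f := by
  simp only [meanQuad, dotProduct_mulVec_conj]

lemma meanQuad_nonneg {X : Matrix (Fin a) (Fin a) ℝ} (hX : X.PosSemidef) :
    0 ≤ meanQuad P X f :=
  integral_nonneg fun s => by simpa using hX.dotProduct_mulVec_nonneg (f s)

lemma meanQuad_add_of_orthogonal (hf : MemLp f 2 P) (hg : MemLp g 2 P)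
    (h : ∀ i j, ∫ s, f s i * g s j ∂P = 0) (X : Matrix (Fin a) (Fin a) ℝ) :
    meanQuad P X (fun s => f s + g s) = meanQuad P X f + meanQuad P X g := by
  rw [meanQuad_eq_sum hf, meanQuad_eq_sum hg, meanQuad_eq_sum (f := fun s => f s + g s) (hf.add hg), ← Finset.sum_add_distrib]
  refine Finset.sum_congr rfl fun i _ => ?_
  rw [← Finset.sum_add_distrib]
  refine Finset.sum_congr rfl fun j _ => ?_
  rw [← mul_add]
  congr 1
  have e : ∀ s, (f s + g s) i * (f s + g s) j
      = (f s i * f s j + g s i * g s j) + (f s i * g s j + f s j * g s i) := fun s => by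
    simp only [Pi.add_apply]; ring
  have i1 : Integrable (fun s => f s i * f s j) P := (hf.eval i).integrable_mul (hf.eval j)
  have i2 : Integrable (fun s => g s i * g s j) P := (hg.eval i).integrable_mul (hg.eval j)
  have i3 : Integrable (fun s => f s i * g s j) P := (hf.eval i).integrable_mul (hg.eval j)
  have i4 : Integrable (fun s => f s j * g s i) P := (hf.eval j).integrable_mul (hg.eval i)
  simp only [e]
  have s1 := integral_add (i1.add i2) (i3.add i4)
  have s2 := integral_add i1 i2
  have s3 := integral_add i3 i4
  simp only [Pi.add_apply] at s1
  rw [s1, s2, s3, h i j, h j i]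
  ring

end SecondMoments

/-! ### Multiplication by a noise variable independent of the past. -/

section WhiteNoise

variable {Ω : Type*} {w : ℕ → Ω → ℝ} {σ : ℝ}

lemma past_mono (w : ℕ → Ω → ℝ) {k l : ℕ} (h : k ≤ l) : past w k ≤ past w l :=
  iSup_le fun i => le_iSup (fun j : Fin l => MeasurableSpace.comap (w j) inferInstance)
    (Fin.castLE h i)

lemma comap_le_past (w : ℕ → Ω → ℝ) {k l : ℕ} (h : k < l) :
    MeasurableSpace.comap (w k) inferInstance ≤ past w l :=
  le_iSup (fun j : Fin l => MeasurableSpace.comap (w j) inferInstance) ⟨k, h⟩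

variable [m₀ : MeasurableSpace Ω] {P : Measure Ω}

namespace IsWhiteNoise

lemma past_le (hw : IsWhiteNoise P w σ) (k : ℕ) : past w k ≤ m₀ :=
  iSup_le fun i => (hw.measurable i).comap_le

lemma indep_past (hw : IsWhiteNoise P w σ) (k : ℕ) :
    Indep (MeasurableSpace.comap (w k) inferInstance) (past w k) P := by
  have h := indep_iSup_of_disjoint (fun i => (hw.measurable i).comap_le) hw.indep
    (S := {k}) (T := Set.Iio k) (by simp)
  refine indep_of_indep_of_le_left (indep_of_indep_of_le_right h ?_) ?_
  · exact iSup_le fun i => le_iSup₂_of_le (i : ℕ) i.2 le_rfl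
  · exact le_iSup₂_of_le k rfl le_rfl

lemma indepFun (hw : IsWhiteNoise P w σ) {k : ℕ} {f : Ω → ℝ}
    (hf : AEStronglyMeasurable[past w k] f P) : IndepFun (w k) f P := by
  obtain ⟨g, hg, hfg⟩ := hf
  refine IndepFun.congr (f := w k) (g := g) ?_ Filter.EventuallyEq.rfl hfg.symm
  rw [IndepFun_iff_Indep]
  exact indep_of_indep_of_le_right (hw.indep_past k) hg.measurable.comap_le

/-- No fourth moments are needed: `w k ^ 2` and `f ^ 2` are independent and integrable, so their
product is integrable. -/
lemma memLp_mul (hw : IsWhiteNoise P w σ) {k : ℕ} {f : Ω → ℝ}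
    (hf : AEStronglyMeasurable[past w k] f P) (hf2 : MemLp f 2 P) :
    MemLp (fun s => w k s * f s) 2 P := by
  have h1 := (hw.indepFun hf).comp (φ := fun x => x ^ 2) (ψ := fun x => x ^ 2)
    (by fun_prop) (by fun_prop)
  have h2 := h1.integrable_mul (hw.memLp k).integrable_sq hf2.integrable_sq
  have h3 : AEStronglyMeasurable (fun s => w k s * f s) P := (hw.memLp k).1.mul hf2.1
  rw [memLp_two_iff_integrable_sq h3]
  refine h2.congr (Eventually.of_forall fun s => ?_)
  simp [mul_pow]

lemma integral_mul_eq_zero (hw : IsWhiteNoise P w σ) {k : ℕ} {f : Ω → ℝ}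
    (hf : AEStronglyMeasurable[past w k] f P) : ∫ s, w k s * f s ∂P = 0 := by
  rw [(hw.indepFun hf).integral_fun_mul_eq_mul_integral (hw.memLp k).1
    (hf.mono (hw.past_le k)), hw.mean, zero_mul]

lemma integral_mul_mul (hw : IsWhiteNoise P w σ) {k : ℕ} {f g : Ω → ℝ}
    (hf : AEStronglyMeasurable[past w k] f P) (hg : AEStronglyMeasurable[past w k] g P) :
    ∫ s, (w k s * f s) * (w k s * g s) ∂P = σ ^ 2 * ∫ s, f s * g s ∂P := by
  have h1 := (hw.indepFun (hf.mul hg)).comp (φ := fun x => x ^ 2) (ψ := id)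
    (by fun_prop) measurable_id
  have h2 := h1.integral_fun_mul_eq_mul_integral ((hw.memLp k).1.pow 2)
    ((hf.mono (hw.past_le k)).mul (hg.mono (hw.past_le k)))
  simp only [Function.comp, id, Pi.mul_apply] at h2
  rw [hw.variance] at h2
  rw [← h2]
  exact integral_congr_ae (Eventually.of_forall fun s => by simp only; ring)

variable {a : ℕ} {f : Ω → Fin a → ℝ}

lemma isL2Measurable_smul (hw : IsWhiteNoise P w σ) {k : ℕ} (hf : IsL2Measurable P (past w k) f) :
    IsL2Measurable P (past w (k + 1)) (fun s => w k s • f s) := by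
  refine ⟨?_, memLp_pi_iff.2 fun i => ?_⟩
  · have h : Measurable[past w (k + 1)] (w k) :=
      measurable_iff_comap_le.2 (comap_le_past w k.lt_succ_self)
    have h' : AEStronglyMeasurable[past w (k + 1)] (w k) P :=
      h.stronglyMeasurable.aestronglyMeasurable
    exact h'.smul (hf.1.mono (past_mono w k.le_succ))
  · exact hw.memLp_mul (hf.apply i).1 (hf.apply i).2

lemma meanQuad_smul (hw : IsWhiteNoise P w σ) {k : ℕ} (hf : IsL2Measurable P (past w k) f)
    (X : Matrix (Fin a) (Fin a) ℝ) :
    meanQuad P X (fun s => w k s • f s) = σ ^ 2 * meanQuad P X f := by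
  rw [meanQuad_eq_sum (hw.isL2Measurable_smul hf).2, meanQuad_eq_sum hf.2]
  simp only [Pi.smul_apply, smul_eq_mul, Finset.mul_sum]
  refine Finset.sum_congr rfl fun i _ => Finset.sum_congr rfl fun j _ => ?_
  rw [hw.integral_mul_mul (hf.apply i).1 (hf.apply j).1]
  ring

end IsWhiteNoise

end WhiteNoise

/-! ### Orthogonal decomposition of the state and evolution of its energy. -/

section Decomposition

variable {Ω : Type*} {n m d : ℕ} {S : DelaySystem n m} {w : ℕ → Ω → ℝ} {I : InitialData n m d}
  {u : ℕ → Ω → Fin m → ℝ}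

namespace DelaySystem

/-- The contribution of the noise of time `k - 1 - j` to the state at time `k`, as long as the
controller has not reacted to it. -/
def innov (S : DelaySystem n m) (w : ℕ → Ω → ℝ) (I : InitialData n m d)
    (u : ℕ → Ω → Fin m → ℝ) : ℕ → ℕ → Ω → Fin n → ℝ
  | 0, _, _ => 0
  | k + 1, 0, s => w k s • (S.Ab *ᵥ S.state w I u k s + S.Bb *ᵥ delayedInput I u k s)
  | k + 1, j + 1, s => S.A *ᵥ S.innov w I u k j s

/-- The part of the state at time `k` that is known to the controller of the input acting at
time `k`. -/
def known (S : DelaySystem n m) (w : ℕ → Ω → ℝ) (I : InitialData n m d)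
    (u : ℕ → Ω → Fin m → ℝ) : ℕ → Ω → Fin n → ℝ
  | 0, _ => I.x₀
  | k + 1, s => S.A *ᵥ S.known w I u k s + S.A *ᵥ S.innov w I u k (d - 1) s
      + S.B *ᵥ delayedInput I u k s

/-- Every innovation ages by one step; the one of age `d - 1` leaves the sum and enters `known`,
while the fresh noise takes age `0`. -/
lemma state_eq_known_add (hd : 0 < d) (k : ℕ) (s : Ω) :
    S.state w I u k s = S.known w I u k s + ∑ j ∈ Finset.range d, S.innov w I u k j s := by
  obtain ⟨d, rfl⟩ : ∃ e, d = e + 1 := ⟨d - 1, by omega⟩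
  induction k with
  | zero => simp [state, known, innov]
  | succ k ih =>
    rw [Finset.sum_range_succ']
    simp only [state, known, innov, Nat.add_sub_cancel]
    conv_lhs => rw [add_mulVec, add_mulVec, smul_mulVec, smul_mulVec]
    rw [smul_add, ← mulVec_sum]
    conv_lhs => enter [1, 1]; rw [ih, Finset.sum_range_succ, mulVec_add, mulVec_add]
    abel

variable [m₀ : MeasurableSpace Ω] {P : Measure Ω}

/-- The weights `C` applied to the second moments of the parts of the state at time `k`. -/
noncomputable def energy (S : DelaySystem n m) (P : Measure Ω) (w : ℕ → Ω → ℝ)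
    (I : InitialData n m d) (u : ℕ → Ω → Fin m → ℝ)
    (C : Fin (d + 1) → Matrix (Fin n) (Fin n) ℝ) (k : ℕ) : ℝ :=
  meanQuad P (C (Fin.last d)) (S.known w I u k)
    + ∑ j : Fin d, meanQuad P (C j.castSucc) (S.innov w I u k j)

variable [IsProbabilityMeasure P] (hw : IsWhiteNoise P w S.σ) (hu : IsAdaptedInput P w u)

include hu in
lemma isL2Measurable_delayedInput (I : InitialData n m d) (k : ℕ) :
    IsL2Measurable P (past w (k - d)) (delayedInput I u k) := by
  by_cases h : k < d
  · have : delayedInput I u k = fun _ => I.uPre ⟨k, h⟩ := by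
      funext s; simp [delayedInput, h]
    rw [this]
    exact IsL2Measurable.const _
  · have : delayedInput I u k = u (k - d) := by
      funext s; simp [delayedInput, h]
    rw [this]
    exact hu (k - d)

include hw hu

lemma isL2Measurable_state (k : ℕ) : IsL2Measurable P (past w k) (S.state w I u k) := by
  induction k with
  | zero => exact IsL2Measurable.const _
  | succ k ih =>
    have hv : IsL2Measurable P (past w k) (delayedInput I u k) :=
      (isL2Measurable_delayedInput hu I k).mono (past_mono w (Nat.sub_le _ _))
    have h1 := ((ih.mulVec S.A).add (hv.mulVec S.B)).mono (past_mono w k.le_succ)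
    have h2 := hw.isL2Measurable_smul ((ih.mulVec S.Ab).add (hv.mulVec S.Bb))
    have : S.state w I u (k + 1) = fun s => (S.A *ᵥ S.state w I u k s
        + S.B *ᵥ delayedInput I u k s) + w k s • (S.Ab *ᵥ S.state w I u k s
        + S.Bb *ᵥ delayedInput I u k s) := by
      funext s
      simp only [state, add_mulVec, smul_mulVec, smul_add]
      abel
    rw [this]
    exact h1.add h2

lemma isL2Measurable_excitation (k : ℕ) : IsL2Measurable P (past w k)
    (fun s => S.Ab *ᵥ S.state w I u k s + S.Bb *ᵥ delayedInput I u k s) :=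
  ((isL2Measurable_state hw hu k).mulVec S.Ab).add
    (((isL2Measurable_delayedInput hu I k).mono (past_mono w (Nat.sub_le _ _))).mulVec S.Bb)

lemma isL2Measurable_innov (k j : ℕ) :
    IsL2Measurable P (past w (k - j)) (S.innov w I u k j) := by
  induction k generalizing j with
  | zero => exact IsL2Measurable.const 0
  | succ k ih =>
    cases j with
    | zero => exact hw.isL2Measurable_smul (isL2Measurable_excitation hw hu k)
    | succ j =>
      rw [Nat.add_sub_add_right]
      exact (ih j).mulVec S.A

/-- The innovations are orthogonal to everything known before. -/
lemma integral_innov_mul (k j : ℕ) (i : Fin n) {y : Ω → ℝ}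
    (hy : AEStronglyMeasurable[past w (k - j - 1)] y P) (hy2 : MemLp y 2 P) :
    ∫ s, S.innov w I u k j s i * y s ∂P = 0 := by
  induction k generalizing j i with
  | zero => simp [innov]
  | succ k ih =>
    cases j with
    | zero =>
      have hf := ((isL2Measurable_excitation (S := S) (I := I) hw hu k).apply i).1
      have := hw.integral_mul_eq_zero (hf.mul hy)
      rw [← this]
      refine integral_congr_ae (Eventually.of_forall fun s => ?_)
      simp only [innov, Pi.smul_apply, smul_eq_mul, Pi.mul_apply]
      ring
    | succ j =>
      rw [Nat.add_sub_add_right] at hy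
      have hint : ∀ l ∈ Finset.univ,
          Integrable (fun s => S.A i l * (S.innov w I u k j s l * y s)) P := fun l _ =>
        ((((isL2Measurable_innov hw hu k j).apply l).2).integrable_mul hy2).const_mul _
      have : ∀ s, S.innov w I u (k + 1) (j + 1) s i * y s
          = ∑ l, S.A i l * (S.innov w I u k j s l * y s) := fun s => by
        simp only [innov, Matrix.mulVec, dotProduct, Finset.sum_mul, mul_assoc]
      simp only [this]
      rw [integral_finsetSum _ hint]
      refine Finset.sum_eq_zero fun l _ => ?_
      rw [integral_const_mul, ih j l hy, mul_zero]

lemma isL2Measurable_known (hd : 0 < d) (k : ℕ) :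
    IsL2Measurable P (past w (k - d)) (S.known w I u k) := by
  induction k with
  | zero => exact IsL2Measurable.const _
  | succ k ih =>
    have h1 := (ih.mulVec S.A).mono (past_mono w (by omega : k - d ≤ k + 1 - d))
    have h2 := ((isL2Measurable_innov (S := S) (I := I) hw hu k (d - 1)).mulVec S.A).mono
      (past_mono w (by omega : k - (d - 1) ≤ k + 1 - d))
    have h3 := ((isL2Measurable_delayedInput hu I k).mulVec S.B).mono
      (past_mono w (by omega : k - d ≤ k + 1 - d))
    exact (h1.add h2).add h3

/-- The innovations are added from the oldest to the newest, so that each is orthogonal to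
everything already in the sum; the order is reversed at the end. -/
lemma meanQuad_add_sum_innov {a : ℕ} (k : ℕ) (U : Matrix (Fin a) (Fin n) ℝ)
    {f : Ω → Fin a → ℝ} (hf : IsL2Measurable P (past w (k - d)) f)
    (X : Matrix (Fin a) (Fin a) ℝ) :
    meanQuad P X (fun s => f s + ∑ j ∈ Finset.range d, U *ᵥ S.innov w I u k j s)
      = meanQuad P X f + ∑ j ∈ Finset.range d, meanQuad P (Uᵀ * X * U) (S.innov w I u k j) := by
  have key : ∀ i ≤ d, IsL2Measurable P (past w (k - (d - i)))
        (fun s => f s + ∑ j ∈ Finset.range i, U *ᵥ S.innov w I u k (d - 1 - j) s) ∧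
      meanQuad P X (fun s => f s + ∑ j ∈ Finset.range i, U *ᵥ S.innov w I u k (d - 1 - j) s)
        = meanQuad P X f
          + ∑ j ∈ Finset.range i, meanQuad P (Uᵀ * X * U) (S.innov w I u k (d - 1 - j)) := by
    intro i hi
    induction i with
    | zero => simpa using hf
    | succ i ih =>
      obtain ⟨ih1, ih2⟩ := ih (by omega)
      have he := isL2Measurable_innov (S := S) (I := I) hw hu k (d - 1 - i)
      have hU := he.mulVec U
      have hfun : (fun s => f s + ∑ j ∈ Finset.range (i + 1), U *ᵥ S.innov w I u k (d - 1 - j) s)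
          = fun s => (f s + ∑ j ∈ Finset.range i, U *ᵥ S.innov w I u k (d - 1 - j) s)
            + U *ᵥ S.innov w I u k (d - 1 - i) s := by
        funext s
        rw [Finset.sum_range_succ, add_assoc]
      rw [hfun]
      refine ⟨(ih1.mono (past_mono w (by omega))).add (hU.mono (past_mono w (by omega))), ?_⟩
      rw [meanQuad_add_of_orthogonal ih1.2 hU.2, ih2, meanQuad_mulVec, Finset.sum_range_succ,
        add_assoc]
      intro r t
      have hy := ih1.apply r
      have hpast : k - (d - 1 - i) - 1 = k - (d - i) := by omega
      have hint : ∀ l ∈ Finset.univ, Integrable (fun s => U t l * (S.innov w I u k (d - 1 - i) s l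
          * (f s + ∑ j ∈ Finset.range i, U *ᵥ S.innov w I u k (d - 1 - j) s) r)) P := fun l _ =>
        ((he.apply l).2.integrable_mul hy.2).const_mul _
      have : ∀ s, (f s + ∑ j ∈ Finset.range i, U *ᵥ S.innov w I u k (d - 1 - j) s) r
            * (U *ᵥ S.innov w I u k (d - 1 - i) s) t
          = ∑ l, U t l * (S.innov w I u k (d - 1 - i) s l
          * (f s + ∑ j ∈ Finset.range i, U *ᵥ S.innov w I u k (d - 1 - j) s) r) := fun s => by
        simp only [Matrix.mulVec, dotProduct, Finset.mul_sum]
        exact Finset.sum_congr rfl fun l _ => by ring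
      simp only [this]
      rw [integral_finsetSum _ hint]
      refine Finset.sum_eq_zero fun l _ => ?_
      rw [integral_const_mul, integral_innov_mul hw hu k _ l (by rw [hpast]; exact hy.1) hy.2,
        mul_zero]
  have h := (key d le_rfl).2
  have hr := Finset.sum_range_reflect (fun j => meanQuad P (Uᵀ * X * U) (S.innov w I u k j)) d
  rw [← hr, ← h]
  congr 1
  funext s
  rw [← Finset.sum_range_reflect (fun j => U *ᵥ S.innov w I u k j s) d]

lemma meanQuad_state (hd : 0 < d) (k : ℕ) (Q : Matrix (Fin n) (Fin n) ℝ) :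
    meanQuad P Q (S.state w I u k) = S.energy P w I u (fun _ => Q) k := by
  have h := meanQuad_add_sum_innov (S := S) (I := I) hw hu k 1
    (isL2Measurable_known (S := S) (I := I) hw hu hd k) Q
  simp only [one_mulVec, transpose_one, Matrix.one_mul, Matrix.mul_one,
    ← state_eq_known_add hd k] at h
  refine h.trans ?_
  rw [energy, Finset.sum_range]

/-- One step of the second moments for an arbitrary adapted input. The fresh innovation is excited
by the whole state, so its term splits over the known part and every age; this is why `C 0` appears
in each summand. -/
lemma energy_succ (hd : 0 < d) (k : ℕ) (C : Fin (d + 1) → Matrix (Fin n) (Fin n) ℝ) :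
    S.energy P w I u C (k + 1)
      = meanQuad P (C (Fin.last d))
          (fun s => S.A *ᵥ S.known w I u k s + S.B *ᵥ delayedInput I u k s)
        + S.σ ^ 2 * meanQuad P (C 0)
          (fun s => S.Ab *ᵥ S.known w I u k s + S.Bb *ᵥ delayedInput I u k s)
        + ∑ j : Fin d, meanQuad P (S.Aᵀ * C j.succ * S.A + S.σ ^ 2 • (S.Abᵀ * C 0 * S.Ab))
          (S.innov w I u k j) := by
  obtain ⟨d, rfl⟩ : ∃ e, d = e + 1 := ⟨d - 1, by omega⟩
  have hk := isL2Measurable_known (S := S) (I := I) hw hu hd k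
  have hv := isL2Measurable_delayedInput hu I k
  have he := isL2Measurable_innov (S := S) (I := I) hw hu k
  have e1 : meanQuad P (C (Fin.last (d + 1))) (S.known w I u (k + 1))
      = meanQuad P (C (Fin.last (d + 1)))
          (fun s => S.A *ᵥ S.known w I u k s + S.B *ᵥ delayedInput I u k s)
        + meanQuad P (S.Aᵀ * C (Fin.last (d + 1)) * S.A) (S.innov w I u k d) := by
    have hf := (hk.mulVec S.A).add (hv.mulVec S.B)
    have : S.known w I u (k + 1) = fun s => (S.A *ᵥ S.known w I u k s
        + S.B *ᵥ delayedInput I u k s) + S.A *ᵥ S.innov w I u k d s := by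
      funext s
      simp only [known, Nat.add_sub_cancel]
      abel
    rw [this, meanQuad_add_of_orthogonal hf.2 ((he d).mulVec S.A).2, meanQuad_mulVec]
    intro r t
    have hy := hf.apply r
    have := integral_innov_mul (S := S) (I := I) hw hu (k + 1) (d + 1) t (y := fun s =>
      (S.A *ᵥ S.known w I u k s + S.B *ᵥ delayedInput I u k s) r)
      (by
        have hp : k + 1 - (d + 1) - 1 = k - (d + 1) := by omega
        rw [hp]; exact hy.1) hy.2
    rw [← this]
    exact integral_congr_ae (Eventually.of_forall fun s => by simp only [innov]; ring)
  have e2 : meanQuad P (C 0) (S.innov w I u (k + 1) 0)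
      = S.σ ^ 2 * meanQuad P (C 0)
          (fun s => S.Ab *ᵥ S.known w I u k s + S.Bb *ᵥ delayedInput I u k s)
        + ∑ j : Fin (d + 1), meanQuad P (S.σ ^ 2 • (S.Abᵀ * C 0 * S.Ab)) (S.innov w I u k j) := by
    have h1 := hw.meanQuad_smul (isL2Measurable_excitation (S := S) (I := I) hw hu k) (C 0)
    have h2 := meanQuad_add_sum_innov (S := S) (I := I) hw hu k S.Ab
      ((hk.mulVec S.Ab).add (hv.mulVec S.Bb)) (C 0)
    have h3 : ∀ s, S.Ab *ᵥ S.state w I u k s + S.Bb *ᵥ delayedInput I u k s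
        = (S.Ab *ᵥ S.known w I u k s + S.Bb *ᵥ delayedInput I u k s)
          + ∑ j ∈ Finset.range (d + 1), S.Ab *ᵥ S.innov w I u k j s := by
      intro s
      rw [state_eq_known_add hd, mulVec_add, mulVec_sum]
      abel
    refine h1.trans ?_
    simp only [h3]
    rw [h2, mul_add, Finset.sum_range, Finset.mul_sum]
    simp only [_root_.meanQuad_smul]
  have e3 : ∀ j : Fin d, meanQuad P (C j.succ.castSucc) (S.innov w I u (k + 1) (j.succ : Fin (d + 1)))
      = meanQuad P (S.Aᵀ * C j.castSucc.succ * S.A) (S.innov w I u k j) := by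
    intro j
    rw [← Fin.succ_castSucc, ← meanQuad_mulVec]
    rfl
  rw [energy, Fin.sum_univ_succ]
  simp only [e3]
  change _ + (meanQuad P (C 0) (S.innov w I u (k + 1) 0) + _) = _
  rw [e1, e2]
  have e4 : ∀ j : Fin (d + 1), meanQuad P (S.Aᵀ * C j.succ * S.A + S.σ ^ 2 • (S.Abᵀ * C 0 * S.Ab))
      (S.innov w I u k j) = meanQuad P (S.Aᵀ * C j.succ * S.A) (S.innov w I u k j)
        + meanQuad P (S.σ ^ 2 • (S.Abᵀ * C 0 * S.Ab)) (S.innov w I u k j) := fun j =>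
    meanQuad_add_left (he j).2 _ _
  simp only [e4, Finset.sum_add_distrib]
  rw [Fin.sum_univ_castSucc (f := fun j : Fin (d + 1) =>
    meanQuad P (S.Aᵀ * C j.succ * S.A) (S.innov w I u k j))]
  simp only [Fin.val_castSucc, Fin.val_last, Fin.succ_last]
  ring

end DelaySystem

end Decomposition

/-! ### From mean-square stabilizability to a Lyapunov certificate. -/

section Stabilizability

open scoped MatrixOrder

variable {Ω : Type*} {n m d : ℕ} {S : DelaySystem n m} {w : ℕ → Ω → ℝ} {I : InitialData n m d}
  {u : ℕ → Ω → Fin m → ℝ}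

namespace DelaySystem

/-- There is no noise before time `0`. -/
lemma innov_eq_zero {k j : ℕ} (h : k ≤ j) (s : Ω) : S.innov w I u k j s = 0 := by
  induction k generalizing j with
  | zero => rfl
  | succ k ih =>
    obtain ⟨j, rfl⟩ : ∃ i, j = i + 1 := ⟨j - 1, by omega⟩
    rw [innov, ih (by omega), mulVec_zero]

/-- The state of the noise-free closed loop with gain `κ k` at time `k`. -/
def nominal (S : DelaySystem n m) (κ : ℕ → Matrix (Fin m) (Fin n) ℝ) (x : Fin n → ℝ) :
    ℕ → Fin n → ℝ
  | 0 => x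
  | k + 1 => (S.A + S.B * κ k) *ᵥ S.nominal κ x k

/-- The initial inputs produced by the feedback `κ`. -/
def nominalData (S : DelaySystem n m) (d : ℕ) (κ : ℕ → Matrix (Fin m) (Fin n) ℝ)
    (x : Fin n → ℝ) : InitialData n m d where
  x₀ := x
  uPre k := κ k *ᵥ S.nominal κ x k

/-- Up to time `d` no noise has reached the known part, so it is deterministic. Prescribed initial
inputs can therefore imitate a feedback that acts from time `0`. -/
lemma known_nominalData {κ : ℕ → Matrix (Fin m) (Fin n) ℝ} {x : Fin n → ℝ} {k : ℕ} (hk : k ≤ d)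
    (s : Ω) : S.known w (S.nominalData d κ x) u k s = S.nominal κ x k := by
  induction k with
  | zero => rfl
  | succ k ih =>
    rw [known, ih (by omega), innov_eq_zero (by omega), mulVec_zero, add_zero, delayedInput,
      dif_pos (by omega : k < d), nominal, add_mulVec, ← mulVec_mulVec]
    rfl

lemma delayedInput_nominalData {κ : ℕ → Matrix (Fin m) (Fin n) ℝ} {x : Fin n → ℝ} {k : ℕ}
    (hk : k < d) (s : Ω) : delayedInput (S.nominalData d κ x) u k s
      = κ k *ᵥ S.known w (S.nominalData d κ x) u k s := by
  rw [known_nominalData hk.le, delayedInput, dif_pos hk]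
  rfl

variable [m₀ : MeasurableSpace Ω] {P : Measure Ω} [IsProbabilityMeasure P]

lemma energy_zero (C : Fin (d + 1) → Matrix (Fin n) (Fin n) ℝ) :
    S.energy P w I u C 0 = I.x₀ ⬝ᵥ (C (Fin.last d) *ᵥ I.x₀) := by
  simp [energy, meanQuad, known, innov]

variable (hw : IsWhiteNoise P w S.σ) (hu : IsAdaptedInput P w u)

include hw hu

/-- The known part of the state is its conditional expectation given the information of the
controller. -/
lemma known_ae_eq_condExp (hd : 0 < d) (k : ℕ) :
    S.known w I u (k + d) =ᵐ[P] P[S.state w I u (k + d) | past w k] := by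
  have hk := isL2Measurable_known (S := S) (I := I) hw hu hd (k + d)
  rw [Nat.add_sub_cancel] at hk
  have hint := hk.2.integrable one_le_two
  have hm := hw.past_le k
  refine ae_eq_condExp_of_forall_setIntegral_eq hm
    ((isL2Measurable_state hw hu (k + d)).2.integrable one_le_two)
    (fun _ _ _ => hint.integrableOn) (fun A hA _ => ?_) hk.1
  have he := fun j => (isL2Measurable_innov (S := S) (I := I) hw hu (k + d) j).2.integrable
    one_le_two
  have hst : ∫ s in A, S.state w I u (k + d) s ∂P = ∫ s in A, S.known w I u (k + d) s ∂P
      + ∑ j ∈ Finset.range d, ∫ s in A, S.innov w I u (k + d) j s ∂P := by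
    rw [← integral_finsetSum _ fun j _ => (he j).integrableOn,
      ← integral_add hint.integrableOn (integrable_finsetSum _ fun j _ => (he j).integrableOn)]
    exact integral_congr_ae (Eventually.of_forall fun s => state_eq_known_add hd _ s)
  rw [hst, left_eq_add]
  refine Finset.sum_eq_zero fun j hj => ?_
  have hjd := Finset.mem_range.1 hj
  funext i
  rw [eval_integral fun i => ((he j).eval i).integrableOn, ← integral_indicator (hm _ hA)]
  have h0 := integral_innov_mul (S := S) (I := I) hw hu (k + d) j i
    (y := A.indicator fun _ => 1)
    (((stronglyMeasurable_const.indicator hA).mono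
      (past_mono w (by omega))).aestronglyMeasurable)
    ((memLp_const (1 : ℝ)).indicator (hm _ hA))
  rw [Pi.zero_apply, ← h0]
  refine integral_congr_ae (Eventually.of_forall fun s => ?_)
  by_cases hs : s ∈ A <;> simp [hs]

/-- One step of the evolution of the second moments under a feedback from the known part of the
state. -/
lemma energy_succ_of_feedback (hd : 0 < d) {K : Matrix (Fin m) (Fin n) ℝ} {k : ℕ}
    (hv : delayedInput I u k =ᵐ[P] fun s => K *ᵥ S.known w I u k s)
    (C : Fin (d + 1) → Matrix (Fin n) (Fin n) ℝ) :
    S.energy P w I u C (k + 1) = S.energy P w I u (S.lyap (delayedGain d K) C) k := by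
  have hk := (isL2Measurable_known (S := S) (I := I) hw hu hd k).2
  rw [energy_succ hw hu hd, energy]
  simp only [lyap_castSucc]
  congr 1
  have e1 : (fun s => S.A *ᵥ S.known w I u k s + S.B *ᵥ delayedInput I u k s)
      =ᵐ[P] fun s => (S.A + S.B * K) *ᵥ S.known w I u k s := by
    filter_upwards [hv] with s hs
    rw [hs, add_mulVec, mulVec_mulVec]
  have e2 : (fun s => S.Ab *ᵥ S.known w I u k s + S.Bb *ᵥ delayedInput I u k s)
      =ᵐ[P] fun s => (S.Ab + S.Bb * K) *ᵥ S.known w I u k s := by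
    filter_upwards [hv] with s hs
    rw [hs, add_mulVec, mulVec_mulVec]
  rw [meanQuad_congr _ e1, meanQuad_congr _ e2, meanQuad_mulVec, meanQuad_mulVec, lyap_last,
    stepForm, meanQuad_add_left hk, meanQuad_smul]

lemma energy_add_of_feedback (hd : 0 < d) {K : Matrix (Fin m) (Fin n) ℝ} {l : ℕ}
    (hv : ∀ k, l ≤ k → delayedInput I u k =ᵐ[P] fun s => K *ᵥ S.known w I u k s)
    (C : Fin (d + 1) → Matrix (Fin n) (Fin n) ℝ) (N : ℕ) :
    S.energy P w I u C (l + N) = S.energy P w I u ((S.lyap (delayedGain d K))^[N] C) l := by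
  induction N generalizing C with
  | zero => rfl
  | succ N ih =>
    rw [← add_assoc, energy_succ_of_feedback hw hu hd (hv _ (Nat.le_add_right _ _)), ih,
      Function.iterate_succ_apply]

omit hu in
/-- A stabilizing gain makes the quadratic forms obtained by iterating the Lyapunov operator
decay, also if another gain is used in the first step. -/
lemma tendsto_stepForm_iterate (hd : 0 < d) {K : Matrix (Fin m) (Fin n) ℝ}
    (hK : ∀ I : InitialData n m d, ∃ u : ℕ → Ω → Fin m → ℝ, IsAdaptedInput P w u ∧
      (∀ k, u k =ᵐ[P] fun s => K *ᵥ (P[S.state w I u (k + d) | past w k]) s) ∧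
      S.StableUnder P w I u) (K₀ : Matrix (Fin m) (Fin n) ℝ) (x : Fin n → ℝ) :
    Tendsto (fun N => x ⬝ᵥ (S.stepForm K₀ ((S.lyap (delayedGain d K))^[N] 1 (Fin.last d))
      ((S.lyap (delayedGain d K))^[N] 1 0) *ᵥ x)) atTop (𝓝 0) := by
  -- `K₀` at time `0` and `K` afterwards: starting from a deterministic state, the second moment at
  -- time `N + 1` is the stated form exactly.
  set κ : ℕ → Matrix (Fin m) (Fin n) ℝ := fun k => if k = 0 then K₀ else K with hκ
  obtain ⟨u, hu, hfb, hst⟩ := hK (S.nominalData d κ x)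
  have hv0 : delayedInput (S.nominalData d κ x) u 0
      =ᵐ[P] fun s => K₀ *ᵥ S.known w (S.nominalData d κ x) u 0 s :=
    Eventually.of_forall fun s => by
      rw [delayedInput_nominalData (w := w) hd]
      simp [hκ]
  have hv : ∀ k, 1 ≤ k → delayedInput (S.nominalData d κ x) u k
      =ᵐ[P] fun s => K *ᵥ S.known w (S.nominalData d κ x) u k s := by
    intro k hk
    by_cases hkd : k < d
    · refine Eventually.of_forall fun s => ?_
      rw [delayedInput_nominalData (w := w) hkd]
      simp [hκ, show k ≠ 0 by omega]
    · obtain ⟨l, rfl⟩ : ∃ l, k = l + d := ⟨k - d, by omega⟩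
      filter_upwards [hfb l, known_ae_eq_condExp (S := S) (I := S.nominalData d κ x) hw hu hd l]
        with s h1 h2
      rw [h2, ← h1, delayedInput, dif_neg (by omega), Nat.add_sub_cancel]
  have h1 := hst.comp (tendsto_add_atTop_nat 1)
  refine h1.congr fun N => ?_
  have h2 := meanQuad_state (S := S) (I := S.nominalData d κ x) hw hu hd (N + 1) 1
  have h3 := energy_add_of_feedback (S := S) (I := S.nominalData d κ x) hw hu hd hv 1 N
  rw [energy_succ_of_feedback hw hu hd hv0, energy_zero, lyap_last, add_comm 1 N] at h3
  simp only [meanQuad, one_mulVec] at h2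
  exact h2.trans h3

omit hu in
-- Downward induction on the row. The last row decays by taking `K₀ = K`. Any other row is the next
-- one conjugated by `A` plus a noise term, and the latter is dominated by the decaying form with
-- `K₀ = 0`.
lemma tendsto_iterate (hd : 0 < d) {K : Matrix (Fin m) (Fin n) ℝ}
    (hK : ∀ I : InitialData n m d, ∃ u : ℕ → Ω → Fin m → ℝ, IsAdaptedInput P w u ∧
      (∀ k, u k =ᵐ[P] fun s => K *ᵥ (P[S.state w I u (k + d) | past w k]) s) ∧
      S.StableUnder P w I u) (j : Fin (d + 1)) (x : Fin n → ℝ) :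
    Tendsto (fun N => x ⬝ᵥ ((S.lyap (delayedGain d K))^[N] 1 j *ᵥ x)) atTop (𝓝 0) := by
  rw [← tendsto_add_atTop_iff_nat 1]
  have hnn : ∀ N, (0 : Fin (d + 1) → Matrix (Fin n) (Fin n) ℝ)
      ≤ (S.lyap (delayedGain d K))^[N] 1 := by
    intro N
    induction N with
    | zero => exact fun _ => PosSemidef.one.nonneg
    | succ N ih => rw [Function.iterate_succ_apply']; exact lyap_nonneg _ ih
  induction j using Fin.reverseInduction generalizing x with
  | last =>
    simpa only [Function.iterate_succ_apply', lyap_last] using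
      tendsto_stepForm_iterate hw hd hK K x
  | cast j ih =>
    have h1 := tendsto_stepForm_iterate hw hd hK 0 x
    have h2 := (tendsto_add_atTop_iff_nat (f := fun N => (S.A *ᵥ x) ⬝ᵥ
      ((S.lyap (delayedGain d K))^[N] 1 j.succ *ᵥ (S.A *ᵥ x))) 1).1 (ih (S.A *ᵥ x))
    simp only [Function.iterate_succ_apply', lyap_castSucc, add_mulVec, dotProduct_add,
      dotProduct_mulVec_conj]
    rw [← add_zero (0 : ℝ)]
    refine h2.add (squeeze_zero (fun N => ?_) (fun N => ?_) h1)
    · exact (nonneg_iff_forall.1 (smul_nonneg' (conj_nonneg (hnn N 0) S.Ab) (sq_nonneg S.σ))).2 x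
    · rw [stepForm_zero_gain, add_mulVec, dotProduct_add]
      exact le_add_of_nonneg_left ((nonneg_iff_forall.1 (conj_nonneg (hnn N _) S.A)).2 x)

omit hu in
-- The sum of `F^[k] 1` over `k < N` telescopes to the gap `1 - F^[N] 1`, which is at least one half
-- once the traces are below `1 / 2`; `N ≥ 1` makes the sum at least `1`.
lemma MeanSquareStabilizable.hasCertificate (hd : 0 < d) (h : S.MeanSquareStabilizable d P w) :
    S.HasCertificate d := by
  obtain ⟨K, hK⟩ := h
  set F := S.lyap (delayedGain d K) with hF
  have hnn : ∀ N, (0 : Fin (d + 1) → Matrix (Fin n) (Fin n) ℝ) ≤ F^[N] 1 := by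
    intro N
    induction N with
    | zero => exact fun _ => PosSemidef.one.nonneg
    | succ N ih => rw [Function.iterate_succ_apply']; exact lyap_nonneg _ ih
  have htr : ∀ j, Tendsto (fun N => (F^[N] 1 j).trace) atTop (𝓝 0) := by
    intro j
    have := tendsto_finsetSum Finset.univ fun (i : Fin n) _ =>
      tendsto_iterate hw hd hK j (Pi.single i 1)
    simpa [trace] using this
  have hev : ∀ᶠ N in atTop, ∀ j, (F^[N] 1 j).trace < 1 / 2 :=
    eventually_all.2 fun j => (htr j).eventually_lt_const (by norm_num)
  obtain ⟨N, hN, hN1⟩ := (hev.and (eventually_ge_atTop 1)).exists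
  refine ⟨K, ∑ k ∈ Finset.range N, F^[k] 1, fun j => ?_, fun j => ?_⟩
  · obtain ⟨N, rfl⟩ : ∃ l, N = l + 1 := ⟨N - 1, by omega⟩
    rw [Finset.sum_range_succ']
    refine (PosDef.one (n := Fin n) (R := ℝ)).of_le (le_add_of_nonneg_left ?_)
    rw [Finset.sum_apply]
    exact Finset.sum_nonneg fun k _ => hnn _ j
  · have htel : (∑ k ∈ Finset.range N, F^[k] 1) - F (∑ k ∈ Finset.range N, F^[k] 1)
        = 1 - F^[N] 1 := by
      rw [map_sum, ← Finset.sum_sub_distrib]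
      simp only [← Function.iterate_succ_apply']
      rw [Finset.sum_range_sub' (fun k => F^[k] (1 : Fin (d + 1) → Matrix (Fin n) (Fin n) ℝ)) N]
      rfl
    have := congrFun htel j
    simp only [Pi.sub_apply] at this
    rw [← hF, this]
    have h1 : F^[N] 1 j ≤ (1 / 2 : ℝ) • (1 : Matrix (Fin n) (Fin n) ℝ) :=
      (le_trace_smul_one (hnn N j)).trans (smul_mono_left PosSemidef.one.nonneg (hN j).le)
    refine ((PosDef.one (n := Fin n) (R := ℝ)).smul (by norm_num : (0 : ℝ) < 1 / 2)).of_le ?_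
    rw [← sub_nonneg] at h1 ⊢
    convert h1 using 1
    rw [Pi.one_apply]
    module

end DelaySystem

end Stabilizability

/-! ### Completion of squares along trajectories. -/

section Verification

open scoped MatrixOrder

lemma Matrix.IsSymm.dotProduct_add_mulVec_add {ι : Type*} [Fintype ι] {Z : Matrix ι ι ℝ}
    (hZ : Z.IsSymm) (a b : ι → ℝ) :
    (a + b) ⬝ᵥ (Z *ᵥ (a + b)) = a ⬝ᵥ (Z *ᵥ a) + 2 * (b ⬝ᵥ (Z *ᵥ a)) + b ⬝ᵥ (Z *ᵥ b) := by
  have : a ⬝ᵥ (Z *ᵥ b) = b ⬝ᵥ (Z *ᵥ a) := by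
    rw [dotProduct_mulVec, ← mulVec_transpose, hZ.eq, dotProduct_comm]
  simp only [mulVec_add, add_dotProduct, dotProduct_add, this]
  ring

variable {Ω : Type*} {n m d : ℕ} {S : DelaySystem n m} {w : ℕ → Ω → ℝ} {I : InitialData n m d}
  {u : ℕ → Ω → Fin m → ℝ} {Q : Matrix (Fin n) (Fin n) ℝ} {R : Matrix (Fin m) (Fin m) ℝ}

namespace DelaySystem

/-- Completion of the square in one step. -/
lemma stage_eq_add_square {Z X : Matrix (Fin n) (Fin n) ℝ} (hZ : Z.IsSymm) (hX : X.IsSymm)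
    (hR : R.IsSymm) (hΥ : (S.upsilon R Z X).PosDef) (x : Fin n → ℝ) (v : Fin m → ℝ) :
    (S.A *ᵥ x + S.B *ᵥ v) ⬝ᵥ (Z *ᵥ (S.A *ᵥ x + S.B *ᵥ v))
      + S.σ ^ 2 * ((S.Ab *ᵥ x + S.Bb *ᵥ v) ⬝ᵥ (X *ᵥ (S.Ab *ᵥ x + S.Bb *ᵥ v))) + v ⬝ᵥ (R *ᵥ v)
    = x ⬝ᵥ ((S.stepForm (S.optGain R Z X) Z X
        + (S.optGain R Z X)ᵀ * R * S.optGain R Z X) *ᵥ x)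
      + (v - S.optGain R Z X *ᵥ x) ⬝ᵥ (S.upsilon R Z X *ᵥ (v - S.optGain R Z X *ᵥ x)) := by
  set K := S.optGain R Z X with hK
  set y := v - K *ᵥ x with hy
  have hv : v = K *ᵥ x + y := by rw [hy]; abel
  have h0 : S.gainDefect R K Z X = 0 := by
    rw [gainDefect, S.upsilon_mul_optGain hΥ, neg_add_cancel]
  have h1 : S.Bᵀ * Z * (S.A + S.B * K) + S.σ ^ 2 • (S.Bbᵀ * X * (S.Ab + S.Bb * K)) + R * K = 0 := by
    rw [← h0]
    simp only [gainDefect, upsilon, crossTerm, Matrix.add_mul, Matrix.mul_add, Matrix.smul_mul,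
      Matrix.mul_assoc, smul_add]
    abel
  have e1 : S.A *ᵥ x + S.B *ᵥ v = (S.A + S.B * K) *ᵥ x + S.B *ᵥ y := by
    rw [hv, mulVec_add, mulVec_mulVec, add_mulVec]; abel
  have e2 : S.Ab *ᵥ x + S.Bb *ᵥ v = (S.Ab + S.Bb * K) *ᵥ x + S.Bb *ᵥ y := by
    rw [hv, mulVec_add, mulVec_mulVec, add_mulVec]; abel
  have h2 := congrArg (fun N => y ⬝ᵥ (N *ᵥ x)) h1
  beta_reduce at h2
  rw [add_mulVec, add_mulVec, zero_mulVec, dotProduct_zero, dotProduct_add, dotProduct_add,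
    smul_mulVec, dotProduct_smul, smul_eq_mul, dotProduct_mulVec_mul_mul,
    dotProduct_mulVec_mul_mul, ← mulVec_mulVec] at h2
  rw [e1, e2, hv]
  rw [hZ.dotProduct_add_mulVec_add, hX.dotProduct_add_mulVec_add, hR.dotProduct_add_mulVec_add,
    stepForm, upsilon]
  simp only [add_mulVec (_ + _ : Matrix (Fin n) (Fin n) ℝ), add_mulVec (_ * _ * _),
    add_mulVec (_ + _ : Matrix (Fin m) (Fin m) ℝ), dotProduct_add, smul_mulVec, dotProduct_smul,
    smul_eq_mul, dotProduct_mulVec_conj]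
  linear_combination 2 * h2

/-- Locality in time: the processes at time `k` depend on the inputs acting before time `k`. -/
lemma congr_input {u u' : ℕ → Ω → Fin m → ℝ} {s : Ω} (k : ℕ)
    (h : ∀ j, j + d < k → u j s = u' j s) :
    S.state w I u k s = S.state w I u' k s ∧ (∀ j, S.innov w I u k j s = S.innov w I u' k j s) ∧
      S.known w I u k s = S.known w I u' k s := by
  induction k with
  | zero => exact ⟨rfl, fun _ => rfl, rfl⟩
  | succ k ih =>
    obtain ⟨h1, h2, h3⟩ := ih fun j hj => h j (by omega)
    have hv : delayedInput I u k s = delayedInput I u' k s := by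
      by_cases hk : k < d
      · simp [delayedInput, hk]
      · simp only [delayedInput, dif_neg hk]
        exact h _ (by omega)
    refine ⟨by simp only [state, h1, hv], fun j => ?_, by simp only [known, h2, h3, hv]⟩
    cases j with
    | zero => simp only [innov, h1, hv]
    | succ j => simp only [innov, h2]

/-- The input `u k = K x̂ (k + d)` generated by a gain `K`. -/
noncomputable def feedbackInput (S : DelaySystem n m) (w : ℕ → Ω → ℝ) (I : InitialData n m d)
    (K : Matrix (Fin m) (Fin n) ℝ) : ℕ → Ω → Fin m → ℝ
  | k => fun s => K *ᵥ S.known w I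
      (fun j s => if j < k then S.feedbackInput w I K j s else 0) (k + d) s

/-- The recursion defining the input replaces inputs from time `k` on by zero to be well founded; by
locality in time this does not affect the known part at time `k + d`. -/
lemma feedbackInput_eq (K : Matrix (Fin m) (Fin n) ℝ) (k : ℕ) (s : Ω) :
    S.feedbackInput w I K k s = K *ᵥ S.known w I (S.feedbackInput w I K) (k + d) s := by
  rw [feedbackInput]
  beta_reduce
  congr 1
  refine (congr_input (k + d) fun j hj => ?_).2.2
  simp [show j < k by omega]

lemma known_eq_predictor (k : Fin d) (s : Ω) :
    S.known w I u k s = S.predictor I k := by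
  have key : ∀ k, k ≤ d → S.known w I u k s
      = S.A ^ k *ᵥ I.x₀ + ∑ j ∈ Finset.range k, (S.A ^ (k - 1 - j) * S.B) *ᵥ delayedInput I u j s := by
    intro k hk
    induction k with
    | zero => simp [known]
    | succ k ih =>
      rw [known, ih (by omega), innov_eq_zero (by omega), mulVec_zero, add_zero,
        Finset.sum_range_succ, mulVec_add, mulVec_mulVec, ← pow_succ', mulVec_sum, add_assoc]
      congr 2
      · refine Finset.sum_congr rfl fun j hj => ?_
        have hj' := Finset.mem_range.1 hj
        rw [mulVec_mulVec, ← Matrix.mul_assoc, ← pow_succ']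
        congr 3
        omega
      · simp
  rw [key k k.2.le, predictor]
  congr 1
  have h1 : ∀ j : Fin d, I.uPre j = delayedInput I u j s := fun j => by simp [delayedInput]
  simp only [h1]
  rw [← Nat.Iio_eq_range, ← Fin.map_valEmbedding_Iio, Finset.sum_map]
  rfl

variable [m₀ : MeasurableSpace Ω] {P : Measure Ω}

lemma meanQuad_mono {a : ℕ} {f : Ω → Fin a → ℝ} (hf : MemLp f 2 P)
    {X Y : Matrix (Fin a) (Fin a) ℝ} (h : X ≤ Y) : meanQuad P X f ≤ meanQuad P Y f :=
  integral_mono (integrable_dotProduct_mulVec hf hf X) (integrable_dotProduct_mulVec hf hf Y)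
    fun s => dotProduct_mulVec_mono h (f s)

variable [IsProbabilityMeasure P]

lemma isAdaptedInput_feedbackInput (hw : IsWhiteNoise P w S.σ) (hd : 0 < d)
    (K : Matrix (Fin m) (Fin n) ℝ) : IsAdaptedInput P w (S.feedbackInput w I K) := by
  intro k
  induction k using Nat.strong_induction_on with
  | _ k ih =>
    have hu : IsAdaptedInput P w
        (fun j s => if j < k then S.feedbackInput w I K j s else 0) := by
      intro j
      by_cases hj : j < k
      · simpa [hj] using ih j hj
      · simp only [hj, if_false]
        exact IsL2Measurable.const 0
    have h := (isL2Measurable_known (S := S) (I := I) hw hu hd (k + d)).mulVec K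
    rw [Nat.add_sub_cancel] at h
    have he : S.feedbackInput w I K k = fun s => K *ᵥ S.known w I
      (fun j s => if j < k then S.feedbackInput w I K j s else 0) (k + d) s := by
      rw [feedbackInput]
    rw [he]
    exact h

section Adapted

variable (hw : IsWhiteNoise P w S.σ) (hu : IsAdaptedInput P w u)
include hw hu

/-- Bellman identity: the innovation rows reproduce `C` by the fixed-point equation, and the row of
the known part leaves the square of the deviation from the optimal feedback. -/
lemma energy_succ_add_cost (hd : 0 < d) (hR : R.PosDef)
    {C : Fin (d + 1) → Matrix (Fin n) (Fin n) ℝ} (hC : 0 ≤ C) (h : S.riccati Q R C = C) (k : ℕ) :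
    meanQuad P Q (S.state w I u k) + meanQuad P R (delayedInput I u k)
        + S.energy P w I u C (k + 1)
      = S.energy P w I u C k + meanQuad P (S.upsilon R (C (Fin.last d)) (C 0))
        (fun s => delayedInput I u k s
          - S.optGain R (C (Fin.last d)) (C 0) *ᵥ S.known w I u k s) := by
  set K := S.optGain R (C (Fin.last d)) (C 0) with hK
  have hZ := hC (Fin.last d)
  have hX := hC 0
  have hk := (isL2Measurable_known (S := S) (I := I) hw hu hd k)
  have hv := (isL2Measurable_delayedInput hu I k)
  have hlast : C (Fin.last d) = S.stepForm K (C (Fin.last d)) (C 0) + Kᵀ * R * K + Q := by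
    have := congrFun h (Fin.last d)
    simp only [riccati, optPolicy, Pi.add_apply, lyap_last, runningWeight, delayedGain_last] at this
    conv_lhs => rw [← this]
    rw [← hK]
    abel
  have hstage : meanQuad P (C (Fin.last d))
        (fun s => S.A *ᵥ S.known w I u k s + S.B *ᵥ delayedInput I u k s)
      + S.σ ^ 2 * meanQuad P (C 0)
        (fun s => S.Ab *ᵥ S.known w I u k s + S.Bb *ᵥ delayedInput I u k s)
      + meanQuad P R (delayedInput I u k)
      = meanQuad P (S.stepForm K (C (Fin.last d)) (C 0) + Kᵀ * R * K) (S.known w I u k)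
        + meanQuad P (S.upsilon R (C (Fin.last d)) (C 0))
          (fun s => delayedInput I u k s - K *ᵥ S.known w I u k s) := by
    have f1 := ((hk.mulVec S.A).add (hv.mulVec S.B)).2
    have f2 := ((hk.mulVec S.Ab).add (hv.mulVec S.Bb)).2
    have f3 := (hv.sub (hk.mulVec K)).2
    have i1 := integrable_dotProduct_mulVec f1 f1 (C (Fin.last d))
    have i2 := (integrable_dotProduct_mulVec f2 f2 (C 0)).const_mul (S.σ ^ 2)
    have i3 := integrable_dotProduct_mulVec hv.2 hv.2 R
    have i4 := integrable_dotProduct_mulVec hk.2 hk.2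
      (S.stepForm K (C (Fin.last d)) (C 0) + Kᵀ * R * K)
    have i5 := integrable_dotProduct_mulVec f3 f3 (S.upsilon R (C (Fin.last d)) (C 0))
    simp only [meanQuad]
    have s1 := integral_add i1 i2
    have s2 := integral_add (i1.add i2) i3
    have s3 := integral_add i4 i5
    simp only [Pi.add_apply] at s2
    rw [← integral_const_mul, ← s1, ← s2, ← s3]
    refine integral_congr_ae (Eventually.of_forall fun s => ?_)
    exact stage_eq_add_square (isSymm_of_nonneg hZ) (isSymm_of_nonneg hX)
      (isSymm_of_nonneg hR.posSemidef.nonneg) (S.posDef_upsilon hR hZ hX) _ _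
  have hinn : ∀ j : Fin d, meanQuad P (C j.castSucc) (S.innov w I u k j)
      = meanQuad P (S.Aᵀ * C j.succ * S.A + S.σ ^ 2 • (S.Abᵀ * C 0 * S.Ab)) (S.innov w I u k j)
        + meanQuad P Q (S.innov w I u k j) := fun j => by
    rw [fixedPoint_castSucc h j, meanQuad_add_left (isL2Measurable_innov hw hu k j).2]
  have hkn : meanQuad P (C (Fin.last d)) (S.known w I u k)
      = meanQuad P (S.stepForm K (C (Fin.last d)) (C 0) + Kᵀ * R * K) (S.known w I u k)
        + meanQuad P Q (S.known w I u k) := by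
    conv_lhs => rw [hlast]
    exact meanQuad_add_left hk.2 _ _
  rw [energy_succ hw hu hd, meanQuad_state hw hu hd, energy, energy, hkn]
  simp only [hinn, Finset.sum_add_distrib]
  linarith

lemma sum_cost_add_energy (hd : 0 < d) (hR : R.PosDef)
    {C : Fin (d + 1) → Matrix (Fin n) (Fin n) ℝ} (hC : 0 ≤ C) (h : S.riccati Q R C = C) (N : ℕ) :
    ∑ k ∈ Finset.range N, meanQuad P Q (S.state w I u k)
        + ∑ k ∈ Finset.range N, meanQuad P R (delayedInput I u k) + S.energy P w I u C N
      = S.energy P w I u C 0 + ∑ k ∈ Finset.range N,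
        meanQuad P (S.upsilon R (C (Fin.last d)) (C 0)) (fun s => delayedInput I u k s
          - S.optGain R (C (Fin.last d)) (C 0) *ᵥ S.known w I u k s) := by
  induction N with
  | zero => simp
  | succ N ih =>
    have := energy_succ_add_cost (S := S) (I := I) (Q := Q) hw hu hd hR hC h N
    simp only [Finset.sum_range_succ]
    linarith

/-- The cost over a finite horizon, split into the dual cost, the loss by deviating from the
optimal feedback and the remaining energy. -/
lemma sum_cost_eq (hd : 0 < d) (hR : R.PosDef)
    {C : Fin (d + 1) → Matrix (Fin n) (Fin n) ℝ} (hC : 0 ≤ C) (h : S.riccati Q R C = C) (N : ℕ) :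
    ∑ k ∈ Finset.range (N + d), meanQuad P Q (S.state w I u k)
        + ∑ k ∈ Finset.range N, meanQuad P R (u k) + S.energy P w I u C (N + d)
      = S.quadExpr I R (S.toZXL Q R C) + ∑ k ∈ Finset.range N,
        meanQuad P (S.upsilon R (C (Fin.last d)) (C 0)) (fun s => u k s
          - S.optGain R (C (Fin.last d)) (C 0) *ᵥ S.known w I u (k + d) s) := by
  have hT := sum_cost_add_energy (S := S) (I := I) (Q := Q) hw hu hd hR hC h (N + d)
  set K := S.optGain R (C (Fin.last d)) (C 0) with hK
  set Υ := S.upsilon R (C (Fin.last d)) (C 0) with hΥd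
  set M := S.crossTerm (C (Fin.last d)) (C 0) with hM
  have hΥ : Υ.PosDef := S.posDef_upsilon hR (hC _) (hC _)
  have hΥs := isSymm_of_nonneg hΥ.posSemidef.nonneg
  have hlate : ∀ k, delayedInput I u (d + k) = u k := fun k => by
    funext s
    simp [delayedInput]
  have hearly : ∀ k : Fin d, delayedInput I u k = fun _ => I.uPre k := fun k => by
    funext s
    simp [delayedInput]
  have hL : (S.toZXL Q R C).L = Mᵀ * Υ⁻¹ * M := by
    have h1 := congrFun h (Fin.last d)
    rw [riccati_last hR hC, sub_eq_iff_eq_add] at h1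
    simp only [toZXL] at h1 ⊢
    rw [sub_eq_iff_eq_add', h1]
  -- Before time `d` the inputs are prescribed and the known part is the predictor, so these squares
  -- are deterministic and expand into the bracket of the dual cost. The input cost of these times,
  -- not part of the objective, accounts for `-∑ uᵀ R u`.
  have hsq : ∀ k : Fin d, meanQuad P Υ (fun s => delayedInput I u k s - K *ᵥ S.known w I u k s)
      = 2 * (I.uPre k ⬝ᵥ (M *ᵥ S.predictor I k))
        + S.predictor I k ⬝ᵥ ((S.toZXL Q R C).L *ᵥ S.predictor I k)
        + I.uPre k ⬝ᵥ (Υ *ᵥ I.uPre k) := by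
    intro k
    have e1 : Kᵀ * Υ * K = (S.toZXL Q R C).L := by
      rw [hL, S.optGain_transpose_mul hΥ, hK, optGain, Matrix.neg_mul, Matrix.mul_neg, neg_neg,
        ← Matrix.mul_assoc]
    have e2 : (K *ᵥ S.predictor I k) ⬝ᵥ (Υ *ᵥ I.uPre k)
        = -(I.uPre k ⬝ᵥ (M *ᵥ S.predictor I k)) := by
      rw [dotProduct_comm, dotProduct_comm (Υ *ᵥ _), dotProduct_mulVec, ← mulVec_transpose, hΥs.eq,
        dotProduct_comm, mulVec_mulVec, S.upsilon_mul_optGain hΥ, neg_mulVec, dotProduct_neg]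
    simp only [hearly, known_eq_predictor, meanQuad, integral_const, probReal_univ, one_smul]
    rw [sub_eq_add_neg, hΥs.dotProduct_add_mulVec_add, neg_dotProduct, mulVec_neg, neg_dotProduct,
      dotProduct_neg, e2, ← e1, dotProduct_mulVec_conj]
    ring
  have hR0 : ∀ k : Fin d, meanQuad P R (delayedInput I u k) = I.uPre k ⬝ᵥ (R *ᵥ I.uPre k) := by
    intro k
    simp only [hearly, meanQuad, integral_const, probReal_univ, one_smul]
  rw [add_comm N d, Finset.sum_range_add _ d N, Finset.sum_range_add _ d N,
    Finset.sum_range_add _ d N, energy_zero] at hT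
  rw [add_comm N d, Finset.sum_range_add _ d N]
  simp only [hlate] at hT
  rw [Finset.sum_range (fun k => meanQuad P R (delayedInput I u k)), Finset.sum_range
    (fun k => meanQuad P Υ (fun s => delayedInput I u k s - K *ᵥ S.known w I u k s))] at hT
  simp only [hR0, hsq] at hT
  have hq : S.quadExpr I R (S.toZXL Q R C) = I.x₀ ⬝ᵥ (C (Fin.last d) *ᵥ I.x₀)
      - ∑ k, I.uPre k ⬝ᵥ (R *ᵥ I.uPre k)
      + ∑ k, (2 * (I.uPre k ⬝ᵥ (M *ᵥ S.predictor I k))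
        + S.predictor I k ⬝ᵥ ((S.toZXL Q R C).L *ᵥ S.predictor I k)
        + I.uPre k ⬝ᵥ (Υ *ᵥ I.uPre k)) := rfl
  rw [hq]
  simp only [add_comm _ d]
  linarith

/-- By orthogonality the energy with unit weights is `E (xᵀ x)`, so stability of the state makes
every terminal energy vanish. -/
lemma energy_le (hd : 0 < d) {C : Fin (d + 1) → Matrix (Fin n) (Fin n) ℝ} (hC : 0 ≤ C) :
    ∃ c : ℝ, ∀ k, 0 ≤ S.energy P w I u C k ∧ S.energy P w I u C k
      ≤ c * ∫ s, S.state w I u k s ⬝ᵥ S.state w I u k s ∂P := by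
  obtain ⟨c, hc1, hc⟩ := exists_le_smul_tuple (fun j => isSymm_of_nonneg (hC j))
    (P := fun _ => (1 : Matrix (Fin n) (Fin n) ℝ)) fun _ => PosDef.one
  refine ⟨c, fun k => ⟨add_nonneg (meanQuad_nonneg (hC _).posSemidef)
    (Finset.sum_nonneg fun j _ => meanQuad_nonneg (hC _).posSemidef), ?_⟩⟩
  have h1 := meanQuad_state (S := S) (I := I) hw hu hd k 1
  have h2 : meanQuad P 1 (S.state w I u k)
      = ∫ s, S.state w I u k s ⬝ᵥ S.state w I u k s ∂P := by simp [meanQuad]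
  rw [← h2, h1, energy, energy, mul_add, Finset.mul_sum]
  simp only [← meanQuad_smul]
  exact add_le_add (meanQuad_mono (isL2Measurable_known hw hu hd k).2 (hc _))
    (Finset.sum_le_sum fun j _ => meanQuad_mono (isL2Measurable_innov hw hu k j).2 (hc _))

lemma cost_eq_tsum (I : InitialData n m d) (hQ : Q.PosSemidef) (hR : R.PosSemidef) :
    S.cost P w I Q R u = ∑' k, ENNReal.ofReal (meanQuad P Q (S.state w I u k))
      + ∑' k, ENNReal.ofReal (meanQuad P R (u k)) := by
  have key : ∀ {a : ℕ} {X : Matrix (Fin a) (Fin a) ℝ} {f : Ω → Fin a → ℝ}, X.PosSemidef →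
      MemLp f 2 P → AEMeasurable (fun s => ENNReal.ofReal (f s ⬝ᵥ (X *ᵥ f s))) P ∧
        ∫⁻ s, ENNReal.ofReal (f s ⬝ᵥ (X *ᵥ f s)) ∂P = ENNReal.ofReal (meanQuad P X f) := by
    intro a X f hX hf
    have hi := integrable_dotProduct_mulVec hf hf X
    refine ⟨hi.aestronglyMeasurable.aemeasurable.ennreal_ofReal, ?_⟩
    rw [meanQuad, ofReal_integral_eq_lintegral_ofReal hi (Eventually.of_forall fun s => by
      simpa using hX.dotProduct_mulVec_nonneg (f s))]
  have hx := fun k => key hQ (isL2Measurable_state (S := S) (I := I) hw hu k).2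
  have hv := fun k => key hR (hu k).2
  rw [cost, lintegral_add_left' (AEMeasurable.tsum fun k => (hx k).1),
    lintegral_tsum fun k => (hx k).1, lintegral_tsum fun k => (hv k).1]
  simp only [(hx _).2, (hv _).2]

end Adapted

end DelaySystem

end Verification

/-! ### The dual function as an attained minimum. -/

section DualFunction

open scoped MatrixOrder

/-- The delicate case is an infinite cost with multiplier `0`, where both products are `0` by
convention. -/
lemma EReal.coe_mul_coe_ennreal_sub {r : ℝ} (hr : 0 ≤ r) (a : ENNReal) (c : ℝ) :
    (r : EReal) * ((a : EReal) - (c : EReal))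
      = ((ENNReal.ofReal r * a : ENNReal) : EReal) + ((-(r * c) : ℝ) : EReal) := by
  induction a with
  | top =>
    rcases hr.eq_or_lt with rfl | hr
    · simp
    · rw [ENNReal.mul_top (by simpa using hr), EReal.coe_ennreal_top, EReal.top_sub_coe,
        EReal.coe_mul_top_of_pos hr, EReal.top_add_coe]
  | coe a =>
    rw [ENNReal.ofReal, ← ENNReal.coe_mul, EReal.coe_nnreal_eq_coe_real,
      EReal.coe_nnreal_eq_coe_real, NNReal.coe_mul, Real.coe_toNNReal r hr]
    norm_cast
    ring

lemma meanQuad_sum {Ω ι : Type*} [MeasurableSpace Ω] {P : Measure Ω} {a : ℕ} {f : Ω → Fin a → ℝ}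
    (hf : MemLp f 2 P) (s : Finset ι) (X : ι → Matrix (Fin a) (Fin a) ℝ) :
    meanQuad P (∑ i ∈ s, X i) f = ∑ i ∈ s, meanQuad P (X i) f := by
  classical
  induction s using Finset.induction_on with
  | empty => simp [meanQuad]
  | insert i s hi ih => rw [Finset.sum_insert hi, Finset.sum_insert hi, meanQuad_add_left hf, ih]

namespace DelaySystem

variable {Ω : Type*} {n m p d : ℕ} {S : DelaySystem n m} {w : ℕ → Ω → ℝ} {I : InitialData n m d}
  {u : ℕ → Ω → Fin m → ℝ} {Q : Matrix (Fin n) (Fin n) ℝ} {R : Matrix (Fin m) (Fin m) ℝ}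
  {W : QuadData n m p} {lam : Fin p → ℝ}
  [m₀ : MeasurableSpace Ω] {P : Measure Ω} [IsProbabilityMeasure P] (hw : IsWhiteNoise P w S.σ)
include hw

lemma cost_Qlam_Rlam (hW : W.Positive) (hlam : 0 ≤ lam) (hu : IsAdaptedInput P w u) :
    S.cost P w I (W.Qlam lam) (W.Rlam lam) u
      = S.cost P w I W.Q₀ W.R₀ u
        + ∑ i, ENNReal.ofReal (lam i) * S.cost P w I (W.Q i) (W.R i) u := by
  have key : ∀ {a : ℕ} {X₀ : Matrix (Fin a) (Fin a) ℝ} {X : Fin p → Matrix (Fin a) (Fin a) ℝ}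
      {f : ℕ → Ω → Fin a → ℝ}, X₀.PosDef → (∀ i, (X i).PosDef) → (∀ k, MemLp (f k) 2 P) →
      ∑' k, ENNReal.ofReal (meanQuad P (X₀ + ∑ i, lam i • X i) (f k))
        = ∑' k, ENNReal.ofReal (meanQuad P X₀ (f k))
          + ∑ i, ENNReal.ofReal (lam i) * ∑' k, ENNReal.ofReal (meanQuad P (X i) (f k)) := by
    intro a X₀ X f hX₀ hX hf
    simp_rw [← ENNReal.tsum_mul_left]
    rw [← Summable.tsum_finsetSum fun _ _ => ENNReal.summable, ← ENNReal.tsum_add]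
    refine tsum_congr fun k => ?_
    have hnn : ∀ i, 0 ≤ meanQuad P (X i) (f k) := fun i => meanQuad_nonneg (hX i).posSemidef
    rw [meanQuad_add_left (hf k), meanQuad_sum (hf k), ENNReal.ofReal_add
      (meanQuad_nonneg hX₀.posSemidef) (Finset.sum_nonneg fun i _ => by
        rw [meanQuad_smul]; exact mul_nonneg (hlam i) (hnn i)),
      ENNReal.ofReal_sum_of_nonneg fun i _ => by
        rw [meanQuad_smul]; exact mul_nonneg (hlam i) (hnn i)]
    simp only [meanQuad_smul, ENNReal.ofReal_mul (hlam _)]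
  rw [cost_eq_tsum hw hu I (hW.posDef_Qlam hlam).posSemidef (hW.posDef_Rlam hlam).posSemidef,
    cost_eq_tsum hw hu I hW.Q₀.posSemidef hW.R₀.posSemidef, QuadData.Qlam, QuadData.Rlam,
    key hW.Q₀ hW.Q fun k => (isL2Measurable_state (S := S) (I := I) hw hu k).2,
    key hW.R₀ hW.R fun k => (hu k).2]
  simp only [fun i => cost_eq_tsum (S := S) hw hu I (hW.Q i).posSemidef (hW.R i).posSemidef,
    mul_add, Finset.sum_add_distrib]
  exact add_add_add_comm _ _ _ _

lemma lagrangian_eq (hW : W.Positive) (hlam : 0 ≤ lam) (hu : IsAdaptedInput P w u) :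
    S.lagrangian W P w I lam u = (S.cost P w I (W.Qlam lam) (W.Rlam lam) u : EReal)
      + ((-∑ i, lam i * W.c i : ℝ) : EReal) := by
  have hcoe : ∀ (s : Finset (Fin p)) (f : Fin p → ENNReal),
      ((∑ i ∈ s, f i : ENNReal) : EReal) = ∑ i ∈ s, (f i : EReal) := by
    intro s f
    induction s using Finset.induction_on with
    | empty => simp
    | insert i s hi ih => rw [Finset.sum_insert hi, Finset.sum_insert hi, EReal.coe_ennreal_add, ih]
  have hcoe' : ∀ (s : Finset (Fin p)) (f : Fin p → ℝ),
      ((∑ i ∈ s, f i : ℝ) : EReal) = ∑ i ∈ s, (f i : EReal) := by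
    intro s f
    induction s using Finset.induction_on with
    | empty => simp
    | insert i s hi ih => rw [Finset.sum_insert hi, Finset.sum_insert hi, EReal.coe_add, ih]
  rw [lagrangian, cost_Qlam_Rlam hw hW hlam hu, EReal.coe_ennreal_add, hcoe,
    ← Finset.sum_neg_distrib, hcoe', add_assoc, ← Finset.sum_add_distrib]
  congr 1
  exact Finset.sum_congr rfl fun i _ => EReal.coe_mul_coe_ennreal_sub (hlam i) _ _

variable {C : Fin (d + 1) → Matrix (Fin n) (Fin n) ℝ}

/-- Drop the nonnegative squares in the finite-horizon identity and let the horizon grow: the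
terminal energy tends to zero for admissible controls. -/
lemma quadExpr_le_cost (hd : 0 < d) (hQ : Q.PosDef) (hR : R.PosDef) (hC : 0 ≤ C)
    (h : S.riccati Q R C = C) (hu : u ∈ S.Admissible P w I) :
    ENNReal.ofReal (S.quadExpr I R (S.toZXL Q R C)) ≤ S.cost P w I Q R u := by
  obtain ⟨hu, hst⟩ := hu
  have hlim : Tendsto (fun N => S.energy P w I u C (N + d)) atTop (𝓝 0) := by
    obtain ⟨c, hc⟩ := energy_le (S := S) (I := I) hw hu hd hC
    refine (tendsto_add_atTop_iff_nat d).2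
      (squeeze_zero (fun k => (hc k).1) (fun k => (hc k).2) ?_)
    simpa using Tendsto.const_mul c hst
  have hlim' := ENNReal.tendsto_ofReal
    ((tendsto_const_nhds (x := S.quadExpr I R (S.toZXL Q R C))).sub hlim)
  rw [sub_zero] at hlim'
  refine le_of_tendsto' hlim' fun N => ?_
  have hN := sum_cost_eq (S := S) (I := I) hw hu hd hR hC h N
  have hsq : 0 ≤ ∑ k ∈ Finset.range N, meanQuad P (S.upsilon R (C (Fin.last d)) (C 0))
      (fun s => u k s - S.optGain R (C (Fin.last d)) (C 0) *ᵥ S.known w I u (k + d) s) :=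
    Finset.sum_nonneg fun k _ =>
      meanQuad_nonneg (S.posDef_upsilon hR (hC _) (hC _)).posSemidef
  have hx : ∀ k ∈ Finset.range (N + d), 0 ≤ meanQuad P Q (S.state w I u k) :=
    fun k _ => meanQuad_nonneg hQ.posSemidef
  have hv : ∀ k ∈ Finset.range N, 0 ≤ meanQuad P R (u k) :=
    fun k _ => meanQuad_nonneg hR.posSemidef
  rw [cost_eq_tsum hw hu I hQ.posSemidef hR.posSemidef]
  calc ENNReal.ofReal (S.quadExpr I R (S.toZXL Q R C) - S.energy P w I u C (N + d))
      ≤ ENNReal.ofReal (∑ k ∈ Finset.range (N + d), meanQuad P Q (S.state w I u k)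
        + ∑ k ∈ Finset.range N, meanQuad P R (u k)) := ENNReal.ofReal_le_ofReal (by linarith)
    _ = ∑ k ∈ Finset.range (N + d), ENNReal.ofReal (meanQuad P Q (S.state w I u k))
        + ∑ k ∈ Finset.range N, ENNReal.ofReal (meanQuad P R (u k)) := by
      rw [ENNReal.ofReal_add (Finset.sum_nonneg hx) (Finset.sum_nonneg hv),
        ENNReal.ofReal_sum_of_nonneg hx, ENNReal.ofReal_sum_of_nonneg hv]
    _ ≤ _ := add_le_add (ENNReal.sum_le_tsum _) (ENNReal.sum_le_tsum _)

/-- The feedback with the optimal gain is admissible and attains the lower bound. -/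
lemma exists_admissible_cost_le (hd : 0 < d) (hQ : Q.PosDef) (hR : R.PosDef) (hC : 0 ≤ C)
    (h : S.riccati Q R C = C) : 0 ≤ S.quadExpr I R (S.toZXL Q R C) ∧
    ∃ u ∈ S.Admissible P w I,
      S.cost P w I Q R u ≤ ENNReal.ofReal (S.quadExpr I R (S.toZXL Q R C)) := by
  set E := S.quadExpr I R (S.toZXL Q R C) with hE
  set u := S.feedbackInput w I (S.optGain R (C (Fin.last d)) (C 0)) with hudef
  have hu : IsAdaptedInput P w u := isAdaptedInput_feedbackInput hw hd _
  obtain ⟨c', hc'⟩ := energy_le (S := S) (I := I) hw hu hd hC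
  have hx : ∀ k, 0 ≤ meanQuad P Q (S.state w I u k) := fun k => meanQuad_nonneg hQ.posSemidef
  have hv : ∀ k, 0 ≤ meanQuad P R (u k) := fun k => meanQuad_nonneg hR.posSemidef
  have hle : ∀ N, ∑ k ∈ Finset.range (N + d), meanQuad P Q (S.state w I u k)
      + ∑ k ∈ Finset.range N, meanQuad P R (u k) ≤ E := by
    intro N
    have hN := sum_cost_eq (S := S) (I := I) hw hu hd hR hC h N
    have hsq : ∀ k, meanQuad P (S.upsilon R (C (Fin.last d)) (C 0))
        (fun s => u k s - S.optGain R (C (Fin.last d)) (C 0) *ᵥ S.known w I u (k + d) s) = 0 := by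
      intro k
      have : ∀ s, u k s - S.optGain R (C (Fin.last d)) (C 0) *ᵥ S.known w I u (k + d) s = 0 :=
        fun s => sub_eq_zero.2 (feedbackInput_eq _ k s)
      simp [meanQuad, this]
    simp only [hsq, Finset.sum_const_zero, add_zero] at hN
    linarith [(hc' (N + d)).1]
  have hcost : S.cost P w I Q R u ≤ ENNReal.ofReal E := by
    rw [cost_eq_tsum hw hu I hQ.posSemidef hR.posSemidef]
    refine le_of_tendsto' (((tendsto_add_atTop_iff_nat d).2 (ENNReal.tendsto_nat_tsum _)).add
      (ENNReal.tendsto_nat_tsum _)) fun N => ?_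
    rw [← ENNReal.ofReal_sum_of_nonneg fun k _ => hx k,
      ← ENNReal.ofReal_sum_of_nonneg fun k _ => hv k,
      ← ENNReal.ofReal_add (Finset.sum_nonneg fun k _ => hx k) (Finset.sum_nonneg fun k _ => hv k)]
    exact ENNReal.ofReal_le_ofReal (hle N)
  refine ⟨(add_nonneg (Finset.sum_nonneg fun k _ => hx k)
    (Finset.sum_nonneg fun k _ => hv k)).trans (hle 0), u, ⟨hu, ?_⟩, hcost⟩
  -- Stability follows from finite cost: the stage costs are summable, hence tend to zero, and `Q >
  -- 0` dominates a multiple of the identity.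
  have hfin : ∑' k, ENNReal.ofReal (meanQuad P Q (S.state w I u k)) ≠ ⊤ := by
    rw [cost_eq_tsum hw hu I hQ.posSemidef hR.posSemidef] at hcost
    exact ne_top_of_le_ne_top ENNReal.ofReal_ne_top (le_self_add.trans hcost)
  have hlim := (ENNReal.tendsto_toReal ENNReal.zero_ne_top).comp
    (ENNReal.tendsto_atTop_zero_of_tsum_ne_top hfin)
  simp only [Function.comp_def, ENNReal.toReal_ofReal (hx _), ENNReal.toReal_zero] at hlim
  obtain ⟨c, -, hc⟩ := (isSymm_one (n := Fin n) (α := ℝ)).exists_le_smul hQ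
  have hone : ∀ k, meanQuad P 1 (S.state w I u k)
      = ∫ s, S.state w I u k s ⬝ᵥ S.state w I u k s ∂P := fun k => by simp [meanQuad]
  unfold StableUnder
  simp only [← hone]
  refine squeeze_zero (fun k => meanQuad_nonneg PosSemidef.one) (fun k => ?_)
    (by simpa using hlim.const_mul c)
  rw [← meanQuad_smul]
  exact meanQuad_mono (isL2Measurable_state hw hu k).2 hc

/-- The dual function is attained and equals the dual cost. -/
lemma dualFunction_eq_dualCost (hd : 0 < d) (hW : W.Positive) (hlam : 0 ≤ lam) (hC : 0 ≤ C)
    (h : S.riccati (W.Qlam lam) (W.Rlam lam) C = C) :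
    (∃ u ∈ S.Admissible P w I, S.lagrangian W P w I lam u = S.dualFunction W P w I lam) ∧
      S.dualFunction W P w I lam
        = (S.dualCost W I lam (S.toZXL (W.Qlam lam) (W.Rlam lam) C) : EReal) := by
  have hQ := hW.posDef_Qlam hlam
  have hR := hW.posDef_Rlam hlam
  obtain ⟨hE, u, hu, hcost⟩ := exists_admissible_cost_le (S := S) (I := I) hw hd hQ hR hC h
  have hval : ∀ a : ENNReal, a = ENNReal.ofReal
      (S.quadExpr I (W.Rlam lam) (S.toZXL (W.Qlam lam) (W.Rlam lam) C)) →
      (a : EReal) + ((-∑ i, lam i * W.c i : ℝ) : EReal)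
        = (S.dualCost W I lam (S.toZXL (W.Qlam lam) (W.Rlam lam) C) : EReal) := by
    rintro _ rfl
    rw [EReal.coe_ennreal_ofReal, max_eq_left hE, ← EReal.coe_add, ← sub_eq_add_neg, dualCost]
  have hopt : S.lagrangian W P w I lam u
      = (S.dualCost W I lam (S.toZXL (W.Qlam lam) (W.Rlam lam) C) : EReal) := by
    rw [lagrangian_eq hw hW hlam hu.1]
    exact hval _ (hcost.antisymm (quadExpr_le_cost hw hd hQ hR hC h hu))
  have hdual : S.dualFunction W P w I lam
      = (S.dualCost W I lam (S.toZXL (W.Qlam lam) (W.Rlam lam) C) : EReal) := by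
    refine le_antisymm (hopt ▸ iInf₂_le u hu) (le_iInf₂ fun v hv => ?_)
    rw [lagrangian_eq hw hW hlam hv.1, ← hval _ rfl]
    gcongr
    exact EReal.coe_ennreal_le_coe_ennreal_iff.2 (quadExpr_le_cost hw hd hQ hR hC h hv)
  exact ⟨⟨u, hu, hopt.trans hdual.symm⟩, hdual⟩

end DelaySystem

end DualFunction

/-! ### Projection onto the orthant, and the main theorem. -/

/-- The Euclidean projection onto the orthant is the coordinatewise positive part. -/
lemma isProjectedGradientStep_iff {p : ℕ} {f : (Fin p → ℝ) → ℝ} {g lam lam' : Fin p → ℝ} {α : ℝ}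
    (hlam : 0 ≤ lam) (hg : HasOrthantGradient f g lam) :
    IsProjectedGradientStep f α lam lam' ↔ ∀ i, lam' i = max 0 (lam i + α * g i) := by
  -- The obtuse-angle inequality for projection onto a half-line; its extra square makes the
  -- minimizer unique.
  have hterm : ∀ a b : ℝ, 0 ≤ b → (a - max 0 a) ^ 2 + (max 0 a - b) ^ 2 ≤ (a - b) ^ 2 := by
    intro a b hb
    rcases le_total a 0 with ha | ha
    · rw [max_eq_left ha]; nlinarith [mul_nonneg hb (neg_nonneg.2 ha)]
    · rw [max_eq_right ha]; simp
  constructor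
  · rintro ⟨g', hg', h0, hmin⟩ i
    -- The step quantifies over some gradient, so uniqueness on the orthant is needed to identify
    -- it.
    obtain rfl := hg'.unique hg hlam
    have h1 := hmin (fun i => max 0 (lam i + α * g' i)) fun i => le_max_left _ _
    have h2 := Finset.sum_le_sum fun i (_ : i ∈ Finset.univ) =>
      hterm (lam i + α * g' i) (lam' i) (h0 i)
    rw [Finset.sum_add_distrib] at h2
    have h3 := (Finset.sum_eq_zero_iff_of_nonneg fun i _ =>
      sq_nonneg (max 0 (lam i + α * g' i) - lam' i)).1
      (le_antisymm (by linarith) (Finset.sum_nonneg fun i _ => sq_nonneg _)) i (Finset.mem_univ i)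
    exact (sub_eq_zero.1 (pow_eq_zero_iff two_ne_zero |>.1 h3)).symm
  · intro h
    refine ⟨g, hg, fun i => by rw [h i]; exact le_max_left _ _, fun μ hμ => ?_⟩
    refine Finset.sum_le_sum fun i _ => ?_
    rw [h i]
    linarith [hterm (lam i + α * g i) (μ i) (hμ i),
      sq_nonneg (max 0 (lam i + α * g i) - μ i)]

theorem theorem6 {n m p d : ℕ} (hd : 0 < d)
    {Ω : Type*} [MeasurableSpace Ω] (P : Measure Ω) [IsProbabilityMeasure P]
    (S : DelaySystem n m) (W : QuadData n m p) (hW : W.Positive) (I : InitialData n m d)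
    (w : ℕ → Ω → ℝ) (hw : IsWhiteNoise P w S.σ) (hstab : S.MeanSquareStabilizable d P w) :
    -- for every multiplier the Riccati-ZXL equation has exactly one solution with `Z > 0`
    (∀ lam : Fin p → ℝ, 0 ≤ lam →
      ∃! T : ZXL n m, S.IsZXLSolution d (W.Qlam lam) (W.Rlam lam) T) ∧
    -- `T lam` denotes this solution
    ∀ T : (Fin p → ℝ) → ZXL n m,
      (∀ lam : Fin p → ℝ, 0 ≤ lam →
        S.IsZXLSolution d (W.Qlam lam) (W.Rlam lam) (T lam)) →
      ∀ lam : Fin p → ℝ, 0 ≤ lam →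
        (T lam).Υ.PosDef ∧
        -- the dual function is an attained minimum, equal to the dual cost
        (∃ u ∈ S.Admissible P w I,
          S.lagrangian W P w I lam u = S.dualFunction W P w I lam) ∧
        S.dualFunction W P w I lam = (S.dualCost W I lam (T lam) : EReal) ∧
        -- the linear equations are uniquely solvable, their solutions are the partial derivatives,
        -- and they give the gradient of the dual cost
        (∃ D : Fin p → ZXL n m,
          (∀ i, S.IsGradientSolution d (W.Q i) (W.R i) (T lam) (D i) ∧
            (∀ D', S.IsGradientSolution d (W.Q i) (W.R i) (T lam) D' → D' = D i) ∧
            HasMatrixPartial (fun μ => (T μ).Z) (D i).Z i lam ∧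
            HasMatrixPartial (fun μ => (T μ).X) (D i).X i lam ∧
            HasMatrixPartial (fun μ => (T μ).L) (D i).L i lam ∧
            HasMatrixPartial (fun μ => (T μ).Υ) (D i).Υ i lam ∧
            HasMatrixPartial (fun μ => (T μ).M) (D i).M i lam) ∧
          HasOrthantGradient (fun μ => S.dualCost W I μ (T μ))
            (fun i => S.dualGrad W I i (D i)) lam) ∧
        -- the projected gradient-ascent update for the dual problem
        ∀ α : ℝ, 0 < α → ∀ lam' : Fin p → ℝ,
          (IsProjectedGradientStep (fun μ => S.dualCost W I μ (T μ)) α lam lam' ↔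
            S.IsRiccatiStep W I (T lam) α lam lam') := by
  have hc := hstab.hasCertificate hw hd
  refine ⟨fun lam hlam => DelaySystem.existsUnique_isZXLSolution hc (hW.posDef_Qlam hlam)
    (hW.posDef_Rlam hlam), fun T hT lam hlam => ?_⟩
  -- The solutions are passed to tuples for all multipliers at once; no regularity of `T` is
  -- assumed, and differentiability comes from the Riccati equation alone.
  set C : (Fin p → ℝ) → Fin (d + 1) → Matrix (Fin n) (Fin n) ℝ :=
    fun μ => S.weights d (T μ).Z (T μ).L with hCdef
  have hC : S.IsRiccatiFamily W C := fun μ hμ =>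
    ⟨(hT μ hμ).weights_nonneg hc (hW.posDef_Qlam hμ),
      (hT μ hμ).riccati_weights hc (hW.posDef_Qlam hμ) (hW.posDef_Rlam hμ)⟩
  have hTC : ∀ μ, 0 ≤ μ → T μ = S.toZXL (W.Qlam μ) (W.Rlam μ) (C μ) := fun μ hμ =>
    (hT μ hμ).eq_toZXL
  obtain ⟨hC0, hCr⟩ := hC lam hlam
  have hQ := hW.posDef_Qlam hlam
  have hR := hW.posDef_Rlam hlam
  choose D' hD0 hD' using fun i => DelaySystem.exists_isLinearized hQ hR hC0 hCr
    (hW.Q i).posSemidef.nonneg (hW.R i).posSemidef.nonneg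
  have hs : ∀ i j, (D' i j).IsSymm := fun i j => isSymm_of_nonneg (hD0 i j)
  obtain ⟨hZ, hX, hL, hΥ, hM⟩ := DelaySystem.hasMatrixGradient_toZXL hlam hTC
    fun j => hC.hasMatrixGradient hW hlam hs hD' j
  have hsol : ∀ i, S.IsGradientSolution d (W.Q i) (W.R i) (T lam)
      (S.toZXL (W.Q i) (W.R i) (D' i)) := fun i => by
    rw [hTC lam hlam]
    exact DelaySystem.isGradientSolution_toZXL hR hC0 (hs i) (hD' i)
  have huniq : ∀ i E, S.IsGradientSolution d (W.Q i) (W.R i) (T lam) E →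
      E = S.toZXL (W.Q i) (W.R i) (D' i) := fun i E hE => by
    rw [hTC lam hlam] at hE
    rw [hE.eq_toZXL, DelaySystem.IsLinearized.unique hQ hR hC0 hCr
      (hE.isSymm_weights (isSymm_of_nonneg (hW.Q i).posSemidef.nonneg)) (hs i)
      (hE.isLinearized hR hC0) (hD' i)]
  have hgrad := DelaySystem.hasOrthantGradient_dualCost (S := S) (W := W) I hZ hX hL
  have hdual := DelaySystem.dualFunction_eq_dualCost (I := I) hw hd hW hlam hC0 hCr
  rw [← hTC lam hlam] at hdual
  refine ⟨?_, hdual.1, hdual.2, ⟨_, fun i => ⟨hsol i, huniq i, hZ.hasMatrixPartial hlam i,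
    hX.hasMatrixPartial hlam i, hL.hasMatrixPartial hlam i, hΥ.hasMatrixPartial hlam i,
    hM.hasMatrixPartial hlam i⟩, hgrad⟩, fun α _ lam' => ?_⟩
  · rw [hTC lam hlam]
    exact S.posDef_upsilon hR (hC0 _) (hC0 _)
  · rw [isProjectedGradientStep_iff hlam hgrad]
    refine forall_congr' fun i => ⟨fun h => ⟨_, hsol i, h⟩, ?_⟩
    rintro ⟨E, hE, h⟩
    rwa [huniq i E hE] at h
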